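/- **Setting.** Let $\beta>0$, $L>0$, $c^*>0$, and integers $d\ge 1$, $n\ge 2$. Let $\ell=\lfloor\beta\rfloor$ be the largest integer *strictly* less than $\beta$, and put $\ell_+=\max(\ell,1)$. Let $\mathcal P_{\mathcal H}(\beta,L)$ be the set of probability densities $f:\mathbb R^d\to\mathbb R$ that are supported on $[0,1]^d$, are $\ell$ times differentiable, and satisfy $|D^sf(x)-D^sf(y)|\le L|x-y|_2^{\beta-\ell}$ for all $x,y\in\mathbb R^d$ and all multi-indices $s$ with $|s|=\ell$. Let $\mathbb P_f,\mathbb E_f$ refer to $n$ i.i.d. draws from $f$, and let $\varepsilon=c^*n^{-\beta/(2\beta+d)}$. Let $\hat f$ be a density estimator (measurable in the sample at each point of $[0,1]^d$) such that for all $y\in[0,1]^d$ and $\varepsilon\le t\le 1$ $$\sup_{f\in\mathcal P_{\mathcal H}(\beta,L)}\mathbb P_f\big[|\hat f(y)-f(y)|>t\big]\le 2\exp(-t^2/\varepsilon^2).$$ Set $K=\lfloor n^{1/(2\beta+d)}\rfloor$ and divide $[0,1]^d$ into the $K^d$ sub-cubes $I_{\vec j}=\frac1K(\vec j+[0,1]^d)$,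 $\vec j\in\{0,\dots,K-1\}^d$. The mesh consists of the points $\frac1K(\vec j+\frac{s}{\ell})$, $s\in\mathbb Z_{\ge0}^d$, $|s|\le\ell$ (with $s/\ell:=0$ if $\ell=0$), i.e. of the rescaled $\ell$-th principal lattices of the sub-cubes. **Model.** Algorithms are programs of a unit-cost real random access machine (arithmetic on, and comparison of, reals and natural numbers; no rounding of reals). They are given $n,d,\ell,K,\binom{\ell+d}{d}$, the number of binary digits of $n$, and the real number $L$. A preprocessing program has oracle access to $\hat f$, each call taking time $Q$, and outputs a string of bits; a query program receives only that string and a point $y\in[0,1]^d$, and returns a real number $\tilde f(y)$. **Theorem.** There are an absolute constant $C$, one preprocessing program and one query program, the same for all $\beta,L,c^*,d,n,\hat f$, such that the resulting estimator $\tilde f$ has the following properties. 1. For every sample, $\tilde f$ is constructed in time at most $C\,Q\binom{\ell+d}{d}n^{d/(2\beta+d)}$ for every $Q\ge d+\log n$. At most $\binom{\ell+d}{d}n^{d/(2\beta+d)}$ queries of $\hat f$ are made, all at points of the mesh. 2. For every sample, at most $C\,d^2\ell_+^2\binom{\ell+d}{d}n^{d/(2\beta+d)}\log n$ bits are stored.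 3. For every sample and every $y\in[0,1]^d$, $\tilde f(y)$ is computed from the stored bits in time at most $C\,d\,\ell_+\binom{\ell+d}{d}\log n$. 4. For every sample, $\tilde f$ is on each sub-cube $I_{\vec j}$ a polynomial of degree at most $\ell$ whose values at the mesh points of $I_{\vec j}$ agree up to $L/n$ with the values of $\hat f$ truncated to $[0,L]$ (on common faces of sub-cubes, $\tilde f$ is given by the polynomial of one of them). For every $y\in[0,1]^d$, $\tilde f(y)$ is measurable in the sample. 5. If $\varepsilon\sqrt{\log\big(2\binom{\ell+d}{d}n^{\frac{d}{2\beta+d}+2}\big)}\le 1$ (for fixed $\beta,d,c^*$ this holds for all large $n$), then for every $f\in\mathcal P_{\mathcal H}(\beta,L)$ the norm $\|\tilde f-f\|_\infty=\sup_{y\in[0,1]^d}|\tilde f(y)-f(y)|$ is measurable in the sample and $$\mathbb E_f\|\tilde f-f\|_\infty<\tilde c\,(\log n)^{1/2}n^{-\frac{\beta}{2\beta+d}},\qquad \tilde c=10\binom{\ell+d}{\ell}^3(2\ell)^{2\ell}\Big\{c^*+\frac{Ld^\beta}{\ell!}\Big\}+2Ld^{\frac12(3\ell+1)},$$ where $0^0=1$.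 -/

import Mathlib

open MeasureTheory

namespace DensityInterp

/-! ## Hölder densities and the sampling model -/

/-- `d`-dimensional Euclidean space. -/
abbrev E (d : ℕ) : Type := EuclideanSpace ℝ (Fin d)

/-- The unit cube `[0,1]^d`. -/
def cube (d : ℕ) : Set (E d) := {y | ∀ i, 0 ≤ y i ∧ y i ≤ 1}

/-- The largest integer strictly less than `β` (for `β > 0`). -/
noncomputable def strictFloor (β : ℝ) : ℕ := ⌈β⌉₊ - 1

/-- The partial derivative `∂^ℓ f / ∂x_{i 0} ⋯ ∂x_{i (ℓ-1)}` at `x`. As `i` ranges over all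
sequences of length `ℓ`, these are all the `D^s f` with `|s| = ℓ`. -/
noncomputable def partialDeriv {d ℓ : ℕ} (f : E d → ℝ) (i : Fin ℓ → Fin d) (x : E d) : ℝ :=
  iteratedFDeriv ℝ ℓ f x (fun r => EuclideanSpace.single (i r) (1 : ℝ))

/-- Probability densities on `ℝ^d` that are supported on the unit cube and `L`-Hölder smooth of
order `β`: all partial derivatives of order `ℓ = strictFloor β` exist and are `(β - ℓ)`-Hölder
with constant `L` (hence are continuous). -/
structure IsHolderDensity (d : ℕ) (β L : ℝ) (f : E d → ℝ) : Prop where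
  supported : ∀ x, x ∉ cube d → f x = 0
  smooth : ContDiff ℝ (strictFloor β : ℕ) f
  holder : ∀ (i : Fin (strictFloor β) → Fin d) (x y : E d),
    |partialDeriv f i x - partialDeriv f i y| ≤ L * ‖x - y‖ ^ (β - (strictFloor β : ℝ))
  nonneg : ∀ x, 0 ≤ f x
  integral_eq_one : ∫ x, f x = 1

/-- Samples of size `n`. -/
abbrev Sample (n d : ℕ) : Type := Fin n → E d

/-- The law of `n` independent draws from the density `f`. -/
noncomputable def sampleLaw (n : ℕ) {d : ℕ} (f : E d → ℝ) : Measure (Sample n d) :=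
  Measure.pi fun _ => (volume : Measure (E d)).withDensity fun x => ENNReal.ofReal (f x)

/-- The rate `n^{-β/(2β+d)}`. -/
noncomputable def rate (n d : ℕ) (β : ℝ) : ℝ := (n : ℝ) ^ (-(β / (2 * β + d)))

/-- The pointwise error of the estimator `fhat` is sub-Gaussian at scale
`ε = cstar * n^{-β/(2β+d)}`, uniformly over the Hölder densities: for all `y` in the cube and
all `ε ≤ t ≤ 1` the probability of an error larger than `t` is at most `2 exp(-t²/ε²)`. -/
def TailBound {n d : ℕ} (β L cstar : ℝ) (fhat : Sample n d → E d → ℝ) : Prop :=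
  ∀ y ∈ cube d, ∀ t : ℝ, cstar * rate n d β ≤ t → t ≤ 1 →
    ∀ f : E d → ℝ, IsHolderDensity d β L f →
      sampleLaw n f {X | t < |fhat X y - f y|} ≤
        ENNReal.ofReal (2 * Real.exp (-(t ^ 2 / (cstar * rate n d β) ^ 2)))

/-- The supremum norm over the cube of the difference of two functions. -/
noncomputable def supDist {d : ℕ} (g f : E d → ℝ) : ENNReal :=
  ⨆ y ∈ cube d, ‖g y - f y‖ₑ

/-! ## The mesh -/

/-- The number `⌊n^{1/(2β+d)}⌋` of sub-cubes along each axis. -/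
noncomputable def gridSize (n d : ℕ) (β : ℝ) : ℕ := ⌊(n : ℝ) ^ (1 / (2 * β + d))⌋₊

/-- The closed sub-cube `(j + [0,1]^d) / K`. -/
def subCube {d : ℕ} (K : ℕ) (j : Fin d → Fin K) : Set (E d) :=
  {y | ∀ i, ((j i : ℕ) : ℝ) / K ≤ y i ∧ y i ≤ (((j i : ℕ) : ℝ) + 1) / K}

/-- The point `(j + s/ℓ) / K`. For `s` in `ℕ^d` with `|s| ≤ ℓ` the points `s/ℓ` form the `ℓ`-th
principal lattice of the simplex with vertices `0, e_1, …, e_d` (its barycentric coordinates are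
`s_i/ℓ` and `1 - |s|/ℓ`); for `ℓ = 0` the lattice is the origin. -/
noncomputable def meshPoint {d : ℕ} (ℓ K : ℕ) (j : Fin d → Fin K) (s : Fin d → ℕ) : E d :=
  WithLp.toLp 2 fun i => (((j i : ℕ) : ℝ) + (s i : ℝ) / ℓ) / K

/-- Truncation of a real number to `[0, L]`. -/
noncomputable def clip (L v : ℝ) : ℝ := max 0 (min v L)

/-! ## A real random access machine

The machine has arrays of natural numbers and arrays of real numbers, a read-only store of bits,
an output tape of bits and an oracle for a function on `ℝ^d`. Arithmetic operations, memory
accesses and comparisons have unit cost. Real numbers cannot be rounded or converted to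
natural numbers: they influence the natural numbers and the output through comparisons only. -/

/-- Natural number expressions; `stored i` is the `i`-th bit of the read-only store. -/
inductive NExp : Type
  | lit (c : ℕ)
  | get (a : ℕ) (i : NExp)
  | stored (i : NExp)
  | add (e e' : NExp)
  | sub (e e' : NExp)
  | mul (e e' : NExp)

/-- Real expressions. -/
inductive RExp : Type
  | ofNat (e : NExp)
  | get (a : ℕ) (i : NExp)
  | add (x x' : RExp)
  | sub (x x' : RExp)
  | mul (x x' : RExp)
  | div (x x' : RExp)

/-- Tests. -/
inductive Test : Type
  | natLE (e e' : NExp)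
  | realLE (x x' : RExp)

/-- Programs. `ask src dst i` calls the oracle at the point whose coordinates are the first `d`
entries of the real array `src` and puts the answer in entry `i` of the real array `dst`.
`emit e` appends a bit to the output, namely whether `e` is nonzero. `loop e c` repeats
`c` as often as the value of `e` on entry says. -/
inductive Prog : Type
  | skip
  | setNat (a : ℕ) (i e : NExp)
  | setReal (a : ℕ) (i : NExp) (x : RExp)
  | ask (src dst : ℕ) (i : NExp)
  | emit (e : NExp)
  | seq (c c' : Prog)
  | ite (b : Test) (c c' : Prog)
  | loop (e : NExp) (c : Prog)

/-- Configurations. `asked` records the points at which the oracle was called, `steps` the number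
of elementary steps so far; programs cannot read either of them. -/
structure Config (d : ℕ) : Type where
  nat : ℕ → ℕ → ℕ
  real : ℕ → ℕ → ℝ
  out : List Bool
  asked : List (E d)
  steps : ℕ

/-- Number of operations in an expression. -/
def NExp.cost : NExp → ℕ
  | lit _ => 1
  | get _ i => i.cost + 1
  | stored i => i.cost + 1
  | add e e' => e.cost + e'.cost + 1
  | sub e e' => e.cost + e'.cost + 1
  | mul e e' => e.cost + e'.cost + 1

/-- Number of operations in an expression. -/
def RExp.cost : RExp → ℕ
  | ofNat e => e.cost + 1
  | get _ i => i.cost + 1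
  | add x x' => x.cost + x'.cost + 1
  | sub x x' => x.cost + x'.cost + 1
  | mul x x' => x.cost + x'.cost + 1
  | div x x' => x.cost + x'.cost + 1

/-- Number of operations in a test. -/
def Test.cost : Test → ℕ
  | natLE e e' => e.cost + e'.cost + 1
  | realLE x x' => x.cost + x'.cost + 1

/-- Value of a natural number expression (subtraction is truncated at `0`, and bits beyond the
end of the store are `0`). -/
def NExp.eval {d : ℕ} (store : List Bool) (σ : Config d) : NExp → ℕ
  | lit c => c
  | get a i => σ.nat a (i.eval store σ)
  | stored i => if store.getD (i.eval store σ) false then 1 else 0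
  | add e e' => e.eval store σ + e'.eval store σ
  | sub e e' => e.eval store σ - e'.eval store σ
  | mul e e' => e.eval store σ * e'.eval store σ

/-- Value of a real expression (division by `0` gives `0`). -/
noncomputable def RExp.eval {d : ℕ} (store : List Bool) (σ : Config d) : RExp → ℝ
  | ofNat e => (e.eval store σ : ℝ)
  | get a i => σ.real a (i.eval store σ)
  | add x x' => x.eval store σ + x'.eval store σ
  | sub x x' => x.eval store σ - x'.eval store σ
  | mul x x' => x.eval store σ * x'.eval store σ
  | div x x' => x.eval store σ / x'.eval store σ

/-- Whether a test succeeds. -/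
def Test.holds {d : ℕ} (store : List Bool) (σ : Config d) : Test → Prop
  | natLE e e' => e.eval store σ ≤ e'.eval store σ
  | realLE x x' => x.eval store σ ≤ x'.eval store σ

/-- Count `k` further steps. -/
def Config.tick {d : ℕ} (k : ℕ) (σ : Config d) : Config d := { σ with steps := σ.steps + k }

/-- Overwrite entry `i` of array `a`. -/
def write {α : Type} (m : ℕ → ℕ → α) (a i : ℕ) (v : α) : ℕ → ℕ → α :=
  Function.update m a (Function.update (m a) i v)

open Classical in
/-- The effect of a program, with the oracle `g` and the given read-only store. -/
noncomputable def Prog.run {d : ℕ} (g : E d → ℝ) (store : List Bool) :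
    Prog → Config d → Config d
  | skip, σ => σ
  | setNat a i e, σ =>
      { σ.tick (i.cost + e.cost + 1) with
        nat := write σ.nat a (i.eval store σ) (e.eval store σ) }
  | setReal a i x, σ =>
      { σ.tick (i.cost + x.cost + 1) with
        real := write σ.real a (i.eval store σ) (x.eval store σ) }
  | ask src dst i, σ =>
      let u : E d := WithLp.toLp 2 fun k => σ.real src k
      { σ.tick (i.cost + 1) with
        real := write σ.real dst (i.eval store σ) (g u)
        asked := σ.asked ++ [u] }
  | emit e, σ =>
      { σ.tick (e.cost + 1) with out := σ.out ++ [decide (e.eval store σ ≠ 0)] }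
  | seq c c', σ => c'.run g store (c.run g store σ)
  | ite b c c', σ =>
      if b.holds store σ then c.run g store (σ.tick (b.cost + 1))
      else c'.run g store (σ.tick (b.cost + 1))
  | loop e c, σ =>
      (fun τ => c.run g store (τ.tick 1))^[e.eval store σ] (σ.tick (e.cost + 1))

/-- Initial configuration. The natural array `0` starts with the sample size `n`, the dimension
`d`, the degree `ℓ`, the number `K` of sub-cubes per axis, the number `binom(ℓ+d, d)` of lattice
points and the number of binary digits of `n`. The real array `0` starts with `L`, and the real
array `1` with the coordinates of the input point `y`. Everything else is `0`. -/
noncomputable def start (n d ℓ K : ℕ) (L : ℝ) (y : E d) : Config d where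
  nat := fun a i => if a = 0 then [n, d, ℓ, K, (ℓ + d).choose d, n.size].getD i 0 else 0
  real := fun a i =>
    if a = 0 ∧ i = 0 then L else if h : a = 1 ∧ i < d then y ⟨i, h.2⟩ else 0
  out := []
  asked := []
  steps := 0

/-- The final configuration of the preprocessing program, run with oracle access to the function
`g`. -/
noncomputable def preprocess (pre : Prog) (n d : ℕ) (β L : ℝ) (g : E d → ℝ) : Config d :=
  pre.run g [] (start n d (strictFloor β) (gridSize n d β) L 0)

/-- The final configuration of the query program at the point `y`. It has access to the stored
bits only (its oracle is identically `0`). -/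
noncomputable def evaluate (qry : Prog) (n d : ℕ) (β L : ℝ) (bits : List Bool) (y : E d) :
    Config d :=
  qry.run (fun _ => 0) bits (start n d (strictFloor β) (gridSize n d β) L y)

/-- The function computed by preprocessing `g` and querying the stored bits: the query
program leaves its answer in entry `0` of the real array `2`. -/
noncomputable def compressed (pre qry : Prog) (n d : ℕ) (β L : ℝ) (g : E d → ℝ) (y : E d) : ℝ :=
  (evaluate qry n d β L (preprocess pre n d β L g).out y).real 2 0

/-- Total running time of a computation if each oracle call takes time `Q`. -/
def Config.time {d : ℕ} (Q : ℝ) (σ : Config d) : ℝ := σ.steps + Q * σ.asked.length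

/-- `ftilde` is a piecewise polynomial interpolant of `g`, truncated to `[0, L]`, on the mesh
with `K` sub-cubes per axis: on each sub-cube it is a polynomial of degree at most `ℓ` whose values
on the rescaled principal lattice agree with those of the truncation of `g` up to `δ`. (On a common
face of several sub-cubes the polynomial of any one of them may be used.) -/
def IsInterpolant {d : ℕ} (ℓ K : ℕ) (L δ : ℝ) (g ftilde : E d → ℝ) : Prop :=
  ∃ q : (Fin d → Fin K) → MvPolynomial (Fin d) ℝ,
    (∀ j, (q j).totalDegree ≤ ℓ) ∧
    (∀ j (s : Fin d → ℕ), ∑ i, s i ≤ ℓ →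
      |MvPolynomial.eval (fun i => meshPoint ℓ K j s i) (q j) - clip L (g (meshPoint ℓ K j s))|
        ≤ δ) ∧
    ∀ y ∈ cube d, ∃ j, y ∈ subCube K j ∧ ftilde y = MvPolynomial.eval (fun i => y i) (q j)

/-- The number `binom(ℓ+d, d) * n^{d/(2β+d)}` of mesh points, up to rounding. -/
noncomputable def meshCount (n d : ℕ) (β : ℝ) : ℝ :=
  ((strictFloor β + d).choose d : ℝ) * (n : ℝ) ^ ((d : ℝ) / (2 * β + d))

/-- The constant in the risk bound, with `ℓ = strictFloor β`:
`10 binom(ℓ+d, ℓ)^3 (2ℓ)^{2ℓ} (cstar + L d^β / ℓ!) + 2 L d^{(3ℓ+1)/2}`, where `0^0 = 1`. -/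
noncomputable def riskConst (d : ℕ) (β L cstar : ℝ) : ℝ :=
  10 * ((strictFloor β + d).choose (strictFloor β) : ℝ) ^ 3
      * (2 * (strictFloor β : ℝ)) ^ (2 * strictFloor β)
      * (cstar + L * (d : ℝ) ^ β / ((strictFloor β).factorial : ℝ))
    + 2 * L * (d : ℝ) ^ ((3 * (strictFloor β : ℝ) + 1) / 2)

end DensityInterp

/-!
On every sub-cube interpolate `f̂`, truncated to `[0, L]` and rounded down to a multiple of
`L / 2 ^ b`, where `b` is the number of binary digits of `n`, so that the rounding error is below
`L / n`. Interpolation on the principal lattice is linear in the values, bounded by the Lebesgue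
constant, and reproduces polynomials of degree at most `ℓ`, in particular the Taylor polynomial of
`f` at `y`. Hence the error at `y` is at most the Lebesgue constant times the sum of the largest
error at the mesh points and the largest Taylor remainder. By a union bound over the at most `M`
mesh points, the error of `f̂` at one of them exceeds `t = ε √(log (2 M n²))` with probability at
most `n⁻²`, and even then the truncated values are off by at most `L`.

The programs run through the mesh without tables: a successor rule enumerates the weak compositions
of `ℓ` into `d + 1` parts, the sub-cubes are counted in base `K`, and the sub-cube of a query point
is found by binary search, since the machine cannot round.
-/

namespace DensityInterp

section Machine

/-- The parts of a configuration on which a program can act. They serve to record which parts a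
program leaves alone. -/
inductive Region : Type
  | nat (a : ℕ)
  | real (a : ℕ)
  | out
  | asked
  deriving DecidableEq

/-- Two configurations agree on a region. -/
def Region.Agree {d : ℕ} (σ τ : Config d) : Region → Prop
  | nat a => τ.nat a = σ.nat a
  | real a => τ.real a = σ.real a
  | out => τ.out = σ.out
  | asked => τ.asked = σ.asked

/-- Whether an instruction of the program acts on the region `r`. -/
def Prog.writes (r : Region) : Prog → Bool
  | skip => false
  | setNat a _ _ => r = .nat a
  | setReal a _ _ => r = .real a
  | ask _ a _ => r = .real a ∨ r = .asked
  | emit _ => r = .out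
  | seq c c' => c.writes r || c'.writes r
  | ite _ c c' => c.writes r || c'.writes r
  | loop _ c => c.writes r

/-- The configurations `σ` and `τ` agree on everything that the program `c` does not act on. -/
def Frame {d : ℕ} (c : Prog) (σ τ : Config d) : Prop :=
  ∀ r, c.writes r = false → r.Agree σ τ

/-- Expressions that read only the input array, the array `0` of natural numbers. -/
def NExp.isStatic : NExp → Bool
  | lit _ => true
  | get a i => a == 0 && i.isStatic
  | stored _ => false
  | add e e' => e.isStatic && e'.isStatic
  | sub e e' => e.isStatic && e'.isStatic
  | mul e e' => e.isStatic && e'.isStatic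

/-- Programs all of whose loops have lengths that depend on the input array only. Their running
time is bounded by a function of the input array. -/
def Prog.isStatic : Prog → Bool
  | skip | setNat .. | setReal .. | ask .. | emit .. => true
  | seq c c' => c.isStatic && c'.isStatic
  | ite _ c c' => c.isStatic && c'.isStatic
  | loop e c => e.isStatic && c.isStatic

theorem write_apply {α : Type} (m : ℕ → ℕ → α) (a i : ℕ) (v : α) (b k : ℕ) :
    write m a i v b k = if b = a ∧ k = i then v else m b k := by
  unfold write
  rcases eq_or_ne b a with rfl | hb
  · rcases eq_or_ne k i with rfl | hk <;> simp [*]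
  · simp [hb]

theorem write_of_ne {α : Type} (m : ℕ → ℕ → α) {a b : ℕ} (h : b ≠ a) (i : ℕ) (v : α) :
    write m a i v b = m b :=
  Function.update_of_ne h _ _

theorem iterate_induction {α : Type*} (f : α → α) (I : ℕ → α → Prop) {N : ℕ} {x : α} (h0 : I 0 x)
    (hs : ∀ i < N, ∀ y, I i y → I (i + 1) (f y)) : I N (f^[N] x) := by
  induction N with
  | zero => exact h0
  | succ N ih =>
    rw [Function.iterate_succ_apply']
    exact hs N (Nat.lt_succ_self N) _ (ih fun i hi => hs i (Nat.lt_succ_of_lt hi))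

namespace Frame

variable {d : ℕ} {c c' : Prog} {σ τ υ : Config d}

theorem nat (h : Frame c σ τ) (a : ℕ) (ha : c.writes (.nat a) = false) : τ.nat a = σ.nat a :=
  h _ ha

theorem real (h : Frame c σ τ) (a : ℕ) (ha : c.writes (.real a) = false) : τ.real a = σ.real a :=
  h _ ha

theorem out (h : Frame c σ τ) (hc : c.writes .out = false) : τ.out = σ.out := h _ hc

theorem asked (h : Frame c σ τ) (hc : c.writes .asked = false) : τ.asked = σ.asked := h _ hc

theorem trans (h : Frame c σ τ) (h' : Frame c τ υ) : Frame c σ υ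
  | .nat a, ha => (h' (.nat a) ha).trans (h (.nat a) ha)
  | .real a, ha => (h' (.real a) ha).trans (h (.real a) ha)
  | .out, ha => (h' .out ha).trans (h .out ha)
  | .asked, ha => (h' .asked ha).trans (h .asked ha)

theorem tick (c : Prog) (σ : Config d) (k : ℕ) : Frame c σ (σ.tick k) := by
  rintro (a | a | _ | _) _ <;> rfl

theorem mono (h : Frame c σ τ) (hcc' : ∀ r, c'.writes r = false → c.writes r = false) :
    Frame c' σ τ :=
  fun r hr => h r (hcc' r hr)

end Frame

variable {d : ℕ} (g : E d → ℝ) (st : List Bool)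

theorem Prog.run_seq (c c' : Prog) (σ : Config d) :
    (Prog.seq c c').run g st σ = c'.run g st (c.run g st σ) := rfl

theorem Prog.frame (c : Prog) (σ : Config d) : Frame c σ (c.run g st σ) := by
  induction c generalizing σ with
  | skip => exact Frame.tick .skip σ 0
  | setNat a i e | setReal a i x | ask s a i | emit e =>
    rintro (b | b | _ | _) hr <;>
      first | rfl | simp_all [writes, Region.Agree, run, write_of_ne, Config.tick]
  | seq c c' ih ih' =>
    exact ((ih σ).mono fun r hr => by simp_all [writes]).trans
      ((ih' _).mono fun r hr => by simp_all [writes])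
  | ite b c c' ih ih' =>
    refine (Frame.tick _ σ (b.cost + 1)).trans ?_
    by_cases hb : b.holds st σ
    · simpa only [run, if_pos hb] using (ih _).mono fun r hr => by simp_all [writes]
    · simpa only [run, if_neg hb] using (ih' _).mono fun r hr => by simp_all [writes]
  | loop e c ih =>
    exact iterate_induction _ (fun _ τ => Frame (.loop e c) σ τ) (Frame.tick _ σ _) fun i _ τ hτ =>
      hτ.trans ((Frame.tick _ τ 1).trans (ih _))

theorem Prog.run_loop_induction {e : NExp} (c : Prog) {σ : Config d} {N : ℕ}
    (hN : e.eval st σ = N) (I : ℕ → Config d → Prop) (h0 : I 0 (σ.tick (e.cost + 1)))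
    (hs : ∀ i < N, ∀ τ, Frame c σ τ → I i τ → I (i + 1) (c.run g st (τ.tick 1))) :
    I N ((Prog.loop e c).run g st σ) := by
  subst hN
  have hinv := iterate_induction (fun τ => c.run g st (τ.tick 1))
    (fun i τ => Frame c σ τ ∧ I i τ) (N := e.eval st σ) (x := σ.tick (e.cost + 1))
    ⟨Frame.tick c σ _, h0⟩ fun i hi τ hτ =>
      ⟨hτ.1.trans ((Frame.tick c τ 1).trans (Prog.frame g st c _)), hs i hi τ hτ.1 hτ.2⟩
  exact hinv.2

theorem NExp.eval_eq_of_isStatic {e : NExp} (he : e.isStatic) {σ τ : Config d}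
    (h : τ.nat 0 = σ.nat 0) : e.eval st τ = e.eval st σ := by
  induction e with
  | lit c => rfl
  | get a i ih =>
    obtain ⟨rfl, hi⟩ : a = 0 ∧ i.isStatic := by simpa [isStatic] using he
    simp only [eval, ih hi, h]
  | stored i => simp [isStatic] at he
  | add e e' ih ih' | sub e e' ih ih' | mul e e' ih ih' =>
    obtain ⟨he, he'⟩ : e.isStatic ∧ e'.isStatic := by simpa [isStatic] using he
    simp only [eval, ih he, ih' he']

/-- A bound for the running time of a static program that starts with the input array of `σ`. -/
def Prog.stepBound (σ : Config d) : Prog → ℕ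
  | skip => 0
  | setNat _ i e => i.cost + e.cost + 1
  | setReal _ i x => i.cost + x.cost + 1
  | ask _ _ i => i.cost + 1
  | emit e => e.cost + 1
  | seq c c' => c.stepBound σ + c'.stepBound σ
  | ite b c c' => b.cost + 1 + max (c.stepBound σ) (c'.stepBound σ)
  | loop e c => e.cost + 1 + e.eval st σ * (1 + c.stepBound σ)

theorem Prog.steps_run_le {c : Prog} (hc : c.isStatic)
    (hw : c.writes (.nat 0) = false) {σ₀ σ : Config d} (h : σ.nat 0 = σ₀.nat 0) :
    (c.run g st σ).steps ≤ σ.steps + c.stepBound st σ₀ := by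
  induction c generalizing σ with
  | skip | setNat a i e | setReal a i e | ask s a i | emit e => simp [run, stepBound, Config.tick]
  | seq c c' ih ih' =>
    simp only [isStatic, writes, Bool.and_eq_true, Bool.or_eq_false_iff] at hc hw
    have first := ih hc.1 hw.1 h
    have second := ih' hc.2 hw.2 (((Prog.frame g st c σ).nat 0 hw.1).trans h)
    simp only [run, stepBound]
    omega
  | ite b c c' ih ih' =>
    simp only [isStatic, writes, Bool.and_eq_true, Bool.or_eq_false_iff] at hc hw
    have yes := ih hc.1 hw.1 (σ := σ.tick (b.cost + 1)) h
    have no := ih' hc.2 hw.2 (σ := σ.tick (b.cost + 1)) h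
    simp only [run, stepBound, Config.tick] at *
    split_ifs <;> omega
  | loop e c ih =>
    simp only [isStatic, writes, Bool.and_eq_true] at hc hw
    have hinv := Prog.run_loop_induction g st c (NExp.eval_eq_of_isStatic st hc.1 h)
      (fun i τ => τ.steps ≤ σ.steps + (e.cost + 1) + i * (1 + c.stepBound st σ₀))
      (by simp [Config.tick]) fun i _ τ hF hτ => by
        have body := ih hc.2 hw (σ := τ.tick 1) ((hF.nat 0 hw).trans h)
        simp only [Config.tick] at body ⊢
        rw [Nat.add_mul]
        omega
    simp only [stepBound]
    omega

end Machine

infixr:50 ";;" => Prog.seq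

/-- The natural scalar variable `a`, which is entry `0` of the array `a`. -/
abbrev NExp.var (a : ℕ) : NExp := .get a (.lit 0)

/-- The real scalar variable `a`, which is entry `0` of the real array `a`. -/
abbrev RExp.var (a : ℕ) : RExp := .get a (.lit 0)

/-- Assignment to a natural scalar variable. -/
abbrev Prog.assign (a : ℕ) (e : NExp) : Prog := .setNat a (.lit 0) e

/-- Assignment to a real scalar variable. -/
abbrev Prog.assignReal (a : ℕ) (x : RExp) : Prog := .setReal a (.lit 0) x

/-- Runs `c` with the variable `v` counting up from `0`, as often as `e` says once `v` has been
reset. -/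
def Prog.forLoop (v : ℕ) (e : NExp) (c : Prog) : Prog :=
  assign v (.lit 0) ;; loop e (c ;; assign v (.add (.var v) (.lit 1)))

theorem Prog.run_forLoop_induction {d : ℕ} (g : E d → ℝ) (st : List Bool) {v : ℕ} {e : NExp}
    {c : Prog} {σ : Config d} {N : ℕ} (hv : c.writes (.nat v) = false)
    (hN : ∀ τ, Frame (assign v (.lit 0)) σ τ → e.eval st τ = N) (I : ℕ → Config d → Prop)
    (hI : ∀ i τ υ, Frame (assign v (.lit 0)) τ υ → I i τ → I i υ) (h0 : I 0 σ)
    (hs : ∀ i < N, ∀ τ, Frame (forLoop v e c) σ τ → τ.nat v 0 = i → I i τ →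
      I (i + 1) (c.run g st τ)) :
    I N ((forLoop v e c).run g st σ) := by
  set reset : Prog := assign v (.lit 0)
  set σ₀ := reset.run g st σ
  have hσ₀ : Frame reset σ σ₀ := frame g st _ σ
  have widen {τ υ : Config d} (h : Frame reset τ υ) : Frame (forLoop v e c) τ υ :=
    h.mono fun r hr => by simp_all [writes, forLoop, reset]
  refine (run_loop_induction g st (c ;; assign v (.add (.var v) (.lit 1))) (hN σ₀ hσ₀)
    (fun i τ => τ.nat v 0 = i ∧ I i τ) ⟨?_, hI _ _ _ (hσ₀.trans (Frame.tick _ _ _)) h0⟩ ?_).2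
  · simp [σ₀, reset, run, Config.tick, NExp.eval, write_apply]
  · rintro i hi τ hF ⟨hvi, hIi⟩
    have hτ : Frame (forLoop v e c) σ τ :=
      (widen hσ₀).trans (hF.mono fun r hr => by simp_all [writes, forLoop])
    have hstep := hs i hi (τ.tick 1) (hτ.trans (Frame.tick _ _ _)) hvi
      (hI _ _ _ (Frame.tick _ _ _) hIi)
    have hcount : (c.run g st (τ.tick 1)).nat v 0 = i := by
      rw [(frame g st c (τ.tick 1)).nat v hv]
      exact hvi
    refine ⟨?_, hI _ _ _ (frame g st (assign v (.add (.var v) (.lit 1))) _) hstep⟩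
    simpa [run, NExp.eval, write_apply] using hcount

theorem Prog.steps_run_forLoop_le {d : ℕ} (g : E d → ℝ) (st : List Bool) {v : ℕ} {e : NExp}
    {c : Prog} {σ : Config d} {N : ℕ} (hv : c.writes (.nat v) = false)
    (hN : ∀ τ, Frame (assign v (.lit 0)) σ τ → e.eval st τ = N) (B : ℕ → ℕ)
    (hs : ∀ i < N, ∀ τ, Frame (forLoop v e c) σ τ → τ.nat v 0 = i →
      (c.run g st τ).steps ≤ τ.steps + B i) :
    ((forLoop v e c).run g st σ).steps ≤
      σ.steps + (e.cost + 4) + ∑ i ∈ Finset.range N, (B i + 7) := by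
  set reset : Prog := assign v (.lit 0)
  set σ₀ := reset.run g st σ
  have hσ₀ : Frame reset σ σ₀ := frame g st _ σ
  refine (run_loop_induction g st (c ;; assign v (.add (.var v) (.lit 1))) (hN σ₀ hσ₀)
    (fun i τ => τ.nat v 0 = i ∧
      τ.steps ≤ σ.steps + (e.cost + 4) + ∑ i ∈ Finset.range i, (B i + 7)) ⟨?_, ?_⟩ ?_).2
  · simp [σ₀, reset, run, Config.tick, NExp.eval, write_apply]
  · simp only [σ₀, reset, run, Config.tick, NExp.cost, Finset.range_zero, Finset.sum_empty]
    omega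
  · rintro i hi τ hF ⟨hvi, hle⟩
    have hτ : Frame (forLoop v e c) σ τ :=
      (hσ₀.mono fun r hr => by simp_all [writes, forLoop, reset]).trans
        (hF.mono fun r hr => by simp_all [writes, forLoop])
    have hstep := hs i hi (τ.tick 1) (hτ.trans (Frame.tick _ _ _)) hvi
    have hcount : (c.run g st (τ.tick 1)).nat v 0 = i := by
      rw [(frame g st c (τ.tick 1)).nat v hv]
      exact hvi
    refine ⟨by simpa [run, NExp.eval, write_apply] using hcount, ?_⟩
    simp only [run, Config.tick, NExp.cost, Finset.sum_range_succ] at hstep ⊢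
    omega

section WeakCompositions

/-- The weak compositions `s 0 + ⋯ + s d = ℓ`, extended by zero. They index the points of the
`ℓ`-th principal lattice of a simplex of dimension `d` by their barycentric coordinates `s / ℓ`. -/
abbrev weakComps (d ℓ : ℕ) : Finset (ℕ → ℕ) := Finset.piAntidiag (Finset.range (d + 1)) ℓ

/-- The weak compositions in the order in which the programs go through them: `(ℓ, 0, …, 0)` comes
first, and those with a small last part come before those with a large one. -/
def weakCompList : ℕ → ℕ → List (ℕ → ℕ)
  | 0, ℓ => [Pi.single 0 ℓ]
  | _ + 1, 0 => [0]
  | d + 1, ℓ + 1 => weakCompList d (ℓ + 1) ++ (weakCompList (d + 1) ℓ).map (· + Pi.single (d + 1) 1)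

/-- Entry `i` of `weakCompList`; it is the zero function when `i` is out of range. -/
def weakComp (d ℓ i : ℕ) : ℕ → ℕ := (weakCompList d ℓ).getD i 0

/-- The rule that leads from one entry of `weakCompList` to the next: if `a h` is the first nonzero
part, one unit of it moves to the place `h + 1` and the others move to the place `0`. -/
def NextWeakComp (d : ℕ) (a b : ℕ → ℕ) : Prop :=
  ∃ h < d, (∀ i < h, a i = 0) ∧ 0 < a h ∧
    b = Function.update (Function.update (Function.update a h 0) 0 (a h - 1))
      (h + 1) (a (h + 1) + 1)

variable {d ℓ k : ℕ} {s : ℕ → ℕ}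

theorem mem_weakComps :
    s ∈ weakComps d ℓ ↔ ∑ i ∈ Finset.range (d + 1), s i = ℓ ∧ ∀ i, s i ≠ 0 → i ≤ d := by
  simp only [Finset.mem_piAntidiag, Finset.mem_range, Nat.lt_succ_iff]

theorem sub_single_add_single (h : s k ≠ 0) : s - Pi.single k 1 + Pi.single k 1 = s := by
  funext i
  rcases eq_or_ne i k with rfl | hik
  · simpa using Nat.sub_add_cancel (Nat.pos_of_ne_zero h)
  · simp [hik]

theorem mem_weakComps_succ_left (hs : s (d + 1) = 0) :
    s ∈ weakComps (d + 1) ℓ ↔ s ∈ weakComps d ℓ := by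
  rw [mem_weakComps, mem_weakComps, Finset.sum_range_succ, hs, add_zero]
  refine and_congr_right fun _ => forall₂_congr fun i hi => ⟨fun h => ?_, fun h => by omega⟩
  have : i ≠ d + 1 := by rintro rfl; exact hi hs
  omega

theorem add_single_mem_weakComps (hk : k ≤ d) :
    s + Pi.single k 1 ∈ weakComps d (ℓ + 1) ↔ s ∈ weakComps d ℓ := by
  have hsum : ∑ i ∈ Finset.range (d + 1), (Pi.single k 1 : ℕ → ℕ) i = 1 := by
    rw [Finset.sum_pi_single', if_pos (Finset.mem_range.2 (Nat.lt_succ_of_le hk))]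
  simp only [mem_weakComps, Pi.add_apply, Finset.sum_add_distrib, hsum, Nat.add_right_cancel_iff]
  refine and_congr_right fun _ => forall_congr' fun i => ?_
  rcases eq_or_ne i k with rfl | hik
  · simp [hk]
  · simp [hik]

theorem sub_single_mem_weakComps (h : s k ≠ 0) (hs : s ∈ weakComps d (ℓ + 1)) :
    s - Pi.single k 1 ∈ weakComps d ℓ := by
  rwa [← add_single_mem_weakComps ((mem_weakComps.1 hs).2 k h), sub_single_add_single h]

theorem le_of_mem_weakComps (hs : s ∈ weakComps d ℓ) (k : ℕ) : s k ≤ ℓ := by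
  obtain ⟨hsum, hsupp⟩ := mem_weakComps.1 hs
  by_cases h : s k = 0
  · omega
  · exact hsum ▸ Finset.single_le_sum (fun i _ => Nat.zero_le (s i))
      (Finset.mem_range.2 (Nat.lt_succ_of_le (hsupp k h)))

theorem sum_tail_le_of_mem_weakComps (hs : s ∈ weakComps d ℓ) : ∑ k : Fin d, s (k + 1) ≤ ℓ := by
  have hsum := (mem_weakComps.1 hs).1
  rw [Finset.sum_range_succ', Finset.sum_range] at hsum
  omega

theorem length_weakCompList (d ℓ : ℕ) : (weakCompList d ℓ).length = (ℓ + d).choose d := by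
  induction d generalizing ℓ with
  | zero => simp [weakCompList]
  | succ d ihd =>
    induction ℓ with
    | zero => simp [weakCompList]
    | succ ℓ ihℓ =>
      rw [weakCompList, List.length_append, List.length_map, ihd, ihℓ,
        show ℓ + 1 + (d + 1) = (ℓ + (d + 1)) + 1 by ring, Nat.choose_succ_succ,
        show ℓ + 1 + d = ℓ + (d + 1) by ring]

theorem head?_weakCompList (d ℓ : ℕ) : (weakCompList d ℓ).head? = some (Pi.single 0 ℓ) := by
  induction d generalizing ℓ with
  | zero => simp [weakCompList]
  | succ d ih => cases ℓ <;> simp [weakCompList, ih]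

theorem getLast?_weakCompList (d ℓ : ℕ) : (weakCompList d ℓ).getLast? = some (Pi.single d ℓ) := by
  cases d with
  | zero => simp [weakCompList]
  | succ d =>
    induction ℓ with
    | zero => simp [weakCompList]
    | succ ℓ ih => simp [weakCompList, ih, ← Pi.single_add]

theorem mem_weakCompList : s ∈ weakCompList d ℓ ↔ s ∈ weakComps d ℓ := by
  induction d generalizing ℓ s with
  | zero =>
    rw [weakCompList, List.mem_singleton, mem_weakComps, zero_add, Finset.sum_range_one]
    constructor
    · rintro rfl
      exact ⟨by simp, fun i => by simp +contextual [Pi.single_apply]⟩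
    · rintro ⟨rfl, h⟩
      funext i
      rcases eq_or_ne i 0 with rfl | hi
      · simp
      · simpa [hi] using mt (h i) (by omega)
  | succ d ihd =>
    induction ℓ generalizing s with
    | zero => simp [weakCompList, Finset.piAntidiag_zero]
    | succ ℓ ihℓ =>
      simp only [weakCompList, List.mem_append, List.mem_map, ihd, ihℓ]
      constructor
      · rintro (hs | ⟨t, ht, rfl⟩)
        · have hlast : s (d + 1) = 0 := by
            by_contra h
            exact absurd ((mem_weakComps.1 hs).2 _ h) (by omega)
          exact (mem_weakComps_succ_left hlast).2 hs
        · exact (add_single_mem_weakComps le_rfl).2 ht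
      · intro hs
        by_cases hlast : s (d + 1) = 0
        · exact .inl ((mem_weakComps_succ_left hlast).1 hs)
        · exact .inr ⟨_, sub_single_mem_weakComps hlast hs, sub_single_add_single hlast⟩

theorem nodup_weakCompList (d ℓ : ℕ) : (weakCompList d ℓ).Nodup := by
  induction d generalizing ℓ with
  | zero => simp [weakCompList]
  | succ d ihd =>
    induction ℓ with
    | zero => simp [weakCompList]
    | succ ℓ ihℓ =>
      rw [weakCompList]
      refine List.Nodup.append (ihd _) (ihℓ.map (add_left_injective _)) fun s hs hs' => ?_
      obtain ⟨t, -, rfl⟩ := List.mem_map.1 hs'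
      exact absurd ((mem_weakComps.1 (mem_weakCompList.1 hs)).2 (d + 1) (by simp)) (by omega)

theorem toFinset_weakCompList [DecidableEq (ℕ → ℕ)] (d ℓ : ℕ) :
    (weakCompList d ℓ).toFinset = weakComps d ℓ := by
  ext s
  rw [List.mem_toFinset, mem_weakCompList]

theorem card_weakComps (d ℓ : ℕ) : (weakComps d ℓ).card = (ℓ + d).choose d := by
  classical
  rw [← toFinset_weakCompList, List.toFinset_card_of_nodup (nodup_weakCompList d ℓ),
    length_weakCompList]

namespace NextWeakComp

variable {a b : ℕ → ℕ}

theorem succ (h : NextWeakComp d a b) : NextWeakComp (d + 1) a b :=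
  let ⟨i, hi, h'⟩ := h
  ⟨i, Nat.lt_succ_of_lt hi, h'⟩

theorem add_single (h : NextWeakComp d a b) :
    NextWeakComp d (a + Pi.single d 1) (b + Pi.single d 1) := by
  obtain ⟨h, hd, h0, hp, rfl⟩ := h
  refine ⟨h, hd, fun i hi => by simp [h0 i hi, (hi.trans hd).ne], by simp [hp], ?_⟩
  funext i
  simp only [Pi.add_apply, Function.update_apply, Pi.single_apply]
  grind

theorem single_single (d ℓ : ℕ) :
    NextWeakComp (d + 1) (Pi.single d (ℓ + 1)) (Pi.single 0 ℓ + Pi.single (d + 1) 1) := by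
  refine ⟨d, Nat.lt_succ_self d, fun i hi => by simp [hi.ne], by simp, ?_⟩
  funext i
  simp only [Pi.add_apply, Function.update_apply, Pi.single_apply]
  grind

end NextWeakComp

theorem isChain_weakCompList (d ℓ : ℕ) : (weakCompList d ℓ).IsChain (NextWeakComp d) := by
  induction d generalizing ℓ with
  | zero => simp [weakCompList]
  | succ d ihd =>
    induction ℓ with
    | zero => simp [weakCompList]
    | succ ℓ ihℓ =>
      rw [weakCompList, List.isChain_append, List.isChain_map, List.head?_map,
        getLast?_weakCompList, head?_weakCompList]
      refine ⟨(ihd _).imp fun _ _ => NextWeakComp.succ, ihℓ.imp fun _ _ => NextWeakComp.add_single,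
        ?_⟩
      rintro _ ⟨⟩ _ ⟨⟩
      exact NextWeakComp.single_single d ℓ

theorem weakComp_zero (d ℓ : ℕ) : weakComp d ℓ 0 = Pi.single 0 ℓ := by
  rw [weakComp, ← List.headD_eq_getD, List.headD_eq_head?_getD, head?_weakCompList,
    Option.getD_some]

theorem weakComp_eq_getElem {i : ℕ} (hi : i < (weakCompList d ℓ).length) :
    weakComp d ℓ i = (weakCompList d ℓ)[i] :=
  List.getD_eq_getElem _ _ hi

theorem nextWeakComp_weakComp {i : ℕ} (hi : i + 1 < (ℓ + d).choose d) :
    NextWeakComp d (weakComp d ℓ i) (weakComp d ℓ (i + 1)) := by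
  rw [← length_weakCompList] at hi
  rw [weakComp_eq_getElem hi, weakComp_eq_getElem (Nat.lt_of_succ_lt hi)]
  exact List.isChain_iff_getElem.1 (isChain_weakCompList d ℓ) i hi

theorem weakComp_mem {i : ℕ} (hi : i < (ℓ + d).choose d) : weakComp d ℓ i ∈ weakComps d ℓ := by
  rw [← length_weakCompList] at hi
  rw [← mem_weakCompList, weakComp_eq_getElem hi]
  exact List.getElem_mem hi

theorem sum_weakComp {M : Type*} [AddCommMonoid M] (d ℓ : ℕ) (F : (ℕ → ℕ) → M) :
    ∑ i ∈ Finset.range ((ℓ + d).choose d), F (weakComp d ℓ i) = ∑ s ∈ weakComps d ℓ, F s := by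
  classical
  rw [← toFinset_weakCompList, List.sum_toFinset _ (nodup_weakCompList d ℓ), ← length_weakCompList,
    Finset.sum_range, ← Fin.sum_univ_fun_getElem]
  exact Finset.sum_congr rfl fun i _ => congrArg F (weakComp_eq_getElem i.2)

end WeakCompositions

section BinaryDigits

/-- What is left of `v` after the removal of its first `m` binary digits relative to `L`. -/
noncomputable def remainder (L v : ℝ) : ℕ → ℝ
  | 0 => v
  | m + 1 => if L / 2 ^ (m + 1) ≤ remainder L v m then remainder L v m - L / 2 ^ (m + 1)
      else remainder L v m

open Classical in
/-- The `m`-th binary digit of `v` relative to `L`, found by the greedy algorithm. Its weight is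
`L / 2 ^ (m + 1)`. -/
noncomputable def digit (L v : ℝ) (m : ℕ) : Bool := decide (L / 2 ^ (m + 1) ≤ remainder L v m)

/-- The first `b` binary digits of `v` relative to `L`. -/
noncomputable def digits (b : ℕ) (L v : ℝ) : List Bool := (List.range b).map (digit L v)

/-- The number with the binary digits `δ 0, …, δ (b - 1)` relative to `L`. -/
noncomputable def ofDigits (L : ℝ) (δ : ℕ → Bool) (b : ℕ) : ℝ :=
  ∑ m ∈ Finset.range b, if δ m then L / 2 ^ (m + 1) else 0

/-- The value of `v` that is stored with `b` bits: `v` is truncated to `[0, L]` and rounded down to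
`b` binary digits relative to `L`. -/
noncomputable def quantize (b : ℕ) (L v : ℝ) : ℝ := ofDigits L (digit L (clip L v)) b

variable {L : ℝ}

theorem clip_nonneg (L v : ℝ) : 0 ≤ clip L v := le_max_left _ _

theorem clip_le (hL : 0 ≤ L) (v : ℝ) : clip L v ≤ L := max_le hL (min_le_right _ _)

theorem clip_of_mem {v : ℝ} (h0 : 0 ≤ v) (hL : v ≤ L) : clip L v = v := by
  rw [clip, min_eq_left hL, max_eq_right h0]

theorem abs_clip_sub_clip_le (L v w : ℝ) : |clip L v - clip L w| ≤ |v - w| :=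
  calc |clip L v - clip L w| ≤ max |(0 : ℝ) - 0| |min v L - min w L| := abs_max_sub_max_le_max ..
    _ = |min v L - min w L| := by simp
    _ ≤ max |v - w| |L - L| := abs_min_sub_min_le_max ..
    _ = |v - w| := by simp

theorem measurable_clip (L : ℝ) : Measurable (clip L) := by
  unfold clip
  fun_prop

theorem length_digits (b : ℕ) (L v : ℝ) : (digits b L v).length = b := by simp [digits]

theorem digits_succ (b : ℕ) (L v : ℝ) : digits (b + 1) L v = digits b L v ++ [digit L v b] := by
  simp [digits, List.range_succ]

theorem getD_digits {b m : ℕ} (hm : m < b) (v : ℝ) :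
    (digits b L v).getD m false = digit L v m := by
  simp [digits, hm]

theorem div_two_pow_div_two (L : ℝ) (m : ℕ) : L / 2 ^ m / 2 = L / 2 ^ (m + 1) := by
  rw [div_div, pow_succ]

theorem remainder_nonneg {v : ℝ} (hv : 0 ≤ v) (b : ℕ) : 0 ≤ remainder L v b := by
  induction b with
  | zero => exact hv
  | succ b ih =>
    rw [remainder]
    split_ifs with h
    exacts [sub_nonneg.2 h, ih]

theorem remainder_le {v : ℝ} (hv : v ≤ L) (b : ℕ) : remainder L v b ≤ L / 2 ^ b := by
  induction b with
  | zero => simpa [remainder] using hv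
  | succ b ih =>
    rw [← div_two_pow_div_two, remainder, ← div_two_pow_div_two]
    split_ifs with h
    · linarith
    · exact (not_le.1 h).le

theorem ofDigits_digit (L v : ℝ) (b : ℕ) : ofDigits L (digit L v) b = v - remainder L v b := by
  induction b with
  | zero => simp [ofDigits, remainder]
  | succ b ih =>
    rw [ofDigits, Finset.sum_range_succ, ← ofDigits, ih]
    by_cases h : L / 2 ^ (b + 1) ≤ remainder L v b
    · simp only [remainder, digit, h, decide_true, if_true]
      ring
    · simp [remainder, digit, h]

theorem quantize_nonneg (hL : 0 ≤ L) (b : ℕ) (v : ℝ) : 0 ≤ quantize b L v := by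
  unfold quantize ofDigits
  exact Finset.sum_nonneg fun m _ => by split_ifs <;> positivity

theorem quantize_le (hL : 0 ≤ L) (b : ℕ) (v : ℝ) : quantize b L v ≤ L := by
  rw [quantize, ofDigits_digit]
  linarith [clip_le hL v, remainder_nonneg (L := L) (clip_nonneg L v) b]

theorem abs_quantize_sub_clip_le (hL : 0 ≤ L) (b : ℕ) (v : ℝ) :
    |quantize b L v - clip L v| ≤ L / 2 ^ b := by
  rw [quantize, ofDigits_digit, sub_sub_cancel_left, abs_neg,
    abs_of_nonneg (remainder_nonneg (clip_nonneg L v) b)]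
  exact remainder_le (clip_le hL v) b

theorem measurable_remainder (L : ℝ) (b : ℕ) : Measurable fun v => remainder L v b := by
  induction b with
  | zero => exact measurable_id
  | succ b ih => exact Measurable.ite (measurableSet_le measurable_const ih) (ih.sub_const _) ih

theorem measurable_digit (L : ℝ) (m : ℕ) : Measurable fun v => digit L v m := by
  refine measurable_to_bool ?_
  simpa [digit, Set.preimage] using measurableSet_le measurable_const (measurable_remainder L m)

section Lists

variable {α Ω : Type*} {w : ℕ}

theorem length_flatMap_range (N : ℕ) {F : ℕ → List α} (hF : ∀ i, (F i).length = w) :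
    ((List.range N).flatMap F).length = N * w := by
  simp [List.length_flatMap, hF]

theorem getD_flatMap_range {N : ℕ} {F : ℕ → List α} (hF : ∀ i, (F i).length = w) {i m : ℕ}
    (hi : i < N) (hm : m < w) (x : α) :
    ((List.range N).flatMap F).getD (i * w + m) x = (F i).getD m x := by
  induction N with
  | zero => omega
  | succ N ih =>
    have hlen := length_flatMap_range N hF
    rw [List.range_succ, List.flatMap_append]
    rcases Nat.lt_succ_iff_lt_or_eq.1 hi with h | rfl
    · have hlt : i * w + m < N * w := by nlinarith
      rw [List.getD_append _ _ _ _ (hlen ▸ hlt), ih h]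
    · rw [List.getD_append_right _ _ _ _ (by omega), hlen]
      simp

variable [Countable α] [MeasurableSpace (List α)] [DiscreteMeasurableSpace (List α)]
  [MeasurableSpace Ω]

theorem measurable_append {h h' : Ω → List α} (hh : Measurable h) (hh' : Measurable h') :
    Measurable fun X => h X ++ h' X :=
  (Measurable.of_discrete (f := fun p : List α × List α => p.1 ++ p.2)).comp (hh.prodMk hh')

theorem measurable_flatMap_range (N : ℕ) {F : Ω → ℕ → List α}
    (hF : ∀ i < N, Measurable fun X => F X i) :
    Measurable fun X => (List.range N).flatMap (F X) := by
  induction N with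
  | zero => exact measurable_const
  | succ N ih =>
    simp only [List.range_succ, List.flatMap_append, List.flatMap_singleton]
    exact measurable_append (ih fun i hi => hF i (Nat.lt_succ_of_lt hi)) (hF N (Nat.lt_succ_self N))

end Lists

theorem measurable_digits [MeasurableSpace (List Bool)] [DiscreteMeasurableSpace (List Bool)]
    (b : ℕ) (L : ℝ) : Measurable (digits b L) := by
  induction b with
  | zero => exact measurable_const
  | succ b ih =>
    simp only [funext (digits_succ b L)]
    exact measurable_append ih
      ((Measurable.of_discrete (f := fun x : Bool => [x])).comp (measurable_digit L b))

end BinaryDigits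

open NExp Prog

section Programs

namespace Reg

-- The arrays of natural numbers; array `0` holds the inputs.
abbrev index : ℕ := 1
abbrev comp : ℕ := 2
abbrev pos : ℕ := 3
abbrev temp : ℕ := 4
abbrev cell : ℕ := 5
abbrev prod : ℕ := 6
abbrev carry : ℕ := 7
abbrev pow : ℕ := 8
abbrev exponent : ℕ := 9
abbrev cellIndex : ℕ := 10
abbrev pointer : ℕ := 11

-- The arrays of real numbers; the machine fixes the numbers of the first three.
abbrev bound : ℕ := 0
abbrev query : ℕ := 1
abbrev result : ℕ := 2
abbrev point : ℕ := 3
abbrev value : ℕ := 4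
abbrev weight : ℕ := 5
abbrev bary : ℕ := 6

end Reg

abbrev NExp.dim : NExp := .get 0 (.lit 1)
abbrev NExp.degree : NExp := .get 0 (.lit 2)
abbrev NExp.grid : NExp := .get 0 (.lit 3)
abbrev NExp.count : NExp := .get 0 (.lit 4)
abbrev NExp.bits : NExp := .get 0 (.lit 5)

/-- Puts the index of the first nonzero part of the current weak composition into `Reg.pos`. -/
def findPos : Prog :=
  assign Reg.pos (lit 0) ;;
  loop dim (ite (.natLE (.get Reg.comp (var Reg.pos)) (lit 0))
    (assign Reg.pos (.add (var Reg.pos) (lit 1))) skip)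

/-- Passes from the current weak composition to the next one, by the rule `NextWeakComp`. -/
def nextComp : Prog :=
  findPos ;;
  assign Reg.temp (.get Reg.comp (var Reg.pos)) ;;
  setNat Reg.comp (var Reg.pos) (lit 0) ;;
  setNat Reg.comp (lit 0) (.sub (var Reg.temp) (lit 1)) ;;
  setNat Reg.comp (.add (var Reg.pos) (lit 1))
    (.add (.get Reg.comp (.add (var Reg.pos) (lit 1))) (lit 1))

/-- Returns to the first weak composition `(ℓ, 0, …, 0)`. -/
def resetComp : Prog :=
  forLoop Reg.index (.add dim (lit 1)) (setNat Reg.comp (var Reg.index) (lit 0)) ;;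
  setNat Reg.comp (lit 0) degree

/-- Adds the carry to the current digit of the number of the cell. -/
def addCarry : Prog :=
  setNat Reg.cell (var Reg.index) (.add (.get Reg.cell (var Reg.index)) (var Reg.carry)) ;;
  ite (.natLE grid (.get Reg.cell (var Reg.index)))
    (setNat Reg.cell (var Reg.index) (lit 0) ;; assign Reg.carry (lit 1))
    (assign Reg.carry (lit 0))

/-- Adds one to the number of the cell, which is stored with `d` digits to the base `K`. -/
def nextCell : Prog := assign Reg.carry (lit 1) ;; forLoop Reg.index dim addCarry

/-- Computes the mesh point that belongs to the current cell and weak composition. -/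
def makePoint : Prog :=
  forLoop Reg.index dim
    (setReal Reg.point (var Reg.index)
      (.div (.add (.ofNat (.get Reg.cell (var Reg.index)))
        (.div (.ofNat (.get Reg.comp (.add (var Reg.index) (lit 1)))) (.ofNat degree)))
        (.ofNat grid)))

/-- Truncates the current value to `[0, L]`. -/
def clipValue : Prog :=
  ite (.realLE (.var Reg.value) (.ofNat (lit 0))) (assignReal Reg.value (.ofNat (lit 0)))
    (ite (.realLE (.var Reg.bound) (.var Reg.value)) (assignReal Reg.value (.var Reg.bound)) skip)

/-- Writes the next binary digit of the current value and removes it from the value. -/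
def emitDigit : Prog :=
  ite (.realLE (.var Reg.weight) (.var Reg.value))
    (emit (lit 1) ;; assignReal Reg.value (.sub (.var Reg.value) (.var Reg.weight)))
    (emit (lit 0)) ;;
  assignReal Reg.weight (.div (.var Reg.weight) (.ofNat (lit 2)))

/-- Writes the binary digits of the current value. -/
def emitDigits : Prog :=
  assignReal Reg.weight (.div (.var Reg.bound) (.ofNat (lit 2))) ;; loop bits emitDigit

/-- Treats one mesh point. -/
def treatPoint : Prog :=
  makePoint ;; ask Reg.point Reg.value (lit 0) ;; clipValue ;; emitDigits ;; nextComp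

/-- Treats all mesh points of one cell. -/
def treatCell : Prog := resetComp ;; loop count treatPoint ;; nextCell

/-- Computes the number `K ^ d` of cells. -/
def countCells : Prog :=
  assign Reg.prod (lit 1) ;; loop dim (assign Reg.prod (.mul (var Reg.prod) grid))

/-- The preprocessing program. -/
def preProg : Prog := countCells ;; loop (var Reg.prod) treatCell

/-- Computes the powers of two up to `2 ^ b`. -/
def makePowers : Prog :=
  setNat Reg.pow (lit 0) (lit 1) ;;
  forLoop Reg.exponent bits
    (setNat Reg.pow (.add (var Reg.exponent) (lit 1))
      (.add (.get Reg.pow (var Reg.exponent)) (.get Reg.pow (var Reg.exponent))))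

/-- Determines one binary digit of the cell coordinate, the most significant one first. -/
def searchStep : Prog :=
  assign Reg.exponent (.sub (var Reg.exponent) (lit 1)) ;;
  assign Reg.temp (.add (var Reg.pos) (.get Reg.pow (var Reg.exponent))) ;;
  ite (.natLE (var Reg.temp) (.sub grid (lit 1)))
    (ite (.realLE (.ofNat (var Reg.temp)) (.mul (.ofNat grid) (.get Reg.query (var Reg.index))))
      (assign Reg.pos (var Reg.temp)) skip)
    skip

/-- Finds the cell coordinate of the query point along one axis by binary search. -/
def searchAxis : Prog :=
  assign Reg.pos (lit 0) ;; assign Reg.exponent bits ;; loop bits searchStep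

/-- Treats one axis in the location of the query point. -/
def locateAxis : Prog :=
  searchAxis ;;
  assign Reg.cellIndex (.add (var Reg.cellIndex) (.mul (var Reg.pos) (var Reg.prod))) ;;
  assign Reg.prod (.mul (var Reg.prod) grid) ;;
  setReal Reg.bary (.add (var Reg.index) (lit 1)) (.mul (.ofNat degree)
    (.sub (.mul (.ofNat grid) (.get Reg.query (var Reg.index))) (.ofNat (var Reg.pos)))) ;;
  assignReal Reg.bary
    (.sub (.var Reg.bary) (.get Reg.bary (.add (var Reg.index) (lit 1))))

/-- Computes the number of the cell of the query point, and the barycentric coordinates of the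
query point with respect to a corner simplex of the cell. -/
def locate : Prog :=
  makePowers ;; assign Reg.cellIndex (lit 0) ;; assign Reg.prod (lit 1) ;;
  assignReal Reg.bary (.ofNat degree) ;; forLoop Reg.index dim locateAxis

/-- Reads one binary digit of a stored value. -/
def readDigit : Prog :=
  ite (.natLE (lit 1) (stored (var Reg.pointer)))
    (assignReal Reg.value (.add (.var Reg.value) (.var Reg.weight))) skip ;;
  assignReal Reg.weight (.div (.var Reg.weight) (.ofNat (lit 2))) ;;
  assign Reg.pointer (.add (var Reg.pointer) (lit 1))

/-- Reads the next stored value. -/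
def readValue : Prog :=
  assignReal Reg.value (.ofNat (lit 0)) ;;
  assignReal Reg.weight (.div (.var Reg.bound) (.ofNat (lit 2))) ;; loop bits readDigit

/-- Multiplies the current value by one linear factor of a Lagrange polynomial. -/
def timesFactor : Prog :=
  assignReal Reg.value (.mul (.var Reg.value)
    (.div (.sub (.get Reg.bary (var Reg.index)) (.ofNat (var Reg.temp)))
      (.sub (.ofNat (.get Reg.comp (var Reg.index))) (.ofNat (var Reg.temp)))))

/-- Multiplies the current value by the Lagrange polynomial of the current weak composition. -/
def timesBasis : Prog :=
  forLoop Reg.index (.add dim (lit 1))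
    (forLoop Reg.temp (.get Reg.comp (var Reg.index)) timesFactor)

/-- Adds one term of the interpolation formula to the result. -/
def addTerm : Prog :=
  readValue ;; timesBasis ;; assignReal Reg.result (.add (.var Reg.result) (.var Reg.value)) ;;
  nextComp

/-- The query program. -/
def qryProg : Prog :=
  locate ;; assign Reg.pointer (.mul (var Reg.cellIndex) (.mul count bits)) ;;
  setNat Reg.comp (lit 0) degree ;; loop count addTerm

end Programs

section Preprocessing

attribute [local simp] run NExp.eval RExp.eval Test.holds Config.tick write_apply

/-- The inputs of a program: the dimension, the degree `ℓ`, the number `K` of cells per axis, the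
number of mesh points per cell, the number `b` of bits per value and the bound `L`. -/
structure HasInputs {d : ℕ} (σ : Config d) (ℓ K b : ℕ) (L : ℝ) : Prop where
  dim : σ.nat 0 1 = d
  degree : σ.nat 0 2 = ℓ
  grid : σ.nat 0 3 = K
  count : σ.nat 0 4 = (ℓ + d).choose d
  bits : σ.nat 0 5 = b
  bound : σ.real Reg.bound 0 = L

/-- The current weak composition is `s`. -/
def HasComp {d : ℕ} (σ : Config d) (s : ℕ → ℕ) : Prop := ∀ k ≤ d, σ.nat Reg.comp k = s k

/-- The current cell has the number `c`. Its coordinates are the digits of `c` to the base `K`. -/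
def HasCell {d : ℕ} (σ : Config d) (K c : ℕ) : Prop := ∀ k < d, σ.nat Reg.cell k = c / K ^ k % K

/-- The mesh point that belongs to the cell with the number `c` and the weak composition `s`. -/
noncomputable def gridPoint (d ℓ K c : ℕ) (s : ℕ → ℕ) : E d :=
  WithLp.toLp 2 fun k => (((c / K ^ (k : ℕ) % K : ℕ) : ℝ) + (s (k + 1) : ℝ) / ℓ) / K

/-- The bits stored for the function `g`. -/
noncomputable def storedBits (d ℓ K b : ℕ) (L : ℝ) (g : E d → ℝ) : List Bool :=
  (List.range (K ^ d)).flatMap fun c => (List.range ((ℓ + d).choose d)).flatMap fun i =>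
    digits b L (clip L (g (gridPoint d ℓ K c (weakComp d ℓ i))))

variable {d ℓ K b c : ℕ} {L : ℝ} (g : E d → ℝ) (st : List Bool) {σ τ : Config d} {s s' : ℕ → ℕ}

theorem HasInputs.frame {p : Prog} (h : HasInputs σ ℓ K b L) (hF : Frame p σ τ)
    (hn : p.writes (.nat 0) = false) (hr : p.writes (.real Reg.bound) = false) :
    HasInputs τ ℓ K b L := by
  constructor <;> simp only [hF.nat 0 hn, hF.real Reg.bound hr, h.dim, h.degree, h.grid, h.count,
    h.bits, h.bound]

theorem HasComp.frame {p : Prog} (h : HasComp σ s) (hF : Frame p σ τ)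
    (hp : p.writes (.nat Reg.comp) = false) : HasComp τ s := by
  simpa only [HasComp, hF.nat Reg.comp hp] using h

theorem HasCell.frame {p : Prog} (h : HasCell σ K c) (hF : Frame p σ τ)
    (hp : p.writes (.nat Reg.cell) = false) : HasCell τ K c := by
  simpa only [HasCell, hF.nat Reg.cell hp] using h

theorem nat_run_findPos (hd : σ.nat 0 1 = d) (hs : HasComp σ s) {h : ℕ} (hh : h < d)
    (h0 : ∀ i < h, s i = 0) (hp : 0 < s h) :
    (findPos.run g st σ).nat Reg.pos 0 = h := by
  have hinv := run_loop_induction g st (ite (.natLE (.get Reg.comp (var Reg.pos)) (lit 0))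
    (assign Reg.pos (.add (var Reg.pos) (lit 1))) skip) (e := dim) (N := d)
    (σ := (assign Reg.pos (lit 0)).run g st σ) (by simp [hd])
    (fun i τ => τ.nat Reg.pos 0 = min i h) (by simp) fun i hi τ hF hpos => by
      have hcomp : τ.nat Reg.comp (min i h) = s (min i h) :=
        (congrFun ((hF.nat Reg.comp rfl).trans ((Prog.frame g st _ σ).nat Reg.comp rfl)) _).trans
          (hs _ (by omega))
      rcases lt_or_ge i h with hih | hih
      · rw [min_eq_left hih.le] at hpos hcomp
        simp [hpos, hcomp, h0 i hih, Nat.succ_le_of_lt hih]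
      · rw [min_eq_right hih] at hpos hcomp
        simp [hpos, hcomp, hp.ne', Nat.le_succ_of_le hih]
  rw [min_eq_right hh.le] at hinv
  exact hinv

theorem hasComp_run_nextComp (hd : σ.nat 0 1 = d) (hs : HasComp σ s) (hss' : NextWeakComp d s s') :
    HasComp (nextComp.run g st σ) s' := by
  obtain ⟨h, hh, h0, hp, rfl⟩ := hss'
  have hpos := nat_run_findPos g st hd hs hh h0 hp
  have hs₁ := hs.frame (Prog.frame g st findPos σ) rfl
  intro i hi
  simp only [nextComp, Prog.run_seq]
  generalize findPos.run g st σ = σ₁ at hpos hs₁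
  simp [hpos, hs₁ h hh.le, hs₁ (h + 1) hh, hs₁ i hi, Function.update_apply]

theorem hasComp_run_resetComp (hσ : HasInputs σ ℓ K b L) :
    HasComp (resetComp.run g st σ) (weakComp d ℓ 0) := by
  have hinv := run_forLoop_induction g st (σ := σ) (v := Reg.index) (e := .add dim (lit 1))
    (c := setNat Reg.comp (var Reg.index) (lit 0)) (N := d + 1) rfl
    (fun τ hF => by simp [(hσ.frame hF rfl rfl).dim])
    (fun i τ => ∀ k < i, τ.nat Reg.comp k = 0)
    (fun i τ υ hF h => by rwa [hF.nat Reg.comp rfl]) (by simp) fun i hi τ _ hindex h k hk => by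
      rcases Nat.lt_succ_iff_lt_or_eq.1 hk with hki | rfl
      · simp [h k hki]
      · simp [hindex]
  have hdeg := (hσ.frame (Prog.frame g st (forLoop Reg.index (.add dim (lit 1))
    (setNat Reg.comp (var Reg.index) (lit 0))) σ) rfl rfl).degree
  intro k hk
  rw [weakComp_zero, resetComp, Prog.run_seq]
  generalize (forLoop _ _ _).run g st σ = σ₁ at hinv hdeg
  simp [hdeg, hinv k (Nat.lt_succ_of_le hk), Pi.single_apply]

theorem nat_run_countCells (hσ : HasInputs σ ℓ K b L) :
    (countCells.run g st σ).nat Reg.prod 0 = K ^ d := by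
  have h₀ := hσ.frame (Prog.frame g st (assign Reg.prod (lit 1)) σ) rfl rfl
  exact run_loop_induction g st _ (e := dim) h₀.dim (fun i τ => τ.nat Reg.prod 0 = K ^ i) (by simp)
    fun i _ τ hF h => by simp [h, (h₀.frame hF rfl rfl).grid, pow_succ]

-- The carry that enters the digit `k` of `c + 1` is `(c + 1) / K ^ k - c / K ^ k`.
theorem succ_div_pow_mod (hK : 0 < K) (c k : ℕ) :
    let x := c / K ^ k % K + ((c + 1) / K ^ k - c / K ^ k)
    (c + 1) / K ^ k % K = (if K ≤ x then 0 else x) ∧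
      (c + 1) / K ^ (k + 1) - c / K ^ (k + 1) = if K ≤ x then 1 else 0 := by
  have carry : (c + 1) / K ^ k = c / K ^ k ∨ (c + 1) / K ^ k = c / K ^ k + 1 := by
    rw [Nat.succ_div]
    split_ifs <;> simp
  simp only [pow_succ, ← Nat.div_div_eq_div_mul]
  generalize c / K ^ k = a at *
  have hlt := Nat.mod_lt a hK
  have hmod := Nat.div_add_mod a K
  rcases carry with h | h
  · simp [h, hlt]
  simp only [h, Nat.add_sub_cancel_left]
  split_ifs with hc
  · have ha : a + 1 = K * (a / K + 1) := by rw [Nat.mul_add]; omega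
    rw [ha]
    simp [Nat.mul_div_cancel_left _ hK]
  · have ha : a + 1 = (a % K + 1) + K * (a / K) := by omega
    refine ⟨?_, ?_⟩
    · rw [ha, Nat.add_mul_mod_self_left, Nat.mod_eq_of_lt (by omega)]
    · rw [ha, Nat.add_mul_div_left _ _ hK, Nat.div_eq_of_lt (by omega)]
      omega

theorem nat_run_addCarry {i : ℕ} (hi : σ.nat Reg.index 0 = i) (hgrid : σ.nat 0 3 = K) :
    let x := σ.nat Reg.cell i + σ.nat Reg.carry 0
    (addCarry.run g st σ).nat Reg.carry 0 = (if K ≤ x then 1 else 0) ∧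
      (addCarry.run g st σ).nat Reg.cell i = (if K ≤ x then 0 else x) ∧
      ∀ k ≠ i, (addCarry.run g st σ).nat Reg.cell k = σ.nat Reg.cell k := by
  simp only [addCarry, run, Test.holds, NExp.eval, Config.tick, write_apply, hi, hgrid]
  split_ifs with h₁ h₂ <;> simp_all [write_apply]

theorem hasCell_run_nextCell (hσ : HasInputs σ ℓ K b L) (hK : 0 < K) (hc : HasCell σ K c) :
    HasCell (nextCell.run g st σ) K (c + 1) := by
  have h₁ := hσ.frame (Prog.frame g st (assign Reg.carry (lit 1)) σ) rfl rfl
  have hinv := run_forLoop_induction g st (c := addCarry) (v := Reg.index) (e := dim) (N := d)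
    (σ := (assign Reg.carry (lit 1)).run g st σ) rfl
    (fun τ hF => (h₁.frame hF rfl rfl).dim)
    (fun i τ => τ.nat Reg.carry 0 = (c + 1) / K ^ i - c / K ^ i ∧
      (∀ k < i, τ.nat Reg.cell k = (c + 1) / K ^ k % K) ∧
      ∀ k, i ≤ k → τ.nat Reg.cell k = σ.nat Reg.cell k)
    (fun i τ υ hF h => by rwa [hF.nat Reg.carry rfl, hF.nat Reg.cell rfl]) (by simp)
    fun i hi τ hF hindex ⟨hcarry, hlt, hge⟩ => by
      have hadd := nat_run_addCarry g st hindex (h₁.frame hF rfl rfl).grid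
      have hdigit := succ_div_pow_mod hK c i
      rw [hcarry, hge i le_rfl, hc i hi] at hadd
      refine ⟨hadd.1.trans hdigit.2.symm, fun k hk => ?_, fun k hk => ?_⟩
      · rcases Nat.lt_succ_iff_lt_or_eq.1 hk with hki | rfl
        · rw [hadd.2.2 k hki.ne, hlt k hki]
        · exact hadd.2.1.trans hdigit.1.symm
      · rw [hadd.2.2 k (by omega), hge k (by omega)]
  exact hinv.2.1

theorem real_run_makePoint (hσ : HasInputs σ ℓ K b L) (hc : HasCell σ K c) (hs : HasComp σ s) :
    (WithLp.toLp 2 fun k => (makePoint.run g st σ).real Reg.point k : E d) =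
      gridPoint d ℓ K c s := by
  have hinv := run_forLoop_induction g st (σ := σ) (v := Reg.index) (e := dim) (N := d)
    (c := setReal Reg.point (var Reg.index)
      (.div (.add (.ofNat (.get Reg.cell (var Reg.index)))
        (.div (.ofNat (.get Reg.comp (.add (var Reg.index) (lit 1)))) (.ofNat degree)))
        (.ofNat grid)))
    rfl (fun τ hF => (hσ.frame hF rfl rfl).dim)
    (fun i τ => ∀ k < i, τ.real Reg.point k =
      (((c / K ^ k % K : ℕ) : ℝ) + (s (k + 1) : ℝ) / ℓ) / K)
    (fun i τ υ hF h => by rwa [hF.real Reg.point rfl]) (by simp)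
    fun i hi τ hF hindex h k hk => by
      have hτ := hσ.frame hF rfl rfl
      rcases Nat.lt_succ_iff_lt_or_eq.1 hk with hki | rfl
      · simpa [hindex, hki.ne] using h k hki
      · simp [hindex, hc.frame hF rfl k hi, hs.frame hF rfl (k + 1) hi, hτ.degree, hτ.grid]
  exact congrArg (WithLp.toLp 2) (funext fun k => hinv k k.2)

theorem real_run_clipValue (hσ : HasInputs σ ℓ K b L) (hL : 0 ≤ L) :
    (clipValue.run g st σ).real Reg.value 0 = clip L (σ.real Reg.value 0) := by
  simp only [clipValue, run, Test.holds, RExp.eval, NExp.eval, Config.tick, hσ.bound, Nat.cast_zero]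
  split_ifs with h₀ h₁
  · simp [write_apply, clip, h₀.trans hL, h₀]
  · simp [write_apply, clip, h₁, hL]
  · simp [clip, (not_le.1 h₀).le, (not_le.1 h₁).le]

theorem out_run_emitDigits (hσ : HasInputs σ ℓ K b L) :
    (emitDigits.run g st σ).out = σ.out ++ digits b L (σ.real Reg.value 0) := by
  set v := σ.real Reg.value 0
  have hinv := run_loop_induction g st emitDigit (e := bits) (N := b)
    (σ := (assignReal Reg.weight (.div (.var Reg.bound) (.ofNat (lit 2)))).run g st σ)
    (by simp [hσ.bits])
    (fun i τ => τ.real Reg.value 0 = remainder L v i ∧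
      τ.real Reg.weight 0 = L / 2 ^ (i + 1) ∧ τ.out = σ.out ++ digits i L v)
    (by simp [remainder, digits, hσ.bound, v]) fun i _ τ _ ⟨hvalue, hweight, hout⟩ => by
      have halve : L / 2 ^ (i + 1) / 2 = L / 2 ^ (i + 1 + 1) := div_two_pow_div_two ..
      simp only [emitDigit, run, RExp.eval, NExp.eval, Test.holds, Config.tick, hvalue, hweight,
        digits_succ, digit, remainder, hout]
      split_ifs with hc <;> simp [hc, write_apply, hvalue, hweight, halve]
  exact hinv.2.2

end Preprocessing

section PreprocessingRun

variable {d ℓ K b c : ℕ} {L : ℝ} (g : E d → ℝ) (st : List Bool) {σ : Config d} {s s' : ℕ → ℕ}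

theorem run_treatPoint (hσ : HasInputs σ ℓ K b L) (hL : 0 ≤ L) (hc : HasCell σ K c)
    (hs : HasComp σ s) :
    (treatPoint.run g st σ).out = σ.out ++ digits b L (clip L (g (gridPoint d ℓ K c s))) ∧
      (treatPoint.run g st σ).asked = σ.asked ++ [gridPoint d ℓ K c s] ∧
      ∀ s', NextWeakComp d s s' → HasComp (treatPoint.run g st σ) s' := by
  set u := gridPoint d ℓ K c s
  simp only [treatPoint, Prog.run_seq]
  have hpoint := real_run_makePoint g st hσ hc hs
  have f₁ := Prog.frame g st makePoint σ
  generalize makePoint.run g st σ = σ₁ at *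
  have hasked : ((ask Reg.point Reg.value (lit 0)).run g st σ₁).asked = σ₁.asked ++ [u] := by
    simp only [run, Config.tick, hpoint, u]
  have hvalue : ((ask Reg.point Reg.value (lit 0)).run g st σ₁).real Reg.value 0 = g u := by
    simp only [run, Config.tick, NExp.eval, write_apply, hpoint, and_self, if_true, u]
  have f₂ := Prog.frame g st (ask Reg.point Reg.value (lit 0)) σ₁
  generalize (ask Reg.point Reg.value (lit 0)).run g st σ₁ = σ₂ at *
  have hσ₂ := (hσ.frame f₁ rfl rfl).frame f₂ rfl rfl
  have hclip := real_run_clipValue g st hσ₂ hL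
  have f₃ := Prog.frame g st clipValue σ₂
  generalize clipValue.run g st σ₂ = σ₃ at *
  have hσ₃ := hσ₂.frame f₃ rfl rfl
  have hemit := out_run_emitDigits g st hσ₃
  have f₄ := Prog.frame g st emitDigits σ₃
  generalize emitDigits.run g st σ₃ = σ₄ at *
  have f₅ := Prog.frame g st nextComp σ₄
  refine ⟨?_, ?_, fun s' hs' => ?_⟩
  · rw [f₅.out rfl, hemit, hclip, hvalue, f₃.out rfl, f₂.out rfl, f₁.out rfl]
  · rw [f₅.asked rfl, f₄.asked rfl, f₃.asked rfl, hasked, f₁.asked rfl]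
  · exact hasComp_run_nextComp g st (hσ₃.frame f₄ rfl rfl).dim
      ((((hs.frame f₁ rfl).frame f₂ rfl).frame f₃ rfl).frame f₄ rfl) hs'

theorem run_treatCell (hσ : HasInputs σ ℓ K b L) (hL : 0 ≤ L) (hK : 0 < K)
    (hc : HasCell σ K c) :
    (treatCell.run g st σ).out = σ.out ++ (List.range ((ℓ + d).choose d)).flatMap (fun i =>
        digits b L (clip L (g (gridPoint d ℓ K c (weakComp d ℓ i))))) ∧
      (treatCell.run g st σ).asked = σ.asked ++ (List.range ((ℓ + d).choose d)).map
        (fun i => gridPoint d ℓ K c (weakComp d ℓ i)) ∧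
      HasCell (treatCell.run g st σ) K (c + 1) := by
  simp only [treatCell, Prog.run_seq]
  have hreset := hasComp_run_resetComp g st hσ
  have f₁ := Prog.frame g st resetComp σ
  generalize resetComp.run g st σ = σ₁ at *
  have hσ₁ := hσ.frame f₁ rfl rfl
  have hc₁ := hc.frame f₁ rfl
  have hinv := run_loop_induction g st treatPoint (e := count) hσ₁.count (fun i τ =>
    τ.out = σ.out ++ (List.range i).flatMap (fun i =>
        digits b L (clip L (g (gridPoint d ℓ K c (weakComp d ℓ i))))) ∧
      τ.asked = σ.asked ++ (List.range i).map (fun i => gridPoint d ℓ K c (weakComp d ℓ i)) ∧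
      (i < (ℓ + d).choose d → HasComp τ (weakComp d ℓ i)))
    ⟨by simpa [Config.tick] using f₁.out rfl, by simpa [Config.tick] using f₁.asked rfl,
      fun _ => hreset⟩
    fun i hi τ hF ⟨hout, hasked, hcomp⟩ => by
      have hτ := hF.trans (Frame.tick _ τ 1)
      obtain ⟨hout', hasked', hcomp'⟩ := run_treatPoint g st (hσ₁.frame hτ rfl rfl) hL
        (hc₁.frame hτ rfl) (s := weakComp d ℓ i) (hcomp hi)
      refine ⟨?_, ?_, fun hlt => hcomp' _ (nextWeakComp_weakComp hlt)⟩
      · rw [hout', show (τ.tick 1).out = _ from hout]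
        simp [List.range_succ]
      · rw [hasked', show (τ.tick 1).asked = _ from hasked]
        simp [List.range_succ]
  have f₂ := Prog.frame g st (loop count treatPoint) σ₁
  generalize (loop count treatPoint).run g st σ₁ = σ₂ at *
  have f₃ := Prog.frame g st nextCell σ₂
  exact ⟨(f₃.out rfl).trans hinv.1, (f₃.asked rfl).trans hinv.2.1,
    hasCell_run_nextCell g st (hσ₁.frame f₂ rfl rfl) hK (hc₁.frame f₂ rfl)⟩

theorem run_preProg (hσ : HasInputs σ ℓ K b L) (hL : 0 ≤ L) (hK : 0 < K) (hc : HasCell σ K 0) :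
    (preProg.run g st σ).out = σ.out ++ storedBits d ℓ K b L g ∧
      (preProg.run g st σ).asked = σ.asked ++ (List.range (K ^ d)).flatMap fun c =>
        (List.range ((ℓ + d).choose d)).map fun i => gridPoint d ℓ K c (weakComp d ℓ i) := by
  simp only [preProg, Prog.run_seq]
  have hcount := nat_run_countCells g st hσ
  have f₁ := Prog.frame g st countCells σ
  generalize countCells.run g st σ = σ₁ at *
  have hσ₁ := hσ.frame f₁ rfl rfl
  have hinv := run_loop_induction g st treatCell (e := var Reg.prod) hcount (fun c τ =>
    τ.out = σ.out ++ (List.range c).flatMap (fun c =>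
        (List.range ((ℓ + d).choose d)).flatMap fun i =>
          digits b L (clip L (g (gridPoint d ℓ K c (weakComp d ℓ i))))) ∧
      τ.asked = σ.asked ++ (List.range c).flatMap (fun c =>
        (List.range ((ℓ + d).choose d)).map fun i => gridPoint d ℓ K c (weakComp d ℓ i)) ∧
      HasCell τ K c)
    ⟨by simpa [Config.tick] using f₁.out rfl, by simpa [Config.tick] using f₁.asked rfl,
      hc.frame f₁ rfl⟩
    fun c _ τ hF ⟨hout, hasked, hcell⟩ => by
      obtain ⟨hout', hasked', hcell'⟩ := run_treatCell g st
        (hσ₁.frame (hF.trans (Frame.tick _ τ 1)) rfl rfl) hL hK (c := c) hcell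
      refine ⟨?_, ?_, hcell'⟩
      · rw [hout', show (τ.tick 1).out = _ from hout]
        simp [List.range_succ]
      · rw [hasked', show (τ.tick 1).asked = _ from hasked]
        simp [List.range_succ]
  exact ⟨hinv.1, hinv.2.1⟩

attribute [local simp] stepBound NExp.cost RExp.cost Test.cost NExp.eval

theorem stepBound_treatPoint_le (hσ : HasInputs σ ℓ K b L) :
    treatPoint.stepBound st σ ≤ 200 * (1 + d + b) := by
  simp [treatPoint, makePoint, clipValue, emitDigits, emitDigit, nextComp, findPos, forLoop, hσ.dim,
    hσ.bits]
  omega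

theorem stepBound_treatCell_le (hσ : HasInputs σ ℓ K b L) :
    treatCell.stepBound st σ ≤
      300 * (1 + d) + (ℓ + d).choose d * (201 * (1 + d + b)) := by
  have hpoints : (ℓ + d).choose d * (1 + treatPoint.stepBound st σ) ≤
      (ℓ + d).choose d * (201 * (1 + d + b)) := by
    gcongr
    have := stepBound_treatPoint_le st hσ
    omega
  simp [treatCell, resetComp, nextCell, addCarry, forLoop, hσ.dim, hσ.count] at hpoints ⊢
  omega

theorem stepBound_countCells_le (hσ : HasInputs σ ℓ K b L) :
    countCells.stepBound st σ ≤ 20 * (1 + d) := by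
  simp [countCells, hσ.dim]
  omega

theorem steps_run_preProg_le (hσ : HasInputs σ ℓ K b L) (hK : 0 < K) :
    (preProg.run g st σ).steps ≤
      σ.steps + 1000 * (K ^ d * ((ℓ + d).choose d * (1 + d + b))) := by
  simp only [preProg, Prog.run_seq]
  have hcount := nat_run_countCells g st hσ
  have f₁ := Prog.frame g st countCells σ
  have hsteps := steps_run_le g st (c := countCells) rfl rfl (σ := σ) rfl
  have hcountCells := stepBound_countCells_le st hσ
  generalize countCells.run g st σ = σ₁ at *
  have hinv := run_loop_induction g st treatCell (e := var Reg.prod) hcount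
    (fun c τ => τ.steps ≤ σ₁.steps + 3 + c * (1 + treatCell.stepBound st σ))
    (by simp [Config.tick]) fun c _ τ hF h => by
      have body := steps_run_le g st (c := treatCell) rfl rfl (σ := τ.tick 1)
        ((hF.nat 0 rfl).trans (f₁.nat 0 rfl))
      simp only [Config.tick] at body ⊢
      rw [Nat.add_mul]
      omega
  set B := (ℓ + d).choose d
  set w := 1 + d + b
  have hB : 0 < B := Nat.choose_pos (Nat.le_add_left d ℓ)
  have hw : w ≤ B * w := Nat.le_mul_of_pos_left _ hB
  have hBw : B * w ≤ K ^ d * (B * w) := Nat.le_mul_of_pos_left _ (Nat.pow_pos hK)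
  have hcell : 1 + treatCell.stepBound st σ ≤ 502 * (B * w) := by
    have hstep : _ ≤ 300 * (1 + d) + B * (201 * w) := stepBound_treatCell_le st hσ
    have : B * (201 * w) = 201 * (B * w) := by ring
    omega
  have hcells : K ^ d * (1 + treatCell.stepBound st σ) ≤ 502 * (K ^ d * (B * w)) :=
    (Nat.mul_le_mul_left _ hcell).trans_eq (by ring)
  omega

end PreprocessingRun

section Coordinates

open Finset

variable {R : Type*} {d K : ℕ}

/-- The finite sequence `x`, continued by zeros. -/
def zeroExtend [Zero R] (x : Fin d → R) (k : ℕ) : R := if h : k < d then x ⟨k, h⟩ else 0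

theorem zeroExtend_coe [Zero R] (x : Fin d → R) (k : Fin d) : zeroExtend x k = x k := by
  simp [zeroExtend]

theorem zeroExtend_of_lt [Zero R] (x : Fin d → R) {k : ℕ} (hk : k < d) :
    zeroExtend x k = x ⟨k, hk⟩ :=
  dif_pos hk

theorem sum_range_zeroExtend [AddCommMonoid R] (x : Fin d → R) :
    ∑ k ∈ range d, zeroExtend x k = ∑ k, x k := by
  simp only [sum_range, zeroExtend_coe]

/-- The coordinates of `x` with respect to the simplex with the vertices `0` and `a e_k`, which are
the barycentric coordinates multiplied by `a`. The coordinate of the vertex `0` comes first. -/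
def baryCoord [AddCommMonoid R] [Sub R] (a : R) (x : Fin d → R) : ℕ → R
  | 0 => a - ∑ k, x k
  | k + 1 => zeroExtend x k

theorem sum_baryCoord [AddCommGroup R] (a : R) (x : Fin d → R) :
    ∑ k ∈ range (d + 1), baryCoord a x k = a := by
  simp [sum_range_succ', baryCoord, sum_range_zeroExtend]

/-- The position of `y` relative to the sub-cube `j`, scaled so that the mesh points of the sub-cube
have integer coordinates. -/
def localCoord [Ring R] (ℓ : ℕ) (j : Fin d → Fin K) (y : Fin d → R) (k : Fin d) : R :=
  ℓ * (K * y k - (j k : ℕ))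

/-- The coordinate of a sub-cube whose side contains the coordinate `x`. -/
noncomputable def cellCoord (K : ℕ) (x : ℝ) : ℕ := min (K - 1) ⌊K * x⌋₊

theorem le_cellCoord_iff {x : ℝ} (hx : 0 ≤ x) {m : ℕ} :
    m ≤ cellCoord K x ↔ m ≤ K - 1 ∧ (m : ℝ) ≤ K * x := by
  rw [cellCoord, le_min_iff, Nat.le_floor_iff (by positivity)]

theorem cellCoord_lt (hK : 0 < K) (x : ℝ) : cellCoord K x < K :=
  (min_le_left _ _).trans_lt (Nat.sub_lt hK one_pos)

theorem mul_le_cellCoord_add_one (hK : 0 < K) {x : ℝ} (hx : x ≤ 1) :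
    K * x ≤ (cellCoord K x : ℝ) + 1 := by
  rcases min_choice (K - 1) ⌊K * x⌋₊ with h | h <;> rw [cellCoord, h]
  · rw [Nat.cast_pred hK, sub_add_cancel]
    exact mul_le_of_le_one_right (Nat.cast_nonneg K) hx
  · exact (Nat.lt_floor_add_one _).le

/-- A sub-cube that contains `y`. -/
noncomputable def cellOf (hK : 0 < K) (y : E d) (k : Fin d) : Fin K :=
  ⟨cellCoord K (y k), cellCoord_lt hK _⟩

theorem mem_subCube_cellOf (hK : 0 < K) {y : E d} (hy : y ∈ cube d) :
    y ∈ subCube K (cellOf hK y) := by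
  have hK' : (0 : ℝ) < K := Nat.cast_pos.2 hK
  intro i
  rw [div_le_iff₀ hK', le_div_iff₀ hK', mul_comm]
  exact ⟨((le_cellCoord_iff (hy i).1).1 le_rfl).2, mul_le_cellCoord_add_one hK (hy i).2⟩

theorem meshPoint_mem_cube {ℓ : ℕ} (j : Fin d → Fin K) {s : Fin d → ℕ} (hs : ∑ i, s i ≤ ℓ) :
    meshPoint ℓ K j s ∈ cube d := by
  intro i
  have hK : (0 : ℝ) < K := Nat.cast_pos.2 (Fin.pos (j i))
  have hsi : (s i : ℝ) / ℓ ≤ 1 := div_le_one_of_le₀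
    (Nat.cast_le.2 ((single_le_sum (fun _ _ => Nat.zero_le _) (mem_univ i)).trans hs))
    (Nat.cast_nonneg ℓ)
  have hji : ((j i : ℕ) : ℝ) + 1 ≤ K := by exact_mod_cast (j i).2
  refine ⟨by simp only [meshPoint]; positivity, ?_⟩
  rw [meshPoint, div_le_one hK]
  linarith

/-- The Lagrange polynomial of the `s`-th point of the principal lattice, as a function of the
coordinates `z = baryCoord ℓ x`. It is the product of the generalized binomial coefficients
`z_k` over `s_k`. Working in a `ℚ`-algebra covers polynomials and their values at once. -/
def lagrangeBasis [CommRing R] [Algebra ℚ R] (d : ℕ) (s : ℕ → ℕ) (z : ℕ → R) : R :=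
  ∏ k ∈ range (d + 1), ∏ t ∈ range (s k), ((s k : ℚ) - t)⁻¹ • (z k - t)

theorem lagrangeBasis_eq_prod_div [Field R] [CharZero R] (d : ℕ) (s : ℕ → ℕ) (z : ℕ → R) :
    lagrangeBasis d s z =
      ∏ k ∈ range (d + 1), ∏ t ∈ range (s k), (z k - t) / ((s k : R) - t) := by
  simp [lagrangeBasis, Rat.smul_def, div_eq_inv_mul]

end Coordinates

section Query

attribute [local simp] run NExp.eval RExp.eval Test.holds Config.tick write_apply

/-- The query point is `y`. -/
def HasQuery {d : ℕ} (σ : Config d) (y : E d) : Prop := ∀ k : Fin d, σ.real Reg.query k = y k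

/-- The coordinates that have been computed for the query point are `z`. -/
def HasBary {d : ℕ} (σ : Config d) (z : ℕ → ℝ) : Prop := ∀ k ≤ d, σ.real Reg.bary k = z k

variable {d ℓ K b : ℕ} {L : ℝ} {y : E d} {z : ℕ → ℝ} {s s' : ℕ → ℕ} (g : E d → ℝ) (st : List Bool)
  {σ τ : Config d}

theorem HasQuery.frame {p : Prog} (h : HasQuery σ y) (hF : Frame p σ τ)
    (hp : p.writes (.real Reg.query) = false) : HasQuery τ y := by
  simpa only [HasQuery, hF.real Reg.query hp] using h

theorem HasBary.frame {p : Prog} (h : HasBary σ z) (hF : Frame p σ τ)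
    (hp : p.writes (.real Reg.bary) = false) : HasBary τ z := by
  simpa only [HasBary, hF.real Reg.bary hp] using h

theorem nat_run_makePowers (hσ : HasInputs σ ℓ K b L) :
    ∀ i ≤ b, (makePowers.run g st σ).nat Reg.pow i = 2 ^ i := by
  have hσ₁ := hσ.frame (Prog.frame g st (setNat Reg.pow (lit 0) (lit 1)) σ) rfl rfl
  exact run_forLoop_induction g st (v := Reg.exponent) (e := bits) (N := b)
    (c := setNat Reg.pow (.add (var Reg.exponent) (lit 1))
      (.add (.get Reg.pow (var Reg.exponent)) (.get Reg.pow (var Reg.exponent))))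
    (σ := (setNat Reg.pow (lit 0) (lit 1)).run g st σ) rfl
    (fun τ hF => (hσ₁.frame hF rfl rfl).bits) (fun i τ => ∀ k ≤ i, τ.nat Reg.pow k = 2 ^ k)
    (fun i τ υ hF h => by rwa [hF.nat Reg.pow rfl]) (by simp)
    fun i _ τ _ hexponent h k hk => by
      rcases Nat.le_succ_iff.1 hk with hki | rfl
      · simpa [hexponent, (Nat.lt_succ_of_le hki).ne] using h k hki
      · simp [hexponent, h i le_rfl, pow_succ, mul_two]

theorem nat_run_searchStep {x : ℝ} (hx : 0 ≤ x) {m : ℕ} (hσ : HasInputs σ ℓ K b L)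
    (hquery : σ.real Reg.query (σ.nat Reg.index 0) = x) (hexponent : σ.nat Reg.exponent 0 = m + 1)
    (hpow : σ.nat Reg.pow m = 2 ^ m) (hle : σ.nat Reg.pos 0 ≤ cellCoord K x)
    (hlt : cellCoord K x < σ.nat Reg.pos 0 + 2 ^ (m + 1)) :
    (searchStep.run g st σ).nat Reg.exponent 0 = m ∧
      (searchStep.run g st σ).nat Reg.pos 0 ≤ cellCoord K x ∧
      cellCoord K x < (searchStep.run g st σ).nat Reg.pos 0 + 2 ^ m := by
  have test := le_cellCoord_iff (K := K) hx (m := σ.nat Reg.pos 0 + 2 ^ m)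
  rw [pow_succ] at hlt
  push_cast at test
  simp only [searchStep, run, NExp.eval, RExp.eval, Test.holds, Config.tick]
  by_cases hgrid : σ.nat Reg.pos 0 + 2 ^ m ≤ K - 1
  · by_cases hreal : (σ.nat Reg.pos 0 : ℝ) + 2 ^ m ≤ K * x
    · simp [write_apply, hquery, hpow, hexponent, hσ.grid, hgrid, hreal, test]
      omega
    · simp [write_apply, hquery, hpow, hexponent, hσ.grid, hgrid, hreal, hle, ← not_le, test]
  · simp [write_apply, hpow, hexponent, hσ.grid, hgrid, hle, ← not_le, test]

theorem nat_run_searchAxis {x : ℝ} (hx : 0 ≤ x) (hK : 0 < K) (hKb : K ≤ 2 ^ b)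
    (hσ : HasInputs σ ℓ K b L) (hquery : σ.real Reg.query (σ.nat Reg.index 0) = x)
    (hpow : ∀ i ≤ b, σ.nat Reg.pow i = 2 ^ i) :
    (searchAxis.run g st σ).nat Reg.pos 0 = cellCoord K x := by
  set setup := assign Reg.pos (lit 0) ;; assign Reg.exponent bits
  have hF₁ := Prog.frame g st setup σ
  have hσ₁ := hσ.frame hF₁ rfl rfl
  have hinv := run_loop_induction g st searchStep (e := bits) (N := b) (σ := setup.run g st σ)
    hσ₁.bits
    (fun i τ => τ.nat Reg.exponent 0 = b - i ∧ τ.nat Reg.pos 0 ≤ cellCoord K x ∧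
      cellCoord K x < τ.nat Reg.pos 0 + 2 ^ (b - i))
    (by simpa [setup, hσ.bits] using (cellCoord_lt hK x).trans_le hKb)
    fun i hi τ hF ⟨hexponent, hle, hlt⟩ => by
      have hτ := hF.trans (Frame.tick _ τ 1)
      rw [show b - i = b - (i + 1) + 1 by omega] at hexponent hlt
      refine nat_run_searchStep g st hx (hσ₁.frame hτ rfl rfl) ?_ hexponent ?_ hle hlt
      · rwa [hτ.real Reg.query rfl, hτ.nat Reg.index rfl, hF₁.real Reg.query rfl,
          hF₁.nat Reg.index rfl]
      · rw [hτ.nat Reg.pow rfl, hF₁.nat Reg.pow rfl, hpow _ (by omega)]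
  obtain ⟨-, hle, hlt⟩ := hinv
  rw [Nat.sub_self, pow_zero] at hlt
  exact hle.antisymm (Nat.le_of_lt_succ hlt)

theorem run_locateAxis (hy : y ∈ cube d) (hK : 0 < K) (hKb : K ≤ 2 ^ b) {i : Fin d}
    (hσ : HasInputs σ ℓ K b L) (hquery : HasQuery σ y) (hindex : σ.nat Reg.index 0 = i)
    (hpow : ∀ i ≤ b, σ.nat Reg.pow i = 2 ^ i) :
    let x := localCoord ℓ (cellOf hK y) y.ofLp i
    let σ' := locateAxis.run g st σ
    σ'.nat Reg.cellIndex 0 =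
        σ.nat Reg.cellIndex 0 + (cellOf hK y i : ℕ) * σ.nat Reg.prod 0 ∧
      σ'.nat Reg.prod 0 = σ.nat Reg.prod 0 * K ∧
      σ'.real Reg.bary 0 = σ.real Reg.bary 0 - x ∧ σ'.real Reg.bary (i + 1) = x ∧
      ∀ k < (i : ℕ), σ'.real Reg.bary (k + 1) = σ.real Reg.bary (k + 1) := by
  have hpos := nat_run_searchAxis g st (hy i).1 hK hKb hσ (by rw [hindex, hquery]) hpow
  have hF := Prog.frame g st searchAxis σ
  have hσ₁ := hσ.frame hF rfl rfl
  have hquery₁ := hquery.frame hF rfl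
  rw [← hF.nat Reg.index rfl] at hindex
  rw [← hF.nat Reg.cellIndex rfl, ← hF.nat Reg.prod rfl, ← hF.real Reg.bary rfl]
  simp only [locateAxis, Prog.run_seq]
  generalize searchAxis.run g st σ = σ₁ at *
  simp only [run, NExp.eval, RExp.eval, Config.tick, write_apply]
  simp +contextual [hindex, hpos, hσ₁.grid, hσ₁.degree, hquery₁ i, localCoord, cellOf, ne_of_lt]

theorem run_forLoop_locateAxis (hy : y ∈ cube d) (hK : 0 < K) (hKb : K ≤ 2 ^ b)
    (hσ : HasInputs σ ℓ K b L) (hquery : HasQuery σ y) (hpow : ∀ i ≤ b, σ.nat Reg.pow i = 2 ^ i)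
    (hcell : σ.nat Reg.cellIndex 0 = 0) (hprod : σ.nat Reg.prod 0 = 1)
    (hbary : σ.real Reg.bary 0 = ℓ) :
    let σ' := (forLoop Reg.index dim locateAxis).run g st σ
    σ'.nat Reg.cellIndex 0 = finFunctionFinEquiv (cellOf hK y) ∧
      HasBary σ' (baryCoord ℓ (localCoord ℓ (cellOf hK y) y.ofLp)) := by
  set x := localCoord ℓ (cellOf hK y) y.ofLp
  obtain ⟨-, hcell, hbary₀, hbary⟩ := run_forLoop_induction g st (c := locateAxis)
    (v := Reg.index) (e := dim) (N := d) (σ := σ) rfl (fun τ hF => (hσ.frame hF rfl rfl).dim)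
    (fun i τ => τ.nat Reg.prod 0 = K ^ i ∧
      τ.nat Reg.cellIndex 0 =
        ∑ k ∈ Finset.range i, zeroExtend (fun k => (cellOf hK y k : ℕ)) k * K ^ k ∧
      τ.real Reg.bary 0 = ℓ - ∑ k ∈ Finset.range i, zeroExtend x k ∧
      ∀ k < i, τ.real Reg.bary (k + 1) = zeroExtend x k)
    (fun i τ υ hF h => by
      rwa [hF.nat Reg.prod rfl, hF.nat Reg.cellIndex rfl, hF.real Reg.bary rfl])
    (by simp [hcell, hprod, hbary]) fun i hi τ hF hindex ⟨hprod, hcell, hbary₀, hbary⟩ => by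
      obtain ⟨hcell', hprod', hbary₀', hnew, hold⟩ := run_locateAxis g st (i := ⟨i, hi⟩) hy hK hKb
        (hσ.frame hF rfl rfl) (hquery.frame hF rfl) hindex (by rwa [hF.nat Reg.pow rfl])
      refine ⟨by rw [hprod', hprod, pow_succ], ?_, ?_, fun k hk => ?_⟩
      · rw [hcell', hcell, hprod, Finset.sum_range_succ, zeroExtend_of_lt _ hi]
      · rw [hbary₀', hbary₀, Finset.sum_range_succ, zeroExtend_of_lt _ hi, sub_sub]
      · rcases Nat.lt_succ_iff_lt_or_eq.1 hk with hki | rfl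
        · rw [hold k hki, hbary k hki]
        · rw [zeroExtend_of_lt _ hi]
          exact hnew
  refine ⟨?_, fun k hk => ?_⟩
  · simpa only [finFunctionFinEquiv_apply, Finset.sum_range, zeroExtend_coe] using hcell
  · cases k with
    | zero => rwa [sum_range_zeroExtend] at hbary₀
    | succ k => exact hbary k hk

theorem run_locate (hy : y ∈ cube d) (hK : 0 < K) (hKb : K ≤ 2 ^ b) (hσ : HasInputs σ ℓ K b L)
    (hquery : HasQuery σ y) :
    (locate.run g st σ).nat Reg.cellIndex 0 = finFunctionFinEquiv (cellOf hK y) ∧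
      HasBary (locate.run g st σ) (baryCoord ℓ (localCoord ℓ (cellOf hK y) y.ofLp)) := by
  set setup := makePowers ;; assign Reg.cellIndex (lit 0) ;; assign Reg.prod (lit 1) ;;
    assignReal Reg.bary (.ofNat degree)
  have hF := Prog.frame g st setup σ
  have hF₁ := Prog.frame g st makePowers σ
  refine run_forLoop_locateAxis g st hy hK hKb (σ := setup.run g st σ) (hσ.frame hF rfl rfl)
    (hquery.frame hF rfl) (nat_run_makePowers g st hσ) ?_ ?_ ?_
  · simp [setup]
  · simp [setup]
  · simpa [setup] using (hσ.frame hF₁ rfl rfl).degree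

theorem run_readDigit :
    (readDigit.run g st σ).real Reg.value 0 = σ.real Reg.value 0 +
        (if st.getD (σ.nat Reg.pointer 0) false then σ.real Reg.weight 0 else 0) ∧
      (readDigit.run g st σ).real Reg.weight 0 = σ.real Reg.weight 0 / 2 ∧
      (readDigit.run g st σ).nat Reg.pointer 0 = σ.nat Reg.pointer 0 + 1 := by
  by_cases hbit : st.getD (σ.nat Reg.pointer 0) false = true <;>
    simp only [readDigit, run, NExp.eval, RExp.eval, Test.holds, Config.tick, hbit] <;>
    simp [write_apply]

theorem run_readValue (hσ : HasInputs σ ℓ K b L) :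
    (readValue.run g st σ).real Reg.value 0 =
        ofDigits L (fun m => st.getD (σ.nat Reg.pointer 0 + m) false) b ∧
      (readValue.run g st σ).nat Reg.pointer 0 = σ.nat Reg.pointer 0 + b := by
  set p := σ.nat Reg.pointer 0
  set setup := assignReal Reg.value (.ofNat (lit 0)) ;;
    assignReal Reg.weight (.div (.var Reg.bound) (.ofNat (lit 2)))
  have hinv := run_loop_induction g st readDigit (e := bits) (N := b) (σ := setup.run g st σ)
    (by simp [setup, hσ.bits])
    (fun i τ => τ.real Reg.value 0 = ofDigits L (fun m => st.getD (p + m) false) i ∧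
      τ.real Reg.weight 0 = L / 2 ^ (i + 1) ∧ τ.nat Reg.pointer 0 = p + i)
    (by simp [setup, ofDigits, hσ.bound, p]) fun i _ τ _ ⟨hvalue, hweight, hpointer⟩ => by
      obtain ⟨hvalue', hweight', hpointer'⟩ := run_readDigit g st (σ := τ.tick 1)
      simp only [Config.tick, hvalue, hweight, hpointer] at hvalue' hweight' hpointer'
      exact ⟨hvalue'.trans (Finset.sum_range_succ _ i).symm,
        hweight'.trans (div_two_pow_div_two ..), hpointer'⟩
  exact ⟨hinv.1, hinv.2.2⟩

theorem real_run_timesBasis (hd : σ.nat 0 1 = d) (hs : HasComp σ s) (hz : HasBary σ z) :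
    (timesBasis.run g st σ).real Reg.value 0 = σ.real Reg.value 0 * lagrangeBasis d s z := by
  rw [lagrangeBasis_eq_prod_div]
  exact run_forLoop_induction g st (v := Reg.index) (e := .add dim (lit 1)) (N := d + 1) (σ := σ)
    (c := forLoop Reg.temp (.get Reg.comp (var Reg.index)) timesFactor) rfl
    (fun τ hF => by simp [hF.nat 0 rfl, hd])
    (fun i τ => τ.real Reg.value 0 = σ.real Reg.value 0 *
      ∏ k ∈ Finset.range i, ∏ t ∈ Finset.range (s k), (z k - t) / ((s k : ℝ) - t))
    (fun i τ υ hF h => by rwa [hF.real Reg.value rfl]) (by simp) fun i hi τ hF hindex h => by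
      have hsi := hs.frame hF rfl i (Nat.le_of_lt_succ hi)
      have hzi := hz.frame hF rfl i (Nat.le_of_lt_succ hi)
      rw [Finset.prod_range_succ, ← mul_assoc, ← h]
      exact run_forLoop_induction g st (v := Reg.temp) (e := .get Reg.comp (var Reg.index))
        (c := timesFactor) (N := s i) (σ := τ) rfl
        (fun υ hυ => by simp [hυ.nat Reg.index rfl, hυ.nat Reg.comp rfl, hindex, hsi])
        (fun j υ => υ.real Reg.value 0 = τ.real Reg.value 0 *
          ∏ t ∈ Finset.range j, (z i - t) / ((s i : ℝ) - t))
        (fun j υ ω hF h => by rwa [hF.real Reg.value rfl]) (by simp) fun j _ υ hυ htemp h => by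
          rw [Finset.prod_range_succ, ← mul_assoc, ← h]
          simp [timesFactor, htemp, hυ.nat Reg.index rfl, hυ.nat Reg.comp rfl,
            hυ.real Reg.bary rfl, hindex, hsi, hzi]

theorem steps_run_timesBasis_le (hd : σ.nat 0 1 = d) (hs : HasComp σ s) :
    (timesBasis.run g st σ).steps ≤
      σ.steps + 100 * (d + 1 + ∑ k ∈ Finset.range (d + 1), s k) := by
  have hsteps := Prog.steps_run_forLoop_le g st (v := Reg.index) (e := .add dim (lit 1)) (σ := σ)
    (c := forLoop Reg.temp (.get Reg.comp (var Reg.index)) timesFactor) (N := d + 1) rfl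
    (fun τ hF => by simp [hF.nat 0 rfl, hd]) (fun i => 7 + 30 * s i) fun i hi τ hF hindex => by
      have hsi := hs.frame hF rfl i (Nat.le_of_lt_succ hi)
      refine (Prog.steps_run_forLoop_le g st (v := Reg.temp)
        (e := .get Reg.comp (var Reg.index)) (c := timesFactor) (N := s i) (σ := τ) rfl
        (fun υ hυ => by simp [hυ.nat Reg.index rfl, hυ.nat Reg.comp rfl, hindex, hsi])
        (fun _ => 23) fun j _ υ _ _ => ?_).trans ?_
      · simp [timesFactor, NExp.cost, RExp.cost]
      · simp only [NExp.cost, Finset.sum_const, Finset.card_range, smul_eq_mul]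
        omega
  simp only [Finset.sum_add_distrib, Finset.sum_const, Finset.card_range, smul_eq_mul,
    ← Finset.mul_sum, NExp.cost] at hsteps
  exact hsteps.trans (by omega)

end Query

section QueryRun

variable {d ℓ K b : ℕ} {L : ℝ} {y : E d} {z : ℕ → ℝ} {s s' : ℕ → ℕ} (g : E d → ℝ) (st : List Bool)
  {σ : Config d}

attribute [local simp] run stepBound NExp.cost RExp.cost Test.cost NExp.eval RExp.eval Config.tick
  write_apply

theorem run_addTerm (hσ : HasInputs σ ℓ K b L) (hs : HasComp σ s) (hz : HasBary σ z) :
    (addTerm.run g st σ).real Reg.result 0 = σ.real Reg.result 0 +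
        ofDigits L (fun m => st.getD (σ.nat Reg.pointer 0 + m) false) b * lagrangeBasis d s z ∧
      (addTerm.run g st σ).nat Reg.pointer 0 = σ.nat Reg.pointer 0 + b ∧
      ∀ s', NextWeakComp d s s' → HasComp (addTerm.run g st σ) s' := by
  simp only [addTerm, Prog.run_seq]
  obtain ⟨hvalue, hpointer⟩ := run_readValue g st hσ
  have f₁ := Prog.frame g st readValue σ
  generalize readValue.run g st σ = σ₁ at *
  have hσ₁ := hσ.frame f₁ rfl rfl
  have hterm := real_run_timesBasis g st hσ₁.dim (hs.frame f₁ rfl) (hz.frame f₁ rfl)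
  have f₂ := Prog.frame g st timesBasis σ₁
  generalize timesBasis.run g st σ₁ = σ₂ at *
  set addResult := assignReal Reg.result (.add (.var Reg.result) (.var Reg.value))
  have hresult : (addResult.run g st σ₂).real Reg.result 0 =
      σ₂.real Reg.result 0 + σ₂.real Reg.value 0 := by simp [addResult]
  have f₃ := Prog.frame g st addResult σ₂
  generalize addResult.run g st σ₂ = σ₃ at *
  have f₄ := Prog.frame g st nextComp σ₃
  refine ⟨?_, ?_, fun s' hs' => ?_⟩
  · rw [f₄.real Reg.result rfl, hresult, hterm, hvalue, f₂.real Reg.result rfl,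
      f₁.real Reg.result rfl]
  · rw [f₄.nat Reg.pointer rfl, f₃.nat Reg.pointer rfl, f₂.nat Reg.pointer rfl, hpointer]
  · exact hasComp_run_nextComp g st ((hσ₁.frame f₂ rfl rfl).frame f₃ rfl rfl).dim
      (((hs.frame f₁ rfl).frame f₂ rfl).frame f₃ rfl) hs'

theorem steps_run_addTerm_le (hσ : HasInputs σ ℓ K b L) (hs : HasComp σ s) :
    (addTerm.run g st σ).steps ≤
      σ.steps + 200 * (1 + d + b + ∑ k ∈ Finset.range (d + 1), s k) := by
  simp only [addTerm, Prog.run_seq]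
  have hread := steps_run_le g st (c := readValue) rfl rfl (σ := σ) rfl
  have hreadBound : readValue.stepBound st σ ≤ 30 * (1 + b) := by
    simp [readValue, readDigit, hσ.bits]
    omega
  have f₁ := Prog.frame g st readValue σ
  generalize readValue.run g st σ = σ₁ at *
  have hσ₁ := hσ.frame f₁ rfl rfl
  have hbasis := steps_run_timesBasis_le g st hσ₁.dim (hs.frame f₁ rfl)
  have f₂ := Prog.frame g st timesBasis σ₁
  generalize timesBasis.run g st σ₁ = σ₂ at *
  set addResult := assignReal Reg.result (.add (.var Reg.result) (.var Reg.value))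
  have hadd : (addResult.run g st σ₂).steps = σ₂.steps + 7 := by simp [addResult]
  have f₃ := Prog.frame g st addResult σ₂
  generalize addResult.run g st σ₂ = σ₃ at *
  have hnext := steps_run_le g st (c := nextComp) rfl rfl (σ := σ₃) rfl
  have hnextBound : nextComp.stepBound st σ₃ ≤ 50 * (1 + d) := by
    simp [nextComp, findPos, ((hσ₁.frame f₂ rfl rfl).frame f₃ rfl rfl).dim]
    omega
  omega

theorem run_loop_addTerm (hσ : HasInputs σ ℓ K b L) (hs : HasComp σ (weakComp d ℓ 0))
    (hz : HasBary σ z) :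
    ((loop count addTerm).run g st σ).real Reg.result 0 = σ.real Reg.result 0 +
        ∑ i ∈ Finset.range ((ℓ + d).choose d),
          ofDigits L (fun m => st.getD (σ.nat Reg.pointer 0 + i * b + m) false) b *
            lagrangeBasis d (weakComp d ℓ i) z ∧
      ((loop count addTerm).run g st σ).steps ≤
        σ.steps + 3 + (ℓ + d).choose d * (201 * (1 + d + b + ℓ)) := by
  obtain ⟨hresult, -, -, hsteps⟩ := run_loop_induction g st addTerm (e := count) hσ.count
    (fun i τ => τ.real Reg.result 0 = σ.real Reg.result 0 + ∑ i ∈ Finset.range i,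
          ofDigits L (fun m => st.getD (σ.nat Reg.pointer 0 + i * b + m) false) b *
            lagrangeBasis d (weakComp d ℓ i) z ∧
      τ.nat Reg.pointer 0 = σ.nat Reg.pointer 0 + i * b ∧
      (i < (ℓ + d).choose d → HasComp τ (weakComp d ℓ i)) ∧
      τ.steps ≤ σ.steps + 3 + i * (201 * (1 + d + b + ℓ)))
    ⟨by simp, by simp, fun _ => hs, by simp⟩
    fun i hi τ hF ⟨hresult, hpointer, hcomp, _⟩ => by
      have hτ := hF.trans (Frame.tick _ τ 1)
      have hσ' := hσ.frame hτ rfl rfl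
      have hs' : HasComp (τ.tick 1) _ := hcomp hi
      obtain ⟨hresult', hpointer', hcomp'⟩ := run_addTerm g st hσ' hs' (hz.frame hτ rfl)
      have hsteps' := steps_run_addTerm_le g st hσ' hs'
      rw [(mem_weakComps.1 (weakComp_mem hi)).1] at hsteps'
      simp only [Config.tick] at hresult' hpointer' hsteps' ⊢
      refine ⟨?_, ?_, fun hlt => hcomp' _ (nextWeakComp_weakComp hlt), ?_⟩
      · rw [hresult', hresult, hpointer, Finset.sum_range_succ, add_assoc]
      · rw [hpointer', hpointer, Nat.succ_mul, add_assoc]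
      · rw [Nat.succ_mul]
        omega
  exact ⟨hresult, hsteps⟩

theorem stepBound_locate_le (hσ : HasInputs σ ℓ K b L) :
    locate.stepBound st σ ≤ 300 * ((1 + d) * (1 + b)) := by
  have : (1 + d) * (1 + b) = 1 + d + b + d * b := by ring
  simp [locate, makePowers, locateAxis, searchAxis, searchStep, forLoop, hσ.dim, hσ.bits]
  nlinarith [Nat.zero_le (d * b)]

theorem run_qryProg (hy : y ∈ cube d) (hK : 0 < K) (hKb : K ≤ 2 ^ b) (hσ : HasInputs σ ℓ K b L)
    (hquery : HasQuery σ y) (hcomp : σ.nat Reg.comp = 0) (hresult : σ.real Reg.result 0 = 0) :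
    (qryProg.run g st σ).real Reg.result 0 = ∑ i ∈ Finset.range ((ℓ + d).choose d),
        ofDigits L (fun m => st.getD (finFunctionFinEquiv (cellOf hK y) * ((ℓ + d).choose d * b) +
            i * b + m) false) b *
          lagrangeBasis d (weakComp d ℓ i)
            (baryCoord (ℓ : ℝ) (localCoord ℓ (cellOf hK y) y.ofLp)) ∧
      (qryProg.run g st σ).steps ≤ σ.steps + 20 + 300 * ((1 + d) * (1 + b)) +
        (ℓ + d).choose d * (201 * (1 + d + b + ℓ)) := by
  simp only [qryProg, Prog.run_seq]
  obtain ⟨hcell, hbary⟩ := run_locate g st hy hK hKb hσ hquery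
  have f₁ := Prog.frame g st locate σ
  have hlocate := (steps_run_le g st (c := locate) rfl rfl (σ := σ) rfl).trans
    (Nat.add_le_add_left (stepBound_locate_le st hσ) _)
  generalize locate.run g st σ = σ₁ at *
  have hσ₁ := hσ.frame f₁ rfl rfl
  rw [← f₁.nat Reg.comp rfl] at hcomp
  rw [← f₁.real Reg.result rfl] at hresult
  set setPointer := assign Reg.pointer (.mul (var Reg.cellIndex) (.mul count bits))
  set setComp := setNat Reg.comp (lit 0) degree
  have f₂ := Prog.frame g st setPointer σ₁
  have f₃ := Prog.frame g st setComp (setPointer.run g st σ₁)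
  obtain ⟨hsum, hsteps⟩ := run_loop_addTerm g st (z := baryCoord ℓ _)
    (σ := setComp.run g st (setPointer.run g st σ₁)) ((hσ₁.frame f₂ rfl rfl).frame f₃ rfl rfl)
    (fun k _ => by
      simp [setPointer, setComp, weakComp_zero, Pi.single_apply, hcomp, hσ₁.degree])
    ((hbary.frame f₂ rfl).frame f₃ rfl)
  refine ⟨hsum.trans ?_, hsteps.trans ?_⟩
  · simp [setPointer, setComp, hresult, hcell, hσ₁.count, hσ₁.bits]
  · simp [setPointer, setComp]
    omega

end QueryRun

section Decoding

variable {d ℓ K b : ℕ} {L : ℝ} {g : E d → ℝ} {s : ℕ → ℕ}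

theorem length_storedBits (d ℓ K b : ℕ) (L : ℝ) (g : E d → ℝ) :
    (storedBits d ℓ K b L g).length = K ^ d * ((ℓ + d).choose d * b) :=
  length_flatMap_range _ fun _ => length_flatMap_range _ fun _ => length_digits ..

theorem ofDigits_storedBits {c i : ℕ} (hc : c < K ^ d) (hi : i < (ℓ + d).choose d) :
    ofDigits L (fun m => (storedBits d ℓ K b L g).getD
        (c * ((ℓ + d).choose d * b) + i * b + m) false) b =
      quantize b L (g (gridPoint d ℓ K c (weakComp d ℓ i))) := by
  refine Finset.sum_congr rfl fun m hm => ?_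
  have hm := Finset.mem_range.1 hm
  have hlt : i * b + m < (ℓ + d).choose d * b :=
    calc i * b + m < (i + 1) * b := by rw [Nat.succ_mul]; omega
      _ ≤ _ := Nat.mul_le_mul_right _ hi
  simp only [storedBits, add_assoc]
  rw [getD_flatMap_range (fun _ => length_flatMap_range _ fun _ => length_digits ..) hc hlt,
    getD_flatMap_range (fun _ => length_digits ..) hi hm, getD_digits hm]

theorem finFunctionFinEquiv_div_pow_mod (j : Fin d → Fin K) (k : Fin d) :
    (finFunctionFinEquiv j : ℕ) / K ^ (k : ℕ) % K = j k := by
  rw [← finFunctionFinEquiv_symm_apply_val, Equiv.symm_apply_apply]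

theorem gridPoint_finFunctionFinEquiv (ℓ : ℕ) (j : Fin d → Fin K) (s : ℕ → ℕ) :
    gridPoint d ℓ K (finFunctionFinEquiv j) s = meshPoint ℓ K j fun k => s (k + 1) := by
  simp only [gridPoint, meshPoint, finFunctionFinEquiv_div_pow_mod]

theorem exists_gridPoint_eq_meshPoint {c : ℕ} (hc : c < K ^ d) (hs : s ∈ weakComps d ℓ) :
    ∃ (j : Fin d → Fin K) (s' : Fin d → ℕ), ∑ i, s' i ≤ ℓ ∧
      gridPoint d ℓ K c s = meshPoint ℓ K j s' := by
  refine ⟨finFunctionFinEquiv.symm ⟨c, hc⟩, fun k => s (k + 1), sum_tail_le_of_mem_weakComps hs, ?_⟩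
  rw [← gridPoint_finFunctionFinEquiv, Equiv.apply_symm_apply]

end Decoding

section LagrangeBasis

open Finset

variable {R : Type*} [CommRing R] [Algebra ℚ R] {d ℓ k : ℕ}

theorem succ_mul_prod_inv_smul_sub (z : R) (s : ℕ) :
    ((s : R) + 1) * ∏ t ∈ range (s + 1), (((s + 1 : ℕ) : ℚ) - t)⁻¹ • (z - t) =
      z * ∏ t ∈ range s, ((s : ℚ) - t)⁻¹ • (z - 1 - t) := by
  have hinv : ((s : R) + 1) * (((s + 1 : ℕ) : ℚ) - (0 : ℕ))⁻¹ • (z - (0 : ℕ)) = z := by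
    rw [Nat.cast_zero, sub_zero, Nat.cast_zero, sub_zero, mul_smul_comm, ← Nat.cast_succ,
      ← map_natCast (algebraMap ℚ R), ← Algebra.smul_def, inv_smul_smul₀]
    positivity
  rw [prod_range_succ', mul_left_comm, hinv, mul_comm]
  congr 1
  refine prod_congr rfl fun t _ => ?_
  rw [Nat.cast_succ, Nat.cast_succ, Nat.cast_succ, add_sub_add_right_eq_sub, sub_sub, add_comm 1]

theorem succ_mul_lagrangeBasis (hk : k ≤ d) (s : ℕ → ℕ) (z : ℕ → R) :
    ((s k : R) + 1) * lagrangeBasis d (s + Pi.single k 1) z =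
      z k * lagrangeBasis d s (z - Pi.single k 1) := by
  have hmem : k ∈ range (d + 1) := mem_range_succ_iff.2 hk
  rw [lagrangeBasis, lagrangeBasis, ← mul_prod_erase _ _ hmem, ← mul_prod_erase _ _ hmem,
    ← mul_assoc, ← mul_assoc]
  congr 1
  · simpa using succ_mul_prod_inv_smul_sub (z k) (s k)
  · refine prod_congr rfl fun i hi => ?_
    simp [(mem_erase.1 hi).1]

theorem sum_coord_mul_lagrangeBasis (hk : k ≤ d) (z : ℕ → R) (G : (ℕ → ℕ) → R) :
    ∑ s ∈ weakComps d (ℓ + 1), (s k : R) * (lagrangeBasis d s z * G s) =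
      z k * ∑ s ∈ weakComps d ℓ, lagrangeBasis d s (z - Pi.single k 1) * G (s + Pi.single k 1) := by
  rw [← sum_filter_of_ne (p := fun s : ℕ → ℕ => s k ≠ 0) fun s _ hs h0 => hs (by simp [h0]),
    mul_sum]
  refine sum_nbij' (fun s => s - Pi.single k 1) (fun s => s + Pi.single k 1) ?_ ?_ ?_ ?_ ?_
  · exact fun s hs => sub_single_mem_weakComps (mem_filter.1 hs).2 (mem_filter.1 hs).1
  · exact fun s hs => mem_filter.2 ⟨(add_single_mem_weakComps hk).2 hs, by simp⟩
  · exact fun s hs => sub_single_add_single (mem_filter.1 hs).2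
  · exact fun s _ => add_tsub_cancel_right s _
  · intro s hs
    obtain ⟨s, rfl⟩ : ∃ s' : ℕ → ℕ, s = s' + Pi.single k 1 :=
      ⟨_, (sub_single_add_single (mem_filter.1 hs).2).symm⟩
    simp only [add_tsub_cancel_right, ← mul_assoc, ← succ_mul_lagrangeBasis hk]
    simp

theorem sum_sub_single {R : Type*} [Ring R] (hk : k ≤ d) {z : ℕ → R}
    (hz : ∑ i ∈ range (d + 1), z i = (ℓ + 1 : ℕ)) :
    ∑ i ∈ range (d + 1), (z - Pi.single k 1 : ℕ → R) i = ℓ := by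
  simp only [Pi.sub_apply, sum_sub_distrib, hz, sum_pi_single', if_pos (mem_range_succ_iff.2 hk),
    Nat.cast_succ, add_sub_cancel_right]

theorem sum_lagrangeBasis {z : ℕ → R} (hz : ∑ i ∈ range (d + 1), z i = ℓ) :
    ∑ s ∈ weakComps d ℓ, lagrangeBasis d s z = 1 := by
  induction ℓ generalizing z with
  | zero => simp [lagrangeBasis]
  | succ ℓ ih =>
    have hunit : IsUnit ((ℓ + 1 : ℕ) : R) := by
      rw [← map_natCast (algebraMap ℚ R)]
      exact (IsUnit.mk0 _ (by positivity)).map _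
    refine hunit.mul_left_cancel ?_
    calc ((ℓ + 1 : ℕ) : R) * ∑ s ∈ weakComps d (ℓ + 1), lagrangeBasis d s z
        = ∑ s ∈ weakComps d (ℓ + 1), ∑ k ∈ range (d + 1),
            (s k : R) * (lagrangeBasis d s z * 1) := by
          rw [mul_sum]
          refine sum_congr rfl fun s hs => ?_
          rw [← sum_mul, mul_one, ← Nat.cast_sum, (mem_weakComps.1 hs).1]
      _ = ∑ k ∈ range (d + 1), z k := by
          rw [sum_comm]
          refine sum_congr rfl fun k hk => ?_
          have hk' := mem_range_succ_iff.1 hk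
          rw [sum_coord_mul_lagrangeBasis hk' z fun _ => 1]
          simp only [mul_one]
          rw [ih (sum_sub_single hk' hz), mul_one]
      _ = ((ℓ + 1 : ℕ) : R) * 1 := by rw [hz, mul_one]

-- The shifts `c` make the induction go through: subtracting `1` from `z_k` adds `1` to `c_k`.
theorem sum_lagrangeBasis_mul_prod {m : ℕ} (k : Fin m → ℕ) (hk : ∀ i, k i ≤ d) (hm : m ≤ ℓ)
    {z : ℕ → R} (hz : ∑ i ∈ range (d + 1), z i = ℓ) (c : ℕ → R) :
    ∑ s ∈ weakComps d ℓ, lagrangeBasis d s z * ∏ i, ((s (k i) : R) + c (k i)) =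
      ∏ i, (z (k i) + c (k i)) := by
  induction m generalizing ℓ z c with
  | zero => simpa using sum_lagrangeBasis hz
  | succ m ih =>
    obtain ⟨ℓ, rfl⟩ : ∃ ℓ', ℓ = ℓ' + 1 := ⟨ℓ - 1, by omega⟩
    have hk' : ∀ i : Fin m, k i.succ ≤ d := fun i => hk _
    set P : (ℕ → R) → R := fun x => ∏ i : Fin m, (x (k i.succ) + c (k i.succ)) with hP
    have hunshifted : ∑ s ∈ weakComps d (ℓ + 1), lagrangeBasis d s z * P (fun i => s i) = P z :=
      ih _ hk' (by omega) hz c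
    have hshifted : ∑ s ∈ weakComps d (ℓ + 1),
        (s (k 0) : R) * (lagrangeBasis d s z * P fun i => s i) = z (k 0) * P z := by
      rw [sum_coord_mul_lagrangeBasis (hk 0) z fun s => P fun i => s i]
      have h := ih _ hk' (by omega) (sum_sub_single (hk 0) hz) (c + Pi.single (k 0) 1)
      simp only [Pi.add_apply, Pi.sub_apply, sub_add_add_cancel] at h
      simp only [hP, Pi.add_apply, Nat.cast_add, add_right_comm _ _ (c _)]
      simpa [Pi.single_apply, add_assoc] using congrArg (z (k 0) * ·) h
    calc ∑ s ∈ weakComps d (ℓ + 1), lagrangeBasis d s z * ∏ i, ((s (k i) : R) + c (k i))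
        = ∑ s ∈ weakComps d (ℓ + 1), ((s (k 0) : R) * (lagrangeBasis d s z * P fun i => s i) +
            c (k 0) * (lagrangeBasis d s z * P fun i => s i)) :=
          sum_congr rfl fun s _ => by rw [Fin.prod_univ_succ]; ring
      _ = z (k 0) * P z + c (k 0) * P z := by
          rw [sum_add_distrib, hshifted, ← mul_sum, hunshifted]
      _ = ∏ i, (z (k i) + c (k i)) := by rw [Fin.prod_univ_succ, add_mul]

theorem map_lagrangeBasis {S : Type*} [CommRing S] [Algebra ℚ S] (φ : R →ₐ[ℚ] S) (s : ℕ → ℕ)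
    (z : ℕ → R) : φ (lagrangeBasis d s z) = lagrangeBasis d s fun k => φ (z k) := by
  simp [lagrangeBasis, map_prod]

end LagrangeBasis

section Interpolation

open Finset

variable {d ℓ K : ℕ} {s s' : ℕ → ℕ}

theorem exists_lt_of_ne_of_mem_weakComps (hs : s ∈ weakComps d ℓ) (hs' : s' ∈ weakComps d ℓ)
    (hne : s ≠ s') : ∃ k ∈ range (d + 1), s' k < s k := by
  rw [mem_weakComps] at hs hs'
  by_contra! hle
  have heq := (sum_eq_sum_iff_of_le hle).1 (hs.1.trans hs'.1.symm)
  refine hne (funext fun k => ?_)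
  by_cases hk : k ≤ d
  · exact heq k (mem_range_succ_iff.2 hk)
  · rw [not_imp_comm.1 (hs.2 k) hk, not_imp_comm.1 (hs'.2 k) hk]

theorem lagrangeBasis_natCast {R : Type*} [Field R] [CharZero R] [Decidable (s = s')]
    (hs : s ∈ weakComps d ℓ) (hs' : s' ∈ weakComps d ℓ) :
    lagrangeBasis d s (fun k => (s' k : R)) = if s = s' then 1 else 0 := by
  rw [lagrangeBasis_eq_prod_div]
  split_ifs with h
  · subst h
    refine prod_eq_one fun k _ => prod_eq_one fun t ht => div_self (sub_ne_zero.2 ?_)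
    exact_mod_cast (mem_range.1 ht).ne'
  · obtain ⟨k, hk, hlt⟩ := exists_lt_of_ne_of_mem_weakComps hs hs' h
    exact prod_eq_zero hk (prod_eq_zero (mem_range.2 hlt) (by rw [sub_self, zero_div]))

theorem abs_lagrangeBasis_le (hs : s ∈ weakComps d ℓ) {z : ℕ → ℝ} {B : ℝ}
    (hz : ∀ k ≤ d, ∀ t < s k, |z k - t| ≤ B) : |lagrangeBasis d s z| ≤ B ^ ℓ := by
  rw [lagrangeBasis_eq_prod_div, abs_prod, ← (mem_weakComps.1 hs).1, ← prod_pow_eq_pow_sum]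
  refine prod_le_prod (fun _ _ => abs_nonneg _) fun k hk => ?_
  rw [abs_prod]
  refine (prod_le_prod (fun _ _ => abs_nonneg _) fun t ht => ?_).trans_eq
    (by rw [prod_const, card_range])
  have ht' : (t : ℝ) + 1 ≤ s k := by exact_mod_cast mem_range.1 ht
  rw [abs_div]
  refine (div_le_self (abs_nonneg _) ?_).trans (hz k (mem_range_succ_iff.1 hk) t (mem_range.1 ht))
  exact (by linarith : (1 : ℝ) ≤ s k - t).trans (le_abs_self _)

theorem abs_baryCoord_sub_le (hd : 1 ≤ d) {x : Fin d → ℝ} (h0 : ∀ i, 0 ≤ x i) (hℓ : ∀ i, x i ≤ ℓ)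
    {k t : ℕ} (hk : k ≤ d) (ht : t ≤ ℓ) : |baryCoord (ℓ : ℝ) x k - t| ≤ d * ℓ := by
  have hdℓ : (ℓ : ℝ) ≤ d * ℓ := le_mul_of_one_le_left (Nat.cast_nonneg _) (by exact_mod_cast hd)
  have : (0 : ℝ) ≤ t := Nat.cast_nonneg t
  have htℓ : (t : ℝ) ≤ ℓ := Nat.cast_le.2 ht
  rw [abs_le]
  cases k with
  | zero =>
    have hsum0 : 0 ≤ ∑ i, x i := sum_nonneg fun i _ => h0 i
    have hsum : ∑ i, x i ≤ d * ℓ := by simpa using sum_le_card_nsmul univ x ℓ fun i _ => hℓ i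
    simp only [baryCoord]
    constructor <;> linarith
  | succ k =>
    have h0k := h0 ⟨k, hk⟩
    have hℓk := hℓ ⟨k, hk⟩
    rw [baryCoord, zeroExtend_of_lt x hk]
    constructor <;> linarith

theorem pow_le_factorial_mul_choose (d ℓ : ℕ) : d ^ ℓ ≤ ℓ.factorial * (ℓ + d).choose d := by
  rw [← Nat.choose_symm_add, ← Nat.descFactorial_eq_factorial_mul_choose, Nat.add_comm]
  calc d ^ ℓ ≤ (d + ℓ + 1 - ℓ) ^ ℓ := Nat.pow_le_pow_left (by omega) ℓ
    _ ≤ (d + ℓ).descFactorial ℓ := Nat.pow_sub_le_descFactorial _ _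

theorem baryCoord_mem_weakComps {x : Fin d → ℕ} (hx : ∑ i, x i ≤ ℓ) :
    baryCoord ℓ x ∈ weakComps d ℓ := by
  refine mem_weakComps.2 ⟨?_, fun k hk => ?_⟩
  · rw [sum_range_succ']
    simp only [baryCoord, sum_range_zeroExtend]
    omega
  · by_contra! hdk
    obtain ⟨k, rfl⟩ : ∃ k', k = k' + 1 := ⟨k - 1, by omega⟩
    exact hk (dif_neg (by omega))

theorem localCoord_meshPoint (j : Fin d → Fin K) {x : Fin d → ℕ} (hx : ∑ i, x i ≤ ℓ) :
    localCoord ℓ j (meshPoint ℓ K j x).ofLp = fun k => (x k : ℝ) := by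
  funext k
  have hK : (K : ℝ) ≠ 0 := Nat.cast_ne_zero.2 (Fin.pos (j k)).ne'
  rw [localCoord, meshPoint, mul_div_cancel₀ _ hK, add_sub_cancel_left]
  rcases eq_or_ne ℓ 0 with rfl | hℓ
  · simp [(sum_eq_zero_iff.1 (Nat.le_zero.1 hx)) k (mem_univ k)]
  · rw [mul_div_cancel₀ _ (Nat.cast_ne_zero.2 hℓ)]

theorem baryCoord_natCast {x : Fin d → ℕ} (hx : ∑ i, x i ≤ ℓ) :
    baryCoord (ℓ : ℝ) (fun k => (x k : ℝ)) = fun k => ((baryCoord ℓ x k : ℕ) : ℝ) := by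
  funext k
  cases k with
  | zero => simp [baryCoord, hx]
  | succ k => simp only [baryCoord, zeroExtend]; split_ifs <;> simp

theorem map_baryCoord {R S : Type*} [Ring R] [Ring S] (φ : R →+* S) (a : R) (x : Fin d → R)
    (k : ℕ) : φ (baryCoord a x k) = baryCoord (φ a) (fun i => φ (x i)) k := by
  cases k with
  | zero => simp [baryCoord, map_sum]
  | succ k => simp only [baryCoord, zeroExtend]; split_ifs <;> simp

/-- The polynomial on the sub-cube `j` with the value `v s` at the mesh point of the weak
composition `s`. -/
noncomputable def interpPoly (ℓ : ℕ) (j : Fin d → Fin K) (v : (ℕ → ℕ) → ℝ) :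
    MvPolynomial (Fin d) ℝ :=
  ∑ s ∈ weakComps d ℓ, MvPolynomial.C (v s) *
    lagrangeBasis d s (baryCoord (ℓ : MvPolynomial (Fin d) ℝ) (localCoord ℓ j MvPolynomial.X))

theorem eval_interpPoly (j : Fin d → Fin K) (v : (ℕ → ℕ) → ℝ) (y : Fin d → ℝ) :
    MvPolynomial.eval y (interpPoly ℓ j v) = ∑ s ∈ weakComps d ℓ,
      v s * lagrangeBasis d s (baryCoord (ℓ : ℝ) (localCoord ℓ j y)) := by
  have hbasis : ∀ s z, MvPolynomial.eval y (lagrangeBasis d s z) =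
      lagrangeBasis d s fun k => MvPolynomial.eval y (z k) :=
    fun s z => map_lagrangeBasis ((MvPolynomial.eval y).toRatAlgHom) s z
  have hlocal : ∀ i, MvPolynomial.eval y (localCoord ℓ j MvPolynomial.X i) = localCoord ℓ j y i :=
    fun i => by simp [localCoord]
  simp only [interpPoly, map_sum, map_mul, MvPolynomial.eval_C, hbasis, map_baryCoord, map_natCast,
    hlocal]

theorem totalDegree_baryCoord_localCoord_le (j : Fin d → Fin K) (k : ℕ) :
    (baryCoord (ℓ : MvPolynomial (Fin d) ℝ)
      (localCoord ℓ j MvPolynomial.X) k).totalDegree ≤ 1 := by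
  have hcast : ∀ m : ℕ, (m : MvPolynomial (Fin d) ℝ).totalDegree = 0 := fun m => by
    rw [← map_natCast (MvPolynomial.C (σ := Fin d) (R := ℝ)), MvPolynomial.totalDegree_C]
  have hmul : ∀ (m : ℕ) (p : MvPolynomial (Fin d) ℝ), p.totalDegree ≤ 1 →
      (m * p).totalDegree ≤ 1 := fun m p hp =>
    (MvPolynomial.totalDegree_mul _ _).trans (by rwa [hcast, zero_add])
  have hlocal : ∀ i, (localCoord ℓ j (MvPolynomial.X (R := ℝ)) i).totalDegree ≤ 1 := fun i =>
    hmul _ _ <| (MvPolynomial.totalDegree_sub _ _).trans <| max_le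
      (hmul _ _ (MvPolynomial.totalDegree_X i).le) ((hcast _).le.trans zero_le_one)
  cases k with
  | zero =>
    exact (MvPolynomial.totalDegree_sub _ _).trans <| max_le ((hcast _).le.trans zero_le_one)
      (MvPolynomial.totalDegree_finsetSum_le fun i _ => hlocal i)
  | succ k =>
    simp only [baryCoord, zeroExtend]
    split_ifs
    · exact hlocal _
    · simp

theorem totalDegree_lagrangeBasis_le {z : ℕ → MvPolynomial (Fin d) ℝ}
    (hz : ∀ k, (z k).totalDegree ≤ 1) (hs : s ∈ weakComps d ℓ) :
    (lagrangeBasis d s z).totalDegree ≤ ℓ := by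
  have hfactor : ∀ k (t : ℕ), (((s k : ℚ) - t)⁻¹ • (z k - t)).totalDegree ≤ 1 := fun k t => by
    refine (MvPolynomial.totalDegree_smul_le _ _).trans ?_
    rw [← map_natCast MvPolynomial.C t]
    refine (MvPolynomial.totalDegree_sub_C_le _ _).trans (hz k)
  refine (MvPolynomial.totalDegree_finsetProd _ _).trans ?_
  rw [← (mem_weakComps.1 hs).1]
  refine sum_le_sum fun k _ => (MvPolynomial.totalDegree_finsetProd _ _).trans ?_
  exact (sum_le_sum fun t _ => hfactor k t).trans_eq (by simp)

theorem totalDegree_interpPoly_le (j : Fin d → Fin K) (v : (ℕ → ℕ) → ℝ) :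
    (interpPoly ℓ j v).totalDegree ≤ ℓ :=
  MvPolynomial.totalDegree_finsetSum_le fun s hs => (MvPolynomial.totalDegree_mul _ _).trans <| by
    rw [MvPolynomial.totalDegree_C, zero_add]
    exact totalDegree_lagrangeBasis_le (totalDegree_baryCoord_localCoord_le j) hs

theorem eval_meshPoint_interpPoly (j : Fin d → Fin K) (v : (ℕ → ℕ) → ℝ) {x : Fin d → ℕ}
    (hx : ∑ i, x i ≤ ℓ) :
    MvPolynomial.eval (meshPoint ℓ K j x).ofLp (interpPoly ℓ j v) = v (baryCoord ℓ x) := by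
  classical
  have hmem := baryCoord_mem_weakComps hx
  rw [eval_interpPoly, localCoord_meshPoint j hx, baryCoord_natCast hx, sum_eq_single_of_mem _ hmem]
  · rw [lagrangeBasis_natCast hmem hmem, if_pos rfl, mul_one]
  · intro s hs hne
    rw [lagrangeBasis_natCast hs hmem, if_neg hne, mul_zero]

end Interpolation

section Estimator

open Finset

variable {n d : ℕ} {β L : ℝ} {g : E d → ℝ} {y : E d}

theorem gridSize_pos (hn : 0 < n) (hβ : 0 ≤ β) : 0 < gridSize n d β :=
  Nat.floor_pos.2 (Real.one_le_rpow (Nat.one_le_cast.2 hn) (by positivity))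

theorem gridSize_le (hn : 0 < n) (hd : 1 ≤ d) (hβ : 0 ≤ β) : gridSize n d β ≤ n := by
  have hd' : (1 : ℝ) ≤ d := Nat.one_le_cast.2 hd
  refine Nat.floor_le_of_le ?_
  calc (n : ℝ) ^ (1 / (2 * β + d)) ≤ (n : ℝ) ^ (1 : ℝ) :=
        Real.rpow_le_rpow_of_exponent_le (Nat.one_le_cast.2 hn)
          (div_le_one_of_le₀ (by linarith) (by linarith))
    _ = n := Real.rpow_one _

theorem gridSize_pow_le (n d : ℕ) (β : ℝ) :
    (gridSize n d β : ℝ) ^ d ≤ (n : ℝ) ^ ((d : ℝ) / (2 * β + d)) :=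
  calc (gridSize n d β : ℝ) ^ d ≤ ((n : ℝ) ^ (1 / (2 * β + d))) ^ d := by
        gcongr
        exact Nat.floor_le (by positivity)
    _ = (n : ℝ) ^ ((d : ℝ) / (2 * β + d)) := by
        rw [← Real.rpow_mul_natCast (Nat.cast_nonneg n), one_div_mul_eq_div]

theorem hasInputs_start (n ℓ K : ℕ) (L : ℝ) (y : E d) :
    HasInputs (start n d ℓ K L y) ℓ K n.size L := by
  constructor <;> simp [start]

theorem hasCell_start (n ℓ K : ℕ) (L : ℝ) (y : E d) : HasCell (start n d ℓ K L y) K 0 :=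
  fun k _ => by simp [start]

theorem hasQuery_start (n ℓ K : ℕ) (L : ℝ) (y : E d) : HasQuery (start n d ℓ K L y) y :=
  fun k => by simp [start]

theorem out_preprocess (hK : 0 < gridSize n d β) (hL : 0 ≤ L) (g : E d → ℝ) :
    (preprocess preProg n d β L g).out =
      storedBits d (strictFloor β) (gridSize n d β) n.size L g :=
  (run_preProg g [] (hasInputs_start ..) hL hK (hasCell_start n _ _ L 0)).1.trans
    (List.nil_append _)

theorem asked_preprocess (hK : 0 < gridSize n d β) (hL : 0 ≤ L) (g : E d → ℝ) :
    (preprocess preProg n d β L g).asked = (List.range (gridSize n d β ^ d)).flatMap fun c =>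
      (List.range ((strictFloor β + d).choose d)).map fun i =>
        gridPoint d (strictFloor β) (gridSize n d β) c (weakComp d (strictFloor β) i) :=
  (run_preProg g [] (hasInputs_start ..) hL hK (hasCell_start n _ _ L 0)).2.trans
    (List.nil_append _)

theorem steps_preprocess_le (hK : 0 < gridSize n d β) (g : E d → ℝ) :
    (preprocess preProg n d β L g).steps ≤
      1000 * (gridSize n d β ^ d * ((strictFloor β + d).choose d * (1 + d + n.size))) :=
  (steps_run_preProg_le g [] (hasInputs_start ..) hK).trans_eq (Nat.zero_add _)

theorem steps_evaluate_le (hK : 0 < gridSize n d β) (hKn : gridSize n d β ≤ n) (hy : y ∈ cube d)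
    (bits : List Bool) :
    (evaluate qryProg n d β L bits y).steps ≤ 20 + 300 * ((1 + d) * (1 + n.size)) +
      (strictFloor β + d).choose d * (201 * (1 + d + n.size + strictFloor β)) := by
  refine (run_qryProg _ bits hy hK (hKn.trans n.lt_size_self.le)
    (hasInputs_start n _ _ L y) (hasQuery_start n _ _ L y) rfl rfl).2.trans_eq ?_
  rw [start, Nat.zero_add]

theorem compressed_eq_eval_interpPoly (hK : 0 < gridSize n d β) (hKn : gridSize n d β ≤ n)
    (hL : 0 ≤ L) (g : E d → ℝ) (hy : y ∈ cube d) :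
    compressed preProg qryProg n d β L g y =
      MvPolynomial.eval y.ofLp (interpPoly (strictFloor β) (cellOf hK y) fun s =>
        quantize n.size L (g (meshPoint (strictFloor β) (gridSize n d β) (cellOf hK y)
          fun k => s (k + 1)))) := by
  rw [eval_interpPoly, compressed, out_preprocess hK hL, evaluate]
  refine (run_qryProg _ _ hy hK (hKn.trans n.lt_size_self.le) (hasInputs_start ..)
    (hasQuery_start n _ _ L y) rfl rfl).1.trans ?_
  rw [← sum_weakComp]
  refine sum_congr rfl fun i hi => ?_
  rw [ofDigits_storedBits (Fin.is_lt _) (mem_range.1 hi), gridPoint_finFunctionFinEquiv]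

theorem abs_quantize_size_sub_clip_le (hn : 0 < n) (hL : 0 ≤ L) (v : ℝ) :
    |quantize n.size L v - clip L v| ≤ L / n := by
  refine (abs_quantize_sub_clip_le hL _ v).trans ?_
  have : (n : ℝ) ≤ 2 ^ n.size := by exact_mod_cast n.lt_size_self.le
  gcongr

theorem isInterpolant_compressed (hn : 0 < n) (hK : 0 < gridSize n d β)
    (hKn : gridSize n d β ≤ n) (hL : 0 ≤ L) (g : E d → ℝ) :
    IsInterpolant (strictFloor β) (gridSize n d β) L (L / n) g
      (compressed preProg qryProg n d β L g) := by
  refine ⟨fun j => interpPoly (strictFloor β) j fun s => quantize n.size L (g (meshPoint _ _ j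
      fun k => s (k + 1))), fun j => totalDegree_interpPoly_le _ _, fun j x hx => ?_,
    fun y hy => ⟨cellOf hK y, mem_subCube_cellOf hK hy,
      compressed_eq_eval_interpPoly hK hKn hL g hy⟩⟩
  rw [eval_meshPoint_interpPoly j _ hx]
  simpa only [baryCoord, zeroExtend_coe] using abs_quantize_size_sub_clip_le hn hL _

end Estimator

section Taylor

open Finset

variable {𝕜 V W : Type*} [NontriviallyNormedField 𝕜] [NormedAddCommGroup V] [NormedAddCommGroup W]

theorem iteratedDeriv_comp_add_smul [NormedSpace 𝕜 V] [NormedSpace 𝕜 W] {f : V → W} {m : ℕ}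
    (hf : ContDiff 𝕜 m f) (y v : V) (τ : 𝕜) :
    iteratedDeriv m (fun τ : 𝕜 => f (y + τ • v)) τ =
      iteratedFDeriv 𝕜 m f (y + τ • v) fun _ => v := by
  have hfy : ContDiff 𝕜 m fun x => f (y + x) := hf.comp (contDiff_const.add contDiff_id)
  have h := (ContinuousLinearMap.toSpanSingleton 𝕜 v).iteratedFDeriv_comp_right hfy τ le_rfl
  rw [iteratedFDeriv_comp_add_left] at h
  simpa [Function.comp_def, iteratedDeriv_eq_iteratedFDeriv] using DFunLike.congr_fun h fun _ => 1

variable [NormedSpace ℝ V] {f : V → ℝ} {ℓ : ℕ}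

/-- The Taylor polynomial of degree `ℓ` of `f` at `y`, evaluated at `y + v`. -/
noncomputable def taylorSum (ℓ : ℕ) (f : V → ℝ) (y v : V) : ℝ :=
  ∑ m ∈ range (ℓ + 1), (m.factorial : ℝ)⁻¹ * iteratedFDeriv ℝ m f y fun _ => v

theorem exists_eq_sum_iteratedFDeriv_add_remainder (hf : ContDiff ℝ ℓ f) (y v : V) :
    ∃ ξ ∈ Set.Icc (0 : ℝ) 1, f (y + v) =
      ∑ m ∈ range ℓ, (m.factorial : ℝ)⁻¹ * (iteratedFDeriv ℝ m f y fun _ => v) +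
        (ℓ.factorial : ℝ)⁻¹ * iteratedFDeriv ℝ ℓ f (y + ξ • v) fun _ => v := by
  obtain _ | ℓ := ℓ
  · exact ⟨1, by simp, by simp⟩
  have hφ : ContDiff ℝ (ℓ + 1 : ℕ) fun τ : ℝ => f (y + τ • v) := hf.comp (by fun_prop)
  obtain ⟨ξ, hξ, hmean⟩ := taylor_mean_remainder_lagrange_iteratedDeriv (x₀ := 0) (x := 1)
    zero_ne_one hφ.contDiffOn
  have htaylor : taylorWithinEval (fun τ : ℝ => f (y + τ • v)) ℓ (Set.uIcc 0 1) 0 1 =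
      ∑ m ∈ range (ℓ + 1), (m.factorial : ℝ)⁻¹ * iteratedFDeriv ℝ m f y fun _ => v := by
    rw [taylor_within_apply]
    refine sum_congr rfl fun m hm => ?_
    have hm' : (m : WithTop ℕ∞) ≤ (ℓ + 1 : ℕ) := by exact_mod_cast (mem_range.1 hm).le
    rw [iteratedDerivWithin_eq_iteratedDeriv (uniqueDiffOn_uIcc zero_ne_one)
      (hφ.of_le hm').contDiffAt (by simp), iteratedDeriv_comp_add_smul (hf.of_le hm')]
    simp
  rw [htaylor, iteratedDeriv_comp_add_smul hf] at hmean
  refine ⟨ξ, Set.Ioo_subset_Icc_self (by simpa using hξ), ?_⟩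
  rw [← sub_eq_iff_eq_add', ← one_smul ℝ v]
  simpa [mul_comm, div_eq_mul_inv] using hmean

theorem abs_sub_taylorSum_le (hf : ContDiff ℝ ℓ f) (y v : V) {M : ℝ}
    (hM : ∀ τ ∈ Set.Icc (0 : ℝ) 1, |iteratedFDeriv ℝ ℓ f (y + τ • v) (fun _ => v) -
      iteratedFDeriv ℝ ℓ f y fun _ => v| ≤ M) :
    |f (y + v) - taylorSum ℓ f y v| ≤ M / ℓ.factorial := by
  obtain ⟨ξ, hξ, heq⟩ := exists_eq_sum_iteratedFDeriv_add_remainder hf y v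
  rw [heq, taylorSum, sum_range_succ, add_sub_add_left_eq_sub, ← mul_sub, abs_mul,
    abs_of_nonneg (by positivity), mul_comm, ← div_eq_mul_inv]
  gcongr
  exact hM ξ hξ

theorem taylorSum_eq_zero_of_eventuallyEq {y : V} (hf : f =ᶠ[nhds y] 0) (ℓ : ℕ) (v : V) :
    taylorSum ℓ f y v = 0 := by
  refine sum_eq_zero fun m _ => ?_
  rw [(hf.iteratedFDeriv ℝ m).eq_of_nhds]
  simp

end Taylor

section Holder

open Finset

variable {d : ℕ} {β L : ℝ} {f : E d → ℝ}

theorem sum_smul_single (v : E d) : ∑ k, v k • EuclideanSpace.single k (1 : ℝ) = v := by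
  simpa using (EuclideanSpace.basisFun (Fin d) ℝ).sum_repr v

theorem norm_le_sum_abs (v : E d) : ‖v‖ ≤ ∑ k, |v k| := by
  conv_lhs => rw [← sum_smul_single v]
  exact (norm_sum_le _ _).trans_eq (by simp [norm_smul])

theorem iteratedFDeriv_diag_eq_sum (m : ℕ) (f : E d → ℝ) (x v : E d) :
    iteratedFDeriv ℝ m f x (fun _ => v) =
      ∑ i : Fin m → Fin d, (∏ r, v (i r)) * partialDeriv f i x := by
  conv_lhs => rw [← sum_smul_single v]
  rw [ContinuousMultilinearMap.map_sum]
  exact sum_congr rfl fun i _ => ContinuousMultilinearMap.map_smul_univ _ _ _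

theorem strictFloor_lt (hβ : 0 < β) : (strictFloor β : ℝ) < β :=
  Nat.lt_ceil.1 (Nat.sub_lt (Nat.ceil_pos.2 hβ) one_pos)

theorem le_strictFloor_add_one (β : ℝ) : β ≤ strictFloor β + 1 :=
  (Nat.le_ceil β).trans (by exact_mod_cast Nat.le_add_of_sub_le le_rfl)

theorem isClosed_cube (d : ℕ) : IsClosed (cube d) := by
  simp only [cube, Set.ofPred_forall, Set.ofPred_and]
  exact isClosed_iInter fun i => (isClosed_le continuous_const (by fun_prop)).inter
    (isClosed_le (by fun_prop) continuous_const)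

namespace IsHolderDensity

theorem abs_iteratedFDeriv_sub_le (hf : IsHolderDensity d β L f) (x y v : E d) :
    |iteratedFDeriv ℝ (strictFloor β) f x (fun _ => v) -
      iteratedFDeriv ℝ (strictFloor β) f y fun _ => v| ≤
      (∑ k, |v k|) ^ strictFloor β * (L * ‖x - y‖ ^ (β - strictFloor β)) := by
  rw [iteratedFDeriv_diag_eq_sum, iteratedFDeriv_diag_eq_sum, ← sum_sub_distrib,
    Fintype.sum_pow, sum_mul]
  refine (abs_sum_le_sum_abs _ _).trans (sum_le_sum fun i _ => ?_)
  rw [← mul_sub, abs_mul, abs_prod]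
  gcongr
  exact hf.holder i x y

theorem abs_sub_taylorSum_le (hf : IsHolderDensity d β L f) (hβ : 0 < β) (hL : 0 ≤ L)
    (y v : E d) {r : ℝ} (hr : ∑ k, |v k| ≤ r) :
    |f (y + v) - taylorSum (strictFloor β) f y v| ≤ L * r ^ β / (strictFloor β).factorial := by
  have hr0 : 0 ≤ r := (sum_nonneg fun _ _ => abs_nonneg _).trans hr
  have hpos : 0 < β - strictFloor β := sub_pos.2 (strictFloor_lt hβ)
  refine DensityInterp.abs_sub_taylorSum_le hf.smooth y v fun τ hτ => ?_
  have hnorm : ‖y + τ • v - y‖ ≤ r := by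
    rw [add_sub_cancel_left, norm_smul, Real.norm_of_nonneg hτ.1]
    exact (mul_le_of_le_one_left (norm_nonneg v) hτ.2).trans ((norm_le_sum_abs v).trans hr)
  calc |iteratedFDeriv ℝ (strictFloor β) f (y + τ • v) (fun _ => v) -
        iteratedFDeriv ℝ (strictFloor β) f y fun _ => v|
      ≤ (∑ k, |v k|) ^ strictFloor β * (L * ‖y + τ • v - y‖ ^ (β - strictFloor β)) :=
        hf.abs_iteratedFDeriv_sub_le _ _ _
    _ ≤ r ^ strictFloor β * (L * r ^ (β - strictFloor β)) := by gcongr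
    _ = L * (r ^ (strictFloor β : ℝ) * r ^ (β - strictFloor β)) := by
        rw [Real.rpow_natCast, mul_left_comm]
    _ = L * r ^ β := by
        rw [← Real.rpow_add_of_nonneg hr0 (by positivity) hpos.le, add_sub_cancel]

theorem eventuallyEq_zero (hf : IsHolderDensity d β L f) {y : E d} (hy : y ∉ cube d) :
    f =ᶠ[nhds y] 0 := by
  filter_upwards [(isClosed_cube d).isOpen_compl.mem_nhds hy] with x hx
  exact hf.supported x hx

theorem le_of_sub_notMem_cube (hf : IsHolderDensity d β L f) (hβ : 0 < β) (hL : 0 ≤ L)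
    {x v : E d} (hv : ∑ k, |v k| ≤ 1) (hx : x - v ∉ cube d) : f x ≤ L := by
  have h := hf.abs_sub_taylorSum_le hβ hL (x - v) v hv
  rw [taylorSum_eq_zero_of_eventuallyEq (hf.eventuallyEq_zero hx), sub_add_cancel, sub_zero,
    Real.one_rpow, mul_one] at h
  exact (le_abs_self _).trans
    (h.trans (div_le_self hL (Nat.one_le_cast.2 (Nat.factorial_pos _))))

-- Some unit vector leads from `x` out of the cube, where the Taylor polynomial of `f` vanishes.
theorem le_bound (hf : IsHolderDensity d β L f) (hβ : 0 < β) (hL : 0 ≤ L) (hd : 1 ≤ d)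
    (x : E d) : f x ≤ L := by
  have hsum (c : ℝ) (hc : |c| ≤ 1) :
      ∑ k, |(EuclideanSpace.single (⟨0, hd⟩ : Fin d) c : E d) k| ≤ 1 := by
    simpa [Pi.single_apply, apply_ite abs] using hc
  rcases lt_or_ge 0 (x ⟨0, hd⟩) with hpos | hneg
  · refine hf.le_of_sub_notMem_cube hβ hL (hsum (-1) (by simp)) fun hc => ?_
    have := (hc ⟨0, hd⟩).2
    simp only [PiLp.sub_apply, PiLp.single_apply, if_pos] at this
    linarith
  · refine hf.le_of_sub_notMem_cube hβ hL (hsum 1 (by simp)) fun hc => ?_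
    have := (hc ⟨0, hd⟩).1
    simp only [PiLp.sub_apply, PiLp.single_apply, if_pos] at this
    linarith

end IsHolderDensity

end Holder

section InterpolationError

open Finset

variable {d ℓ K : ℕ} {β L : ℝ} {f : E d → ℝ} {j : Fin d → Fin K} {s : ℕ → ℕ} {y : E d}

theorem meshPoint_sub_apply (hℓ : ℓ ≠ 0) (j : Fin d → Fin K) (s : Fin d → ℕ) (y : E d)
    (k : Fin d) :
    (meshPoint ℓ K j s - y) k = ((ℓ : ℝ) * K)⁻¹ * (s k + -localCoord ℓ j y k) := by
  have hK : (K : ℝ) ≠ 0 := Nat.cast_ne_zero.2 (Fin.pos (j k)).ne'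
  simp only [localCoord, meshPoint, PiLp.sub_apply]
  field_simp
  ring

-- The factor `s_k - z_k` of the product vanishes at `s = z`.
theorem sum_lagrangeBasis_mul_prod_meshPoint_sub {m : ℕ} (hm0 : m ≠ 0) (hm : m ≤ ℓ)
    (j : Fin d → Fin K) (y : E d) (i : Fin m → Fin d) :
    ∑ s ∈ weakComps d ℓ, lagrangeBasis d s (baryCoord (ℓ : ℝ) (localCoord ℓ j y)) *
      ∏ r, (meshPoint ℓ K j (fun k => s (k + 1)) - y) (i r) = 0 := by
  set z := baryCoord (ℓ : ℝ) (localCoord ℓ j y)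
  have hz : ∀ k : Fin d, localCoord ℓ j y k = z (k + 1) := fun k => (zeroExtend_coe _ k).symm
  have : NeZero m := ⟨hm0⟩
  simp only [meshPoint_sub_apply (hm.trans_lt' hm0.bot_lt).ne', hz, prod_mul_distrib, prod_const,
    mul_left_comm _ (((ℓ : ℝ) * K)⁻¹ ^ _), ← mul_sum]
  rw [sum_lagrangeBasis_mul_prod (fun r => (i r + 1 : ℕ)) (fun r => (i r).2) hm
    (sum_baryCoord _ _) fun k => -z k, prod_eq_zero (mem_univ (0 : Fin m)) (add_neg_cancel _),
    mul_zero]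

theorem sum_lagrangeBasis_mul_taylorSum (j : Fin d → Fin K) (f : E d → ℝ) (y : E d) :
    ∑ s ∈ weakComps d ℓ, lagrangeBasis d s (baryCoord (ℓ : ℝ) (localCoord ℓ j y)) *
      taylorSum ℓ f y (meshPoint ℓ K j (fun k => s (k + 1)) - y) = f y := by
  simp only [taylorSum, mul_sum]
  rw [sum_comm, sum_eq_single_of_mem 0 (by simp)]
  · simp [← sum_mul, sum_lagrangeBasis (sum_baryCoord (ℓ : ℝ) (localCoord ℓ j y))]
  · intro m hm hm0
    simp only [iteratedFDeriv_diag_eq_sum, mul_sum]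
    rw [sum_comm]
    refine sum_eq_zero fun i _ => ?_
    simp only [mul_left_comm _ (m.factorial : ℝ)⁻¹, ← mul_assoc _ _ (partialDeriv f i y), ← mul_sum,
      ← sum_mul]
    rw [sum_lagrangeBasis_mul_prod_meshPoint_sub hm0 (mem_range_succ_iff.1 hm), mul_zero, zero_mul]

theorem sum_abs_meshPoint_sub_le {s : Fin d → ℕ} (hs : ∑ i, s i ≤ ℓ) (hy : y ∈ subCube K j) :
    ∑ k, |(meshPoint ℓ K j s - y) k| ≤ (d : ℝ) / K := by
  have hcoord : ∀ k, |(meshPoint ℓ K j s - y) k| ≤ 1 / K := fun k => by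
    have hsk : (s k : ℝ) / ℓ ≤ 1 := div_le_one_of_le₀
      (Nat.cast_le.2 ((single_le_sum (fun _ _ => Nat.zero_le _) (mem_univ k)).trans hs))
      (Nat.cast_nonneg ℓ)
    have hhi : ((j k : ℕ) + (s k : ℝ) / ℓ) / K ≤ ((j k : ℕ) + 1) / K := by gcongr
    have hlo : ((j k : ℕ) : ℝ) / K ≤ ((j k : ℕ) + (s k : ℝ) / ℓ) / K := by
      gcongr
      exact le_add_of_nonneg_right (by positivity)
    have hyk := hy k
    rw [add_div _ 1] at hhi hyk
    simp only [PiLp.sub_apply, meshPoint, abs_le]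
    constructor <;> linarith
  exact (sum_le_sum fun k _ => hcoord k).trans_eq (by simp [div_eq_mul_inv])

theorem localCoord_nonneg (hy : y ∈ subCube K j) (k : Fin d) : 0 ≤ localCoord ℓ j y k := by
  have h := (hy k).1
  rw [div_le_iff₀' (Nat.cast_pos.2 (Fin.pos (j k)))] at h
  exact mul_nonneg (Nat.cast_nonneg ℓ) (sub_nonneg.2 h)

theorem localCoord_le (hy : y ∈ subCube K j) (k : Fin d) : localCoord ℓ j y k ≤ ℓ := by
  have h := (hy k).2
  rw [le_div_iff₀' (Nat.cast_pos.2 (Fin.pos (j k)))] at h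
  exact mul_le_of_le_one_right (Nat.cast_nonneg ℓ) (sub_le_iff_le_add'.2 h)

/-- An upper bound for the sum of the absolute values of the Lagrange polynomials on the cube
spanned by the simplex of the principal lattice. -/
noncomputable def lebesgueConst (d ℓ : ℕ) : ℝ := ((ℓ + d).choose d : ℝ) * ((d : ℝ) * ℓ) ^ ℓ

theorem lebesgueConst_nonneg (d ℓ : ℕ) : 0 ≤ lebesgueConst d ℓ := by
  rw [lebesgueConst]
  positivity

theorem sum_abs_lagrangeBasis_le (hd : 1 ≤ d) {x : Fin d → ℝ} (h0 : ∀ i, 0 ≤ x i)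
    (hℓ : ∀ i, x i ≤ ℓ) :
    ∑ s ∈ weakComps d ℓ, |lagrangeBasis d s (baryCoord (ℓ : ℝ) x)| ≤ lebesgueConst d ℓ := by
  refine (sum_le_card_nsmul _ _ _ fun s hs => abs_lagrangeBasis_le hs fun k hk t ht =>
    abs_baryCoord_sub_le hd h0 hℓ hk (ht.le.trans (le_of_mem_weakComps hs k))).trans_eq ?_
  rw [card_weakComps, nsmul_eq_mul, lebesgueConst]

theorem abs_sum_mul_lagrangeBasis_le (hd : 1 ≤ d) {x : Fin d → ℝ} (h0 : ∀ i, 0 ≤ x i)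
    (hℓ : ∀ i, x i ≤ ℓ) {a : (ℕ → ℕ) → ℝ} {M : ℝ} (hM : 0 ≤ M)
    (ha : ∀ s ∈ weakComps d ℓ, |a s| ≤ M) :
    |∑ s ∈ weakComps d ℓ, a s * lagrangeBasis d s (baryCoord (ℓ : ℝ) x)| ≤
      lebesgueConst d ℓ * M :=
  calc |∑ s ∈ weakComps d ℓ, a s * lagrangeBasis d s (baryCoord (ℓ : ℝ) x)|
      ≤ ∑ s ∈ weakComps d ℓ, |lagrangeBasis d s (baryCoord (ℓ : ℝ) x)| * M := by
        refine (abs_sum_le_sum_abs _ _).trans (sum_le_sum fun s hs => ?_)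
        rw [abs_mul, mul_comm]
        gcongr
        exact ha s hs
    _ ≤ lebesgueConst d ℓ * M := by
        rw [← sum_mul]
        gcongr
        exact sum_abs_lagrangeBasis_le hd h0 hℓ

-- The interpolation formula reproduces the Taylor polynomial of `f` at `y`, so that only the errors
-- of the values and the Taylor remainders at the mesh points enter.
theorem IsHolderDensity.abs_eval_interpPoly_sub_le (hf : IsHolderDensity d β L f) (hβ : 0 < β)
    (hL : 0 ≤ L) (hd : 1 ≤ d) (hy : y ∈ subCube K j) {v : (ℕ → ℕ) → ℝ} {M : ℝ} (hM0 : 0 ≤ M)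
    (hM : ∀ s ∈ weakComps d (strictFloor β),
      |v s - f (meshPoint (strictFloor β) K j fun k => s (k + 1))| ≤ M) :
    |MvPolynomial.eval y.ofLp (interpPoly (strictFloor β) j v) - f y| ≤
      lebesgueConst d (strictFloor β) *
        (M + L * ((d : ℝ) / K) ^ β / (strictFloor β).factorial) := by
  set mesh : (ℕ → ℕ) → E d := fun s => meshPoint (strictFloor β) K j fun k => s (k + 1)
  have hvalues : ∀ s ∈ weakComps d (strictFloor β),
      |v s - taylorSum (strictFloor β) f y (mesh s - y)| ≤
        M + L * ((d : ℝ) / K) ^ β / (strictFloor β).factorial := fun s hs => by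
    have htaylor := hf.abs_sub_taylorSum_le hβ hL y (mesh s - y)
      (sum_abs_meshPoint_sub_le (sum_tail_le_of_mem_weakComps hs) hy)
    rw [add_sub_cancel] at htaylor
    exact (abs_sub_le _ (f (mesh s)) _).trans (add_le_add (hM s hs) htaylor)
  rw [← sum_lagrangeBasis_mul_taylorSum (ℓ := strictFloor β) j f y]
  rw [eval_interpPoly, ← sum_sub_distrib]
  simp only [mul_comm (lagrangeBasis _ _ _), ← sub_mul]
  exact abs_sum_mul_lagrangeBasis_le hd (localCoord_nonneg hy) (localCoord_le hy) (by positivity)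
    hvalues

end InterpolationError

section Measurability

variable {n d : ℕ} {β L : ℝ} {Ω : Type*} [MeasurableSpace Ω] {fhat : Ω → E d → ℝ}

theorem gridPoint_mem_cube {ℓ K c : ℕ} (hc : c < K ^ d) {s : ℕ → ℕ} (hs : s ∈ weakComps d ℓ) :
    gridPoint d ℓ K c s ∈ cube d := by
  obtain ⟨j, s', hs', h⟩ := exists_gridPoint_eq_meshPoint hc hs
  exact h ▸ meshPoint_mem_cube j hs'

theorem measurable_out_preprocess [MeasurableSpace (List Bool)]
    [DiscreteMeasurableSpace (List Bool)] (hK : 0 < gridSize n d β) (hL : 0 ≤ L)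
    (hfhat : ∀ y ∈ cube d, Measurable fun X => fhat X y) :
    Measurable fun X => (preprocess preProg n d β L (fhat X)).out := by
  simp only [out_preprocess hK hL]
  exact measurable_flatMap_range _ fun c hc => measurable_flatMap_range _ fun i hi =>
    (measurable_digits n.size L).comp
      ((measurable_clip L).comp (hfhat _ (gridPoint_mem_cube hc (weakComp_mem hi))))

theorem measurable_comp_out_preprocess {γ : Type*} [MeasurableSpace γ] (G : List Bool → γ)
    (hK : 0 < gridSize n d β) (hL : 0 ≤ L)
    (hfhat : ∀ y ∈ cube d, Measurable fun X => fhat X y) :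
    Measurable fun X => G (preprocess preProg n d β L (fhat X)).out := by
  let : MeasurableSpace (List Bool) := ⊤
  exact Measurable.of_discrete.comp (measurable_out_preprocess hK hL hfhat)

theorem measurable_compressed (hK : 0 < gridSize n d β) (hL : 0 ≤ L)
    (hfhat : ∀ y ∈ cube d, Measurable fun X => fhat X y) (qry : Prog) (y : E d) :
    Measurable fun X => compressed preProg qry n d β L (fhat X) y :=
  measurable_comp_out_preprocess (fun bits => (evaluate qry n d β L bits y).real 2 0) hK hL hfhat

theorem measurable_supDist_compressed (hK : 0 < gridSize n d β) (hL : 0 ≤ L)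
    (hfhat : ∀ y ∈ cube d, Measurable fun X => fhat X y) (qry : Prog) (f : E d → ℝ) :
    Measurable fun X => supDist (compressed preProg qry n d β L (fhat X)) f :=
  measurable_comp_out_preprocess
    (fun bits => supDist (fun y => (evaluate qry n d β L bits y).real 2 0) f) hK hL hfhat

end Measurability

section Resources

open Finset

variable {n d : ℕ} {β L : ℝ}

theorem log_two_le_log_natCast (hn : 2 ≤ n) : Real.log 2 ≤ Real.log n :=
  Real.log_le_log two_pos (Nat.ofNat_le_cast.2 hn)

theorem size_le_three_mul_log (hn : 2 ≤ n) : (n.size : ℝ) ≤ 3 * Real.log n := by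
  obtain ⟨m, hm⟩ := Nat.exists_eq_add_one.2 (Nat.size_pos.2 (two_pos.trans_le hn))
  have hpow : 2 ^ m ≤ n := Nat.lt_size.1 (hm ▸ Nat.lt_succ_self m)
  have hlog : (m : ℝ) * Real.log 2 ≤ Real.log n := by
    rw [← Real.log_pow]
    exact Real.log_le_log (by positivity) (by exact_mod_cast hpow)
  rw [hm, Nat.cast_succ]
  nlinarith [Real.log_two_gt_d9, log_two_le_log_natCast hn]

theorem gridSize_pow_mul_choose_le (n d : ℕ) (β : ℝ) :
    ((gridSize n d β ^ d * (strictFloor β + d).choose d : ℕ) : ℝ) ≤ meshCount n d β := by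
  rw [meshCount, Nat.cast_mul, Nat.cast_pow, mul_comm]
  gcongr
  exact gridSize_pow_le n d β

theorem meshCount_nonneg (n d : ℕ) (β : ℝ) : 0 ≤ meshCount n d β :=
  (Nat.cast_nonneg _).trans (gridSize_pow_mul_choose_le n d β)

theorem length_asked_preprocess_le (hK : 0 < gridSize n d β) (hL : 0 ≤ L) (g : E d → ℝ) :
    ((preprocess preProg n d β L g).asked.length : ℝ) ≤ meshCount n d β := by
  rw [asked_preprocess hK hL, length_flatMap_range _ fun _ => by rw [List.length_map,
    List.length_range]]
  exact gridSize_pow_mul_choose_le n d β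

theorem exists_meshPoint_of_mem_asked_preprocess (hK : 0 < gridSize n d β) (hL : 0 ≤ L)
    (g : E d → ℝ) {u : E d} (hu : u ∈ (preprocess preProg n d β L g).asked) :
    ∃ (j : Fin d → Fin (gridSize n d β)) (s : Fin d → ℕ),
      ∑ i, s i ≤ strictFloor β ∧ u = meshPoint (strictFloor β) (gridSize n d β) j s := by
  simp only [asked_preprocess hK hL, List.mem_flatMap, List.mem_map, List.mem_range] at hu
  obtain ⟨c, hc, i, hi, rfl⟩ := hu
  exact exists_gridPoint_eq_meshPoint hc (weakComp_mem hi)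

theorem time_preprocess_le (hn : 2 ≤ n) (hd : 1 ≤ d) (hK : 0 < gridSize n d β) (hL : 0 ≤ L)
    (g : E d → ℝ) {Q : ℝ} (hQ : (d : ℝ) + Real.log n ≤ Q) :
    (preprocess preProg n d β L g).time Q ≤ 5000 * (Q * meshCount n d β) := by
  have hd' : (1 : ℝ) ≤ d := Nat.one_le_cast.2 hd
  have hlog : 0 ≤ Real.log n := Real.log_natCast_nonneg n
  have hM := meshCount_nonneg n d β
  have hsteps : ((preprocess preProg n d β L g).steps : ℝ) ≤ 3000 * (Q * meshCount n d β) :=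
    calc ((preprocess preProg n d β L g).steps : ℝ)
        ≤ (1000 * (gridSize n d β ^ d * ((strictFloor β + d).choose d * (1 + d + n.size))) : ℕ) :=
          Nat.cast_le.2 (steps_preprocess_le hK g)
      _ = 1000 * ((gridSize n d β ^ d * (strictFloor β + d).choose d : ℕ) *
            (1 + d + n.size : ℝ)) := by
          push_cast
          ring
      _ ≤ 1000 * (meshCount n d β * (3 * Q)) := by
          gcongr
          · exact gridSize_pow_mul_choose_le n d β
          · linarith [size_le_three_mul_log hn]
      _ = 3000 * (Q * meshCount n d β) := by ring
  have hasked : Q * (preprocess preProg n d β L g).asked.length ≤ Q * meshCount n d β :=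
    mul_le_mul_of_nonneg_left (length_asked_preprocess_le hK hL g) (by linarith)
  rw [Config.time]
  linarith [mul_nonneg (by linarith : 0 ≤ Q) hM]

theorem length_out_preprocess_le (hn : 2 ≤ n) (hd : 1 ≤ d) (hK : 0 < gridSize n d β) (hL : 0 ≤ L)
    (g : E d → ℝ) :
    ((preprocess preProg n d β L g).out.length : ℝ) ≤ 5000 * ((d : ℝ) ^ 2 *
      (max (strictFloor β) 1 : ℕ) ^ 2 * meshCount n d β * Real.log n) := by
  have hlog : 0 ≤ Real.log n := Real.log_natCast_nonneg n
  have hM := meshCount_nonneg n d β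
  have hone : (1 : ℝ) ≤ (d : ℝ) ^ 2 * (max (strictFloor β) 1 : ℕ) ^ 2 :=
    one_le_mul_of_one_le_of_one_le (one_le_pow₀ (Nat.one_le_cast.2 hd))
      (one_le_pow₀ (Nat.one_le_cast.2 (le_max_right _ _)))
  calc ((preprocess preProg n d β L g).out.length : ℝ)
      = (gridSize n d β ^ d * (strictFloor β + d).choose d : ℕ) * n.size := by
        rw [out_preprocess hK hL, length_storedBits, ← mul_assoc, Nat.cast_mul]
    _ ≤ meshCount n d β * (5000 * Real.log n) := by
        gcongr
        · exact gridSize_pow_mul_choose_le n d β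
        · linarith [size_le_three_mul_log hn]
    _ ≤ ((d : ℝ) ^ 2 * (max (strictFloor β) 1 : ℕ) ^ 2) *
          (meshCount n d β * (5000 * Real.log n)) :=
        le_mul_of_one_le_left (by positivity) hone
    _ = _ := by ring

theorem queryCost_le {D m B S l u : ℝ} (hD : 1 ≤ D) (hm : 1 ≤ m) (hB : 1 ≤ B) (hS : 0 ≤ S)
    (hlm : l ≤ m) (hSu : S ≤ 3 * u) (hu : 0.69 ≤ u) :
    20 + 300 * ((1 + D) * (1 + S)) + B * (201 * (1 + D + S + l)) ≤ 5000 * (D * m * B * u) := by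
  have hDm : D ≤ D * m := le_mul_of_one_le_right (by linarith) hm
  have hmD : m ≤ D * m := le_mul_of_one_le_left (by linarith) hD
  have hpu : D * m * 0.69 ≤ D * m * u := by gcongr
  have hu1 : 1 * u ≤ D * m * u := by gcongr; linarith
  have hDu : D * u ≤ D * m * u := by gcongr
  have hfactors : (1 + D) * (1 + S) ≤ 10 * (D * m * u) :=
    calc (1 + D) * (1 + S) ≤ (2 * D) * (5 * u) := by gcongr <;> linarith
      _ ≤ 10 * (D * m * u) := by linarith
  have hsum : 1 + D + S + l ≤ 9 * (D * m * u) := by linarith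
  have hlast : B * (201 * (1 + D + S + l)) ≤ B * (201 * (9 * (D * m * u))) := by gcongr
  have hB1 : D * m * u ≤ B * (D * m * u) := le_mul_of_one_le_left (by linarith) hB
  linarith

theorem steps_evaluate_le_mul_log (hn : 2 ≤ n) (hd : 1 ≤ d) (hK : 0 < gridSize n d β)
    (hKn : gridSize n d β ≤ n) (bits : List Bool) {y : E d} (hy : y ∈ cube d) :
    ((evaluate qryProg n d β L bits y).steps : ℝ) ≤ 5000 * ((d : ℝ) *
      (max (strictFloor β) 1 : ℕ) * ((strictFloor β + d).choose d : ℝ) * Real.log n) := by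
  refine (Nat.cast_le.2 (steps_evaluate_le hK hKn hy bits)).trans ?_
  push_cast
  refine queryCost_le (Nat.one_le_cast.2 hd) (le_max_right _ _)
    (Nat.one_le_cast.2 (Nat.choose_pos (Nat.le_add_left _ _))) (Nat.cast_nonneg _)
    (le_max_left _ _) (size_le_three_mul_log hn) ?_
  linarith [Real.log_two_gt_d9, log_two_le_log_natCast hn]

end Resources

section SupremumError

variable {n d ℓ K : ℕ} {β L t : ℝ} {f : E d → ℝ}

theorem IsHolderDensity.integrable (hf : IsHolderDensity d β L f) : Integrable f :=
  .of_integral_ne_zero (hf.integral_eq_one.symm ▸ one_ne_zero)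

theorem IsHolderDensity.isProbabilityMeasure_sampleLaw (hf : IsHolderDensity d β L f) (n : ℕ) :
    IsProbabilityMeasure (sampleLaw n f) := by
  have : IsProbabilityMeasure
      ((volume : Measure (E d)).withDensity fun x => ENNReal.ofReal (f x)) := by
    constructor
    rw [withDensity_apply _ MeasurableSet.univ, Measure.restrict_univ,
      ← ofReal_integral_eq_lintegral_ofReal hf.integrable (Filter.Eventually.of_forall hf.nonneg),
      hf.integral_eq_one, ENNReal.ofReal_one]
  rw [sampleLaw]
  infer_instance

/-- The event that the estimator `fhat` of `f` is off by more than `t` at some mesh point. -/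
def badEvent {Ω : Type*} (ℓ K : ℕ) (t : ℝ) (fhat : Ω → E d → ℝ) (f : E d → ℝ) : Set Ω :=
  ⋃ p ∈ (Finset.univ : Finset (Fin d → Fin K)) ×ˢ weakComps d ℓ,
    {X | t < |fhat X (meshPoint ℓ K p.1 fun k => p.2 (k + 1)) -
      f (meshPoint ℓ K p.1 fun k => p.2 (k + 1))|}

theorem abs_sub_le_of_notMem_badEvent {Ω : Type*} {fhat : Ω → E d → ℝ} {X : Ω}
    (hX : X ∉ badEvent ℓ K t fhat f) (j : Fin d → Fin K) {s : ℕ → ℕ} (hs : s ∈ weakComps d ℓ) :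
    |fhat X (meshPoint ℓ K j fun k => s (k + 1)) - f (meshPoint ℓ K j fun k => s (k + 1))| ≤ t := by
  by_contra! h
  exact hX (Set.mem_biUnion (x := (j, s))
    (Finset.mem_product.2 ⟨Finset.mem_univ j, hs⟩) h)

theorem measurableSet_badEvent {Ω : Type*} [MeasurableSpace Ω] {fhat : Ω → E d → ℝ} (ℓ K : ℕ)
    (t : ℝ) (hfhat : ∀ y ∈ cube d, Measurable fun X => fhat X y) (f : E d → ℝ) :
    MeasurableSet (badEvent ℓ K t fhat f) := by
  refine Finset.measurableSet_biUnion _ fun p hp => ?_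
  have hmem := meshPoint_mem_cube p.1 (sum_tail_le_of_mem_weakComps (Finset.mem_product.1 hp).2)
  exact measurableSet_lt measurable_const (((hfhat _ hmem).sub_const _).abs)

theorem TailBound.sampleLaw_badEvent_le {cstar : ℝ} {fhat : Sample n d → E d → ℝ}
    (htail : TailBound β L cstar fhat) (hf : IsHolderDensity d β L f)
    (ht : cstar * rate n d β ≤ t) (ht1 : t ≤ 1) (ℓ K : ℕ) :
    sampleLaw n f (badEvent ℓ K t fhat f) ≤ ENNReal.ofReal
      (((K ^ d * (ℓ + d).choose d : ℕ) : ℝ) *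
        (2 * Real.exp (-(t ^ 2 / (cstar * rate n d β) ^ 2)))) := by
  refine (measure_biUnion_finset_le _ _).trans <|
    (Finset.sum_le_card_nsmul _ _ _ fun p hp => htail _ (meshPoint_mem_cube p.1
      (sum_tail_le_of_mem_weakComps (Finset.mem_product.1 hp).2)) t ht ht1 f hf).trans_eq ?_
  rw [Finset.card_product, card_weakComps, Finset.card_univ, Fintype.card_fun, Fintype.card_fin,
    Fintype.card_fin, nsmul_eq_mul, ENNReal.ofReal_mul (Nat.cast_nonneg _), ENNReal.ofReal_natCast]

variable (hf : IsHolderDensity d β L f) (hβ : 0 < β) (hL : 0 ≤ L) (hd : 1 ≤ d)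
include hf hβ hL hd

theorem IsHolderDensity.abs_quantize_sub_le (b : ℕ) (v : ℝ) (x : E d) :
    |quantize b L v - f x| ≤ L :=
  abs_sub_le_of_nonneg_of_le (quantize_nonneg hL b v) (quantize_le hL b v) (hf.nonneg x)
    (hf.le_bound hβ hL hd x)

theorem IsHolderDensity.abs_quantize_size_sub_le (hn : 0 < n) {v : ℝ} {x : E d}
    (hv : |v - f x| ≤ t) : |quantize n.size L v - f x| ≤ L / n + t := by
  have hclip := abs_clip_sub_clip_le L v (f x)
  rw [clip_of_mem (hf.nonneg x) (hf.le_bound hβ hL hd x)] at hclip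
  exact (abs_sub_le _ (clip L v) _).trans
    (add_le_add (abs_quantize_size_sub_clip_le hn hL v) (hclip.trans hv))

theorem IsHolderDensity.supDist_compressed_le_of_forall (hK : 0 < gridSize n d β)
    (hKn : gridSize n d β ≤ n) (g : E d → ℝ) {M : ℝ} (hM0 : 0 ≤ M)
    (hM : ∀ (j : Fin d → Fin (gridSize n d β)), ∀ s ∈ weakComps d (strictFloor β),
      |quantize n.size L (g (meshPoint (strictFloor β) _ j fun k => s (k + 1))) -
        f (meshPoint (strictFloor β) _ j fun k => s (k + 1))| ≤ M) :
    supDist (compressed preProg qryProg n d β L g) f ≤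
      ENNReal.ofReal (lebesgueConst d (strictFloor β) *
        (M + L * ((d : ℝ) / gridSize n d β) ^ β / (strictFloor β).factorial)) := by
  refine iSup₂_le fun y hy => ?_
  rw [compressed_eq_eval_interpPoly hK hKn hL g hy, Real.enorm_eq_ofReal_abs]
  exact ENNReal.ofReal_le_ofReal
    (hf.abs_eval_interpPoly_sub_le hβ hL hd (mem_subCube_cellOf hK hy) hM0 (hM _))

-- On the bad event the stored values and those of `f` still lie in `[0, L]`, so they differ by at
-- most `L`.
theorem IsHolderDensity.supDist_compressed_le {Ω : Type*} (hn : 0 < n)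
    (hK : 0 < gridSize n d β) (hKn : gridSize n d β ≤ n) (ht : 0 ≤ t) (fhat : Ω → E d → ℝ) (X : Ω) :
    supDist (compressed preProg qryProg n d β L (fhat X)) f ≤
      ENNReal.ofReal (lebesgueConst d (strictFloor β) * (L / n + t +
        L * ((d : ℝ) / gridSize n d β) ^ β / (strictFloor β).factorial)) +
      (badEvent (strictFloor β) (gridSize n d β) t fhat f).indicator
        (fun _ => ENNReal.ofReal (lebesgueConst d (strictFloor β) * L)) X := by
  have hΛ := lebesgueConst_nonneg d (strictFloor β)
  by_cases hX : X ∈ badEvent (strictFloor β) (gridSize n d β) t fhat f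
  · rw [Set.indicator_of_mem hX, ← ENNReal.ofReal_add (by positivity) (by positivity), ← mul_add]
    refine (hf.supDist_compressed_le_of_forall hβ hL hd hK hKn (fhat X) hL fun _ _ _ =>
      hf.abs_quantize_sub_le hβ hL hd _ _ _).trans (ENNReal.ofReal_le_ofReal ?_)
    have : 0 ≤ L / n + t := by positivity
    exact mul_le_mul_of_nonneg_left (by linarith) hΛ
  · rw [Set.indicator_of_notMem hX, add_zero]
    exact hf.supDist_compressed_le_of_forall hβ hL hd hK hKn (fhat X) (by positivity)
      fun j _ hs => hf.abs_quantize_size_sub_le hβ hL hd hn (abs_sub_le_of_notMem_badEvent hX j hs)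

end SupremumError

section RiskConstant

variable {n d ℓ : ℕ} {β L cstar : ℝ}

theorem rate_pos (hn : 0 < n) (d : ℕ) (β : ℝ) : 0 < rate n d β :=
  Real.rpow_pos_of_pos (Nat.cast_pos.2 hn) _

theorem inv_le_rate (hn : 0 < n) (hβ : 0 ≤ β) (d : ℕ) : (n : ℝ)⁻¹ ≤ rate n d β := by
  rw [rate, ← Real.rpow_neg_one]
  refine Real.rpow_le_rpow_of_exponent_le (Nat.one_le_cast.2 hn) (neg_le_neg ?_)
  exact div_le_one_of_le₀ (by linarith [(Nat.cast_nonneg d : (0 : ℝ) ≤ d)]) (by positivity)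

theorem sq_inv_le_rate (hn : 0 < n) (hβ : 0 ≤ β) (d : ℕ) : ((n : ℝ) ^ 2)⁻¹ ≤ rate n d β := by
  refine le_trans ?_ (inv_le_rate hn hβ d)
  have hn1 : (1 : ℝ) ≤ n := Nat.one_le_cast.2 hn
  exact inv_anti₀ (by positivity) (le_self_pow₀ hn1 two_ne_zero)

theorem inv_gridSize_le (hn : 0 < n) (hK : 0 < gridSize n d β) :
    (gridSize n d β : ℝ)⁻¹ ≤ 2 * ((n : ℝ) ^ (1 / (2 * β + d)))⁻¹ := by
  have hx : 0 < (n : ℝ) ^ (1 / (2 * β + d)) := Real.rpow_pos_of_pos (Nat.cast_pos.2 hn) _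
  have hK1 : (1 : ℝ) ≤ gridSize n d β := Nat.one_le_cast.2 hK
  have hfloor : (n : ℝ) ^ (1 / (2 * β + d)) < gridSize n d β + 1 := Nat.lt_floor_add_one _
  rw [← div_eq_mul_inv, le_div_iff₀ hx, inv_mul_le_iff₀ (by positivity)]
  linarith

theorem two_rpow_le (β : ℝ) : (2 : ℝ) ^ β ≤ 2 * 2 ^ strictFloor β :=
  calc (2 : ℝ) ^ β ≤ 2 ^ ((strictFloor β : ℝ) + 1) :=
        Real.rpow_le_rpow_of_exponent_le one_le_two (le_strictFloor_add_one β)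
    _ = 2 * 2 ^ strictFloor β := by
        rw [Real.rpow_add two_pos, Real.rpow_natCast, Real.rpow_one, mul_comm]

theorem div_gridSize_rpow_le (hn : 0 < n) (hβ : 0 ≤ β) (hK : 0 < gridSize n d β) :
    ((d : ℝ) / gridSize n d β) ^ β ≤ (d : ℝ) ^ β * (2 * 2 ^ strictFloor β * rate n d β) :=
  calc ((d : ℝ) / gridSize n d β) ^ β
      = (d : ℝ) ^ β * (gridSize n d β : ℝ)⁻¹ ^ β := by
        rw [div_eq_mul_inv, Real.mul_rpow (by positivity) (by positivity)]
    _ ≤ (d : ℝ) ^ β * (2 * ((n : ℝ) ^ (1 / (2 * β + d)))⁻¹) ^ β := by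
        gcongr
        exact inv_gridSize_le hn hK
    _ = (d : ℝ) ^ β * (2 ^ β * rate n d β) := by
        rw [Real.mul_rpow zero_le_two (by positivity), ← Real.rpow_neg (Nat.cast_nonneg n),
          ← Real.rpow_mul (Nat.cast_nonneg n), rate]
        congr 3
        ring
    _ ≤ (d : ℝ) ^ β * (2 * 2 ^ strictFloor β * rate n d β) := by
        have := rate_pos hn d β
        gcongr
        exact two_rpow_le β

theorem one_le_choose (d ℓ : ℕ) : (1 : ℝ) ≤ ((ℓ + d).choose d : ℝ) :=
  Nat.one_le_cast.2 (Nat.choose_pos (Nat.le_add_left d ℓ))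

theorem two_pow_mul_factorial_mul_pow_le (ℓ : ℕ) :
    (2 : ℝ) ^ ℓ * (ℓ.factorial * (ℓ : ℝ) ^ ℓ) ≤ (2 * (ℓ : ℝ)) ^ (2 * ℓ) :=
  calc (2 : ℝ) ^ ℓ * (ℓ.factorial * (ℓ : ℝ) ^ ℓ)
      ≤ (2 ^ ℓ * 2 ^ ℓ) * ((ℓ : ℝ) ^ ℓ * (ℓ : ℝ) ^ ℓ) := by
        gcongr
        · exact le_mul_of_one_le_left (by positivity) (one_le_pow₀ one_le_two)
        · exact_mod_cast Nat.factorial_le_pow ℓ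
    _ = (2 * (ℓ : ℝ)) ^ (2 * ℓ) := by
        rw [mul_pow, two_mul ℓ, pow_add, pow_add]

/-- The factor `binom(ℓ+d, d)^3 (2ℓ)^{2ℓ}` of the constant in the risk bound. -/
noncomputable def riskFactor (d ℓ : ℕ) : ℝ :=
  ((ℓ + d).choose d : ℝ) ^ 3 * (2 * (ℓ : ℝ)) ^ (2 * ℓ)

theorem riskFactor_nonneg (d ℓ : ℕ) : 0 ≤ riskFactor d ℓ := by
  rw [riskFactor, pow_mul]
  positivity

theorem riskConst_eq (d : ℕ) (β L cstar : ℝ) :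
    riskConst d β L cstar = 10 * riskFactor d (strictFloor β) *
        (cstar + L * (d : ℝ) ^ β / (strictFloor β).factorial) +
      2 * L * (d : ℝ) ^ ((3 * (strictFloor β : ℝ) + 1) / 2) := by
  rw [riskConst, riskFactor, Nat.choose_symm_add, mul_assoc (10 : ℝ)]

theorem two_pow_mul_lebesgueConst_mul_choose_le (d ℓ : ℕ) :
    2 ^ ℓ * lebesgueConst d ℓ * (ℓ + d).choose d ≤ riskFactor d ℓ := by
  have hpow : (d : ℝ) ^ ℓ ≤ ℓ.factorial * ((ℓ + d).choose d : ℝ) := by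
    exact_mod_cast pow_le_factorial_mul_choose d ℓ
  calc 2 ^ ℓ * lebesgueConst d ℓ * (ℓ + d).choose d
      = 2 ^ ℓ * ((ℓ + d).choose d : ℝ) * (d : ℝ) ^ ℓ * (ℓ : ℝ) ^ ℓ * (ℓ + d).choose d := by
        rw [lebesgueConst, mul_pow]
        ring
    _ ≤ 2 ^ ℓ * ((ℓ + d).choose d : ℝ) * (ℓ.factorial * ((ℓ + d).choose d : ℝ)) * (ℓ : ℝ) ^ ℓ *
          (ℓ + d).choose d := by gcongr
    _ = ((ℓ + d).choose d : ℝ) ^ 3 * (2 ^ ℓ * (ℓ.factorial * (ℓ : ℝ) ^ ℓ)) := by ring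
    _ ≤ riskFactor d ℓ := by
        rw [riskFactor]
        gcongr
        exact two_pow_mul_factorial_mul_pow_le ℓ

theorem lebesgueConst_mul_choose_le (d ℓ : ℕ) :
    lebesgueConst d ℓ * (ℓ + d).choose d ≤ riskFactor d ℓ := by
  refine le_trans ?_ (two_pow_mul_lebesgueConst_mul_choose_le d ℓ)
  gcongr
  exact le_mul_of_one_le_left (lebesgueConst_nonneg d ℓ) (one_le_pow₀ one_le_two)

theorem two_pow_mul_lebesgueConst_le (d ℓ : ℕ) : 2 ^ ℓ * lebesgueConst d ℓ ≤ riskFactor d ℓ :=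
  (le_mul_of_one_le_right (mul_nonneg (by positivity) (lebesgueConst_nonneg d ℓ))
    (one_le_choose d ℓ)).trans (two_pow_mul_lebesgueConst_mul_choose_le d ℓ)

theorem lebesgueConst_le (hd : 1 ≤ d) (hβ : 0 < β) : lebesgueConst d (strictFloor β) ≤
    riskFactor d (strictFloor β) * ((d : ℝ) ^ β / (strictFloor β).factorial) := by
  set ℓ := strictFloor β
  have hB : ((ℓ + d).choose d : ℝ) ≤ ((ℓ + d).choose d : ℝ) ^ 3 :=
    le_self_pow₀ (one_le_choose d ℓ) three_ne_zero
  have hdβ : (d : ℝ) ^ ℓ ≤ (d : ℝ) ^ β := by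
    rw [← Real.rpow_natCast]
    exact Real.rpow_le_rpow_of_exponent_le (Nat.one_le_cast.2 hd) (strictFloor_lt hβ).le
  have hℓ : (ℓ.factorial : ℝ) * (ℓ : ℝ) ^ ℓ ≤ (2 * (ℓ : ℝ)) ^ (2 * ℓ) :=
    (le_mul_of_one_le_left (by positivity) (one_le_pow₀ one_le_two)).trans
      (two_pow_mul_factorial_mul_pow_le ℓ)
  rw [← mul_div_assoc, le_div_iff₀ (by positivity)]
  calc lebesgueConst d ℓ * ℓ.factorial
      = ((ℓ + d).choose d : ℝ) * (ℓ.factorial * (ℓ : ℝ) ^ ℓ) * (d : ℝ) ^ ℓ := by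
        rw [lebesgueConst, mul_pow]
        ring
    _ ≤ riskFactor d ℓ * (d : ℝ) ^ β := by
        rw [riskFactor]
        gcongr

end RiskConstant

section Risk

variable {n d : ℕ} {β L cstar : ℝ}

/-- The square of the ratio `t / ε` of the error level `t` to the scale `ε` of the estimator. It is
chosen such that the union bound over the mesh gives probability `n⁻²` for the bad event. -/
noncomputable def logLevel (n d : ℕ) (β : ℝ) : ℝ :=
  Real.log (2 * ((strictFloor β + d).choose d : ℝ) * (n : ℝ) ^ ((d : ℝ) / (2 * β + d) + 2))

theorem logLevel_eq (hn : 0 < n) (d : ℕ) (β : ℝ) :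
    logLevel n d β = Real.log 2 + Real.log ((strictFloor β + d).choose d : ℝ) +
      ((d : ℝ) / (2 * β + d) + 2) * Real.log n := by
  have hn0 : (0 : ℝ) < n := Nat.cast_pos.2 hn
  have hB := one_le_choose d (strictFloor β)
  rw [logLevel, Real.log_mul (by positivity) (by positivity),
    Real.log_mul two_ne_zero (by positivity), Real.log_rpow hn0]

theorem one_le_logLevel (hn : 2 ≤ n) (hβ : 0 ≤ β) (d : ℕ) : 1 ≤ logLevel n d β := by
  have hlogB := Real.log_nonneg (one_le_choose d (strictFloor β))
  have hexponent : 0 ≤ (d : ℝ) / (2 * β + d) := by positivity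
  rw [logLevel_eq (two_pos.trans_le hn)]
  nlinarith [Real.log_two_gt_d9, log_two_le_log_natCast hn]

theorem logLevel_le (hn : 2 ≤ n) (hβ : 0 ≤ β) (d : ℕ) :
    logLevel n d β ≤ (3 * ((strictFloor β + d).choose d : ℝ)) ^ 2 * Real.log n := by
  have hB := one_le_choose d (strictFloor β)
  have hlog2 := log_two_le_log_natCast hn
  have hlog : (0.69 : ℝ) ≤ Real.log n := by linarith [Real.log_two_gt_d9]
  have hexponent : (d : ℝ) / (2 * β + d) * Real.log n ≤ Real.log n :=
    mul_le_of_le_one_left (by linarith)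
      (div_le_one_of_le₀ (by linarith) (by positivity))
  have hlogB := Real.log_le_sub_one_of_pos (by linarith : (0 : ℝ) < (strictFloor β + d).choose d)
  rw [logLevel_eq (two_pos.trans_le hn)]
  set B := ((strictFloor β + d).choose d : ℝ)
  have hBlog : B * 0.69 ≤ B * Real.log n := by gcongr
  have hlogBlog : 1 * Real.log n ≤ B * Real.log n := by gcongr
  have hsq : 1 * (B * Real.log n) ≤ B * (B * Real.log n) := by gcongr
  linarith [(by ring : (3 * B) ^ 2 * Real.log n = 9 * (B * (B * Real.log n)))]

theorem sqrt_logLevel_le (hn : 2 ≤ n) (hβ : 0 ≤ β) (d : ℕ) :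
    √(logLevel n d β) ≤ 3 * ((strictFloor β + d).choose d : ℝ) * √(Real.log n) := by
  refine (Real.sqrt_le_sqrt (logLevel_le hn hβ d)).trans_eq ?_
  rw [Real.sqrt_mul (by positivity), Real.sqrt_sq (by positivity)]

theorem card_mesh_mul_exp_neg_logLevel_le (hn : 0 < n) (d : ℕ) (β : ℝ) :
    ((gridSize n d β ^ d * (strictFloor β + d).choose d : ℕ) : ℝ) *
      (2 * Real.exp (-logLevel n d β)) ≤ ((n : ℝ) ^ 2)⁻¹ := by
  have hn0 : (0 : ℝ) < n := Nat.cast_pos.2 hn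
  have hB := one_le_choose d (strictFloor β)
  have hpow : (n : ℝ) ^ ((d : ℝ) / (2 * β + d) + 2) =
      (n : ℝ) ^ ((d : ℝ) / (2 * β + d)) * (n : ℝ) ^ 2 := by
    rw [Real.rpow_add hn0, Real.rpow_two]
  calc ((gridSize n d β ^ d * (strictFloor β + d).choose d : ℕ) : ℝ) *
        (2 * Real.exp (-logLevel n d β))
      ≤ meshCount n d β * (2 * Real.exp (-logLevel n d β)) := by
        gcongr
        exact gridSize_pow_mul_choose_le n d β
    _ = ((n : ℝ) ^ 2)⁻¹ := by
        have hD : (n : ℝ) ^ ((d : ℝ) / (2 * β + d)) ≠ 0 := by positivity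
        rw [logLevel, Real.exp_neg, Real.exp_log (by positivity), hpow, meshCount]
        field_simp

theorem lebesgueConst_mul_level_le (hn : 2 ≤ n) (hβ : 0 ≤ β) (hc : 0 ≤ cstar) (d : ℕ) :
    lebesgueConst d (strictFloor β) * (cstar * rate n d β * √(logLevel n d β)) ≤
      3 * riskFactor d (strictFloor β) * cstar * √(Real.log n) * rate n d β := by
  have hρ := rate_pos (two_pos.trans_le hn) d β
  have hΛ := lebesgueConst_nonneg d (strictFloor β)
  calc lebesgueConst d (strictFloor β) * (cstar * rate n d β * √(logLevel n d β))
      ≤ lebesgueConst d (strictFloor β) * (cstar * rate n d β *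
          (3 * ((strictFloor β + d).choose d : ℝ) * √(Real.log n))) := by
        gcongr
        exact sqrt_logLevel_le hn hβ d
    _ = 3 * (lebesgueConst d (strictFloor β) * (strictFloor β + d).choose d) * cstar *
          √(Real.log n) * rate n d β := by ring
    _ ≤ 3 * riskFactor d (strictFloor β) * cstar * √(Real.log n) * rate n d β := by
        gcongr
        exact lebesgueConst_mul_choose_le d (strictFloor β)

theorem lebesgueConst_mul_bias_le (hn : 0 < n) (hβ : 0 ≤ β) (hL : 0 ≤ L)
    (hK : 0 < gridSize n d β) :
    lebesgueConst d (strictFloor β) *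
        (L * ((d : ℝ) / gridSize n d β) ^ β / (strictFloor β).factorial) ≤
      2 * riskFactor d (strictFloor β) * (L * (d : ℝ) ^ β / (strictFloor β).factorial) *
        rate n d β := by
  have hρ := rate_pos hn d β
  have hΛ := lebesgueConst_nonneg d (strictFloor β)
  calc lebesgueConst d (strictFloor β) *
        (L * ((d : ℝ) / gridSize n d β) ^ β / (strictFloor β).factorial)
      ≤ lebesgueConst d (strictFloor β) * (L * ((d : ℝ) ^ β * (2 * 2 ^ strictFloor β *
          rate n d β)) / (strictFloor β).factorial) := by
        gcongr
        exact div_gridSize_rpow_le hn hβ hK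
    _ = 2 * (2 ^ strictFloor β * lebesgueConst d (strictFloor β)) *
          (L * (d : ℝ) ^ β / (strictFloor β).factorial) * rate n d β := by ring
    _ ≤ 2 * riskFactor d (strictFloor β) * (L * (d : ℝ) ^ β / (strictFloor β).factorial) *
          rate n d β := by
        gcongr
        exact two_pow_mul_lebesgueConst_le d (strictFloor β)

theorem lebesgueConst_mul_le_of_le_rate (hd : 1 ≤ d) (hβ : 0 < β) (hL : 0 ≤ L) {x : ℝ}
    (hx0 : 0 ≤ x) (hx : x ≤ rate n d β) :
    lebesgueConst d (strictFloor β) * (L * x) ≤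
      riskFactor d (strictFloor β) * (L * (d : ℝ) ^ β / (strictFloor β).factorial) *
        rate n d β := by
  have hP := riskFactor_nonneg d (strictFloor β)
  calc lebesgueConst d (strictFloor β) * (L * x)
      ≤ riskFactor d (strictFloor β) * ((d : ℝ) ^ β / (strictFloor β).factorial) *
          (L * rate n d β) := by
        gcongr
        exact lebesgueConst_le hd hβ
    _ = _ := by ring

theorem riskBound_lt (hn : 2 ≤ n) (hd : 1 ≤ d) (hβ : 0 < β) (hL : 0 < L) (hc : 0 ≤ cstar)
    (hK : 0 < gridSize n d β) :
    lebesgueConst d (strictFloor β) * (L / n + cstar * rate n d β * √(logLevel n d β) +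
        L * ((d : ℝ) / gridSize n d β) ^ β / (strictFloor β).factorial) +
      lebesgueConst d (strictFloor β) * L * ((n : ℝ) ^ 2)⁻¹ <
    riskConst d β L cstar * (Real.log n) ^ (1 / 2 : ℝ) * rate n d β := by
  have hn0 : 0 < n := two_pos.trans_le hn
  have hlevel := lebesgueConst_mul_level_le hn hβ.le hc d
  have hbias := lebesgueConst_mul_bias_le hn0 hβ.le hL.le hK
  have hrounding := lebesgueConst_mul_le_of_le_rate hd hβ hL.le (by positivity)
    (inv_le_rate hn0 hβ.le d)
  have hbad := lebesgueConst_mul_le_of_le_rate hd hβ hL.le (by positivity)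
    (sq_inv_le_rate hn0 hβ.le d)
  rw [← Real.sqrt_eq_rpow, riskConst_eq, mul_add, mul_add, mul_assoc _ L, div_eq_mul_inv L]
  set P := riskFactor d (strictFloor β)
  set Y := L * (d : ℝ) ^ β / (strictFloor β).factorial
  set w := 2 * L * (d : ℝ) ^ ((3 * (strictFloor β : ℝ) + 1) / 2)
  have hP : 0 ≤ P := riskFactor_nonneg d _
  have hρ := rate_pos hn0 d β
  have hsqrt : (0.8 : ℝ) ≤ √(Real.log n) :=
    Real.le_sqrt_of_sq_le (by linarith [Real.log_two_gt_d9, log_two_le_log_natCast hn])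
  have hY : P * Y * rate n d β * 0.8 ≤ P * Y * rate n d β * √(Real.log n) := by gcongr
  have hY0 : 0 ≤ P * Y * rate n d β := by positivity
  have hc0 : 0 ≤ P * cstar * √(Real.log n) * rate n d β := by positivity
  have hw : 0 < w * √(Real.log n) * rate n d β := by positivity
  linarith [(by ring : (10 * P * (cstar + Y) + w) * √(Real.log n) * rate n d β =
    10 * (P * cstar * √(Real.log n) * rate n d β) + 10 * (P * Y * rate n d β * √(Real.log n)) +
      w * √(Real.log n) * rate n d β)]

theorem sampleLaw_badEvent_le_sq_inv (hn : 2 ≤ n) (hβ : 0 ≤ β) (hc : 0 < cstar)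
    {fhat : Sample n d → E d → ℝ} (htail : TailBound β L cstar fhat)
    (hlevel : cstar * rate n d β * √(logLevel n d β) ≤ 1)
    {f : E d → ℝ} (hf : IsHolderDensity d β L f) :
    sampleLaw n f (badEvent (strictFloor β) (gridSize n d β)
        (cstar * rate n d β * √(logLevel n d β)) fhat f) ≤
      ENNReal.ofReal ((n : ℝ) ^ 2)⁻¹ := by
  have hn0 : 0 < n := two_pos.trans_le hn
  have hε : 0 < cstar * rate n d β := mul_pos hc (rate_pos hn0 d β)
  have hA := one_le_logLevel hn hβ d
  have hratio : (cstar * rate n d β * √(logLevel n d β)) ^ 2 / (cstar * rate n d β) ^ 2 =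
      logLevel n d β := by
    rw [mul_pow, Real.sq_sqrt (zero_le_one.trans hA), mul_div_cancel_left₀ _ (by positivity)]
  refine (htail.sampleLaw_badEvent_le hf
    (le_mul_of_one_le_right hε.le (Real.one_le_sqrt.2 hA)) hlevel _ _).trans ?_
  rw [hratio]
  exact ENNReal.ofReal_le_ofReal (card_mesh_mul_exp_neg_logLevel_le hn0 d β)

theorem lintegral_supDist_compressed_lt (hn : 2 ≤ n) (hd : 1 ≤ d) (hβ : 0 < β) (hL : 0 < L)
    (hc : 0 < cstar) {fhat : Sample n d → E d → ℝ}
    (hfhat : ∀ y ∈ cube d, Measurable fun X => fhat X y) (htail : TailBound β L cstar fhat)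
    (hlevel : cstar * rate n d β * √(logLevel n d β) ≤ 1)
    {f : E d → ℝ} (hf : IsHolderDensity d β L f) :
    ∫⁻ X, supDist (compressed preProg qryProg n d β L (fhat X)) f ∂(sampleLaw n f) <
      ENNReal.ofReal (riskConst d β L cstar * (Real.log n) ^ (1 / 2 : ℝ) * rate n d β) := by
  have hn0 : 0 < n := two_pos.trans_le hn
  have hK : 0 < gridSize n d β := gridSize_pos hn0 hβ.le
  have hΛ := lebesgueConst_nonneg d (strictFloor β)
  have hρ := rate_pos hn0 d β
  have := hf.isProbabilityMeasure_sampleLaw n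
  set t := cstar * rate n d β * √(logLevel n d β)
  set M := lebesgueConst d (strictFloor β) * (L / n + t +
    L * ((d : ℝ) / gridSize n d β) ^ β / (strictFloor β).factorial)
  set bad := badEvent (strictFloor β) (gridSize n d β) t fhat f
  calc ∫⁻ X, supDist (compressed preProg qryProg n d β L (fhat X)) f ∂(sampleLaw n f)
      ≤ ∫⁻ X, ENNReal.ofReal M + bad.indicator
          (fun _ => ENNReal.ofReal (lebesgueConst d (strictFloor β) * L)) X ∂(sampleLaw n f) :=
        lintegral_mono fun X => hf.supDist_compressed_le hβ hL.le hd hn0 hK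
          (gridSize_le hn0 hd hβ.le) (by positivity) fhat X
    _ = ENNReal.ofReal M +
          ENNReal.ofReal (lebesgueConst d (strictFloor β) * L) * sampleLaw n f bad := by
        rw [lintegral_add_left measurable_const, lintegral_const, measure_univ, mul_one,
          lintegral_indicator_const (measurableSet_badEvent _ _ t hfhat f)]
    _ ≤ ENNReal.ofReal M + ENNReal.ofReal (lebesgueConst d (strictFloor β) * L) *
          ENNReal.ofReal ((n : ℝ) ^ 2)⁻¹ := by
        gcongr
        exact sampleLaw_badEvent_le_sq_inv hn hβ.le hc htail hlevel hf
    _ = ENNReal.ofReal (M + lebesgueConst d (strictFloor β) * L * ((n : ℝ) ^ 2)⁻¹) := by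
        rw [← ENNReal.ofReal_mul (by positivity), ← ENNReal.ofReal_add (by positivity)
          (by positivity)]
    _ < _ := (ENNReal.ofReal_lt_ofReal_iff_of_nonneg (by positivity)).2
        (riskBound_lt hn hd hβ hL hc.le hK)

end Risk

end DensityInterp

theorem theorem1 :
    ∃ (C : ℝ) (pre qry : DensityInterp.Prog), 0 < C ∧
      ∀ (n d : ℕ) (β L cstar : ℝ), 2 ≤ n → 1 ≤ d → 0 < β → 0 < L → 0 < cstar →
      ∀ fhat : DensityInterp.Sample n d → DensityInterp.E d → ℝ,
        (∀ y ∈ DensityInterp.cube d, Measurable fun X => fhat X y) →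
        DensityInterp.TailBound β L cstar fhat →
        -- for every sample: construction, storage, queries, shape of the new estimator
        (∀ X : DensityInterp.Sample n d,
          (∀ Q : ℝ, (d : ℝ) + Real.log n ≤ Q →
            (DensityInterp.preprocess pre n d β L (fhat X)).time Q
              ≤ C * (Q * DensityInterp.meshCount n d β)) ∧
          ((DensityInterp.preprocess pre n d β L (fhat X)).asked.length : ℝ)
              ≤ DensityInterp.meshCount n d β ∧
          (∀ u ∈ (DensityInterp.preprocess pre n d β L (fhat X)).asked,
            ∃ (j : Fin d → Fin (DensityInterp.gridSize n d β)) (s : Fin d → ℕ),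
              ∑ i, s i ≤ DensityInterp.strictFloor β ∧
              u = DensityInterp.meshPoint (DensityInterp.strictFloor β)
                (DensityInterp.gridSize n d β) j s) ∧
          ((DensityInterp.preprocess pre n d β L (fhat X)).out.length : ℝ)
              ≤ C * ((d : ℝ) ^ 2 * (max (DensityInterp.strictFloor β) 1 : ℕ) ^ 2
                * DensityInterp.meshCount n d β * Real.log n) ∧
          (∀ y ∈ DensityInterp.cube d,
            ((DensityInterp.evaluate qry n d β L
                (DensityInterp.preprocess pre n d β L (fhat X)).out y).steps : ℝ)
              ≤ C * ((d : ℝ) * (max (DensityInterp.strictFloor β) 1 : ℕ)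
                * ((DensityInterp.strictFloor β + d).choose d : ℝ) * Real.log n)) ∧
          DensityInterp.IsInterpolant (DensityInterp.strictFloor β)
            (DensityInterp.gridSize n d β) L (L / n) (fhat X)
            (DensityInterp.compressed pre qry n d β L (fhat X))) ∧
        -- the new estimator is measurable in the sample
        (∀ y ∈ DensityInterp.cube d,
          Measurable fun X => DensityInterp.compressed pre qry n d β L (fhat X) y) ∧
        -- the risk bound
        (cstar * DensityInterp.rate n d β
            * √(Real.log (2 * ((DensityInterp.strictFloor β + d).choose d : ℝ)
                * (n : ℝ) ^ ((d : ℝ) / (2 * β + d) + 2))) ≤ 1 →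
          ∀ f : DensityInterp.E d → ℝ, DensityInterp.IsHolderDensity d β L f →
            (Measurable fun X : DensityInterp.Sample n d =>
              DensityInterp.supDist (DensityInterp.compressed pre qry n d β L (fhat X)) f) ∧
            ∫⁻ X, DensityInterp.supDist (DensityInterp.compressed pre qry n d β L (fhat X)) f
                ∂(DensityInterp.sampleLaw n f)
              < ENNReal.ofReal (DensityInterp.riskConst d β L cstar
                * (Real.log n) ^ (1 / 2 : ℝ) * DensityInterp.rate n d β)) := by
  refine ⟨5000, DensityInterp.preProg, DensityInterp.qryProg, by norm_num,
    fun n d β L cstar hn hd hβ hL hc fhat hfhat htail => ?_⟩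
  have hn0 : 0 < n := two_pos.trans_le hn
  have hK : 0 < DensityInterp.gridSize n d β := DensityInterp.gridSize_pos hn0 hβ.le
  have hKn : DensityInterp.gridSize n d β ≤ n := DensityInterp.gridSize_le hn0 hd hβ.le
  exact
    ⟨fun X =>
      ⟨fun _ hQ => DensityInterp.time_preprocess_le hn hd hK hL.le _ hQ,
        DensityInterp.length_asked_preprocess_le hK hL.le _,
        fun _ hu => DensityInterp.exists_meshPoint_of_mem_asked_preprocess hK hL.le _ hu,
        DensityInterp.length_out_preprocess_le hn hd hK hL.le _,
        fun _ hy => DensityInterp.steps_evaluate_le_mul_log hn hd hK hKn _ hy,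
        DensityInterp.isInterpolant_compressed hn0 hK hKn hL.le _⟩,
      fun y _ => DensityInterp.measurable_compressed hK hL.le hfhat _ y,
      fun hlevel f hf =>
        ⟨DensityInterp.measurable_supDist_compressed hK hL.le hfhat _ f,
          DensityInterp.lintegral_supDist_compressed_lt hn hd hβ hL hc hfhat htail hlevel hf⟩⟩
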